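/- For an additive abelian group $G$, let $\mathcal B(G)$ be the monoid of zero-sum sequences over $G$, that is, of all finite unordered sequences (multisets) of elements of $G$, repetition allowed, whose sum is $0$, with concatenation as operation. For a non-invertible (that is, non-empty) $A\in\mathcal B(G)$ let $\mathsf L(A)$ be the set of all $k\in\mathbb N$ such that $A$ is a product of $k$ irreducible elements of $\mathcal B(G)$, set $\mathsf L(1)=\{0\}$ for the empty sequence $1$, and let $\mathcal L(G)=\{\mathsf L(A)\mid A\in\mathcal B(G)\}$. Here $\mathbb N=\{1,2,\dots\}$, $\mathbb N_0=\mathbb N\cup\{0\}$, $[a,b]=\{x\in\mathbb Z\mid a\le x\le b\}$ for integers $a \le b$, $y+L=\{y+x\mid x\in L\}$, $L+L'=\{x+x'\mid x\in L,\ x'\in L'\}$ and $d\cdot L=\{dx\mid x\in L\}$. Let $C_2^4$ be the elementary abelian $2$-group of rank $4$. Then $$\mathcal L(C_2^4)=\mathcal L_1\cup\mathcal L_2\cup\mathcal L_3\cup\mathcal L_4\cup\mathcal L_5\cup\mathcal L_6\cup\mathcal L_7\cup\mathcal L_8,$$ where \begin{align*} \mathcal L_1&=\big\{\{y\}\mid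 y\in\mathbb N_0\big\},\\ \mathcal L_2&=\big\{y+2k+3\cdot[0,k]\mid y,k\in\mathbb N_0\big\},\\ \mathcal L_3&=\big\{y+[2,3],\ y+[2,4],\ y+[3,6],\ y+[3,7],\ y+[4,9]\mid y\in\mathbb N_0\big\}\\ &\quad\cup\big\{y+[m,m+k]\mid y\in\mathbb N_0,\ k\ge 6,\ m\in\mathbb N_0\text{ minimal with }m+k\le 5m/2\big\}\\ &=\big\{y+\lceil 2k/3\rceil+[0,k]\mid y\in\mathbb N_0,\ k\in\mathbb N\setminus\{1,3\}\big\}\cup\big\{y+3+[0,3],\ y+2+[0,1]\mid y\in\mathbb N_0\big\},\\ \mathcal L_4&=\big\{y+2k+2\cdot[0,k]\mid y,k\in\mathbb N_0\big\},\\ \mathcal L_5&=\big\{y+k+2+([0,k]\cup\{k+2\})\mid y\in\mathbb N_0,\ k\in\mathbb N\big\},\\ \mathcal L_6&=\big\{y+2\lceil k/3\rceil+2+(\{0\}\cup[2,k+2])\mid y\in\mathbb N_0,\ k\ge 5\text{ or }k=3\big\},\\ \mathcal L_7&=\big\{y+2k+3+\{0,1,3\}+3\cdot[0,k]\mid y,k\in\mathbb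 N_0\big\}\\ &\quad\cup\big\{(y+2k+4+\{0,1,3\}+3\cdot[0,k])\cup\{y+5k+8\}\mid y,k\in\mathbb N_0\big\},\\ \mathcal L_8&=\big\{y+2k+3+\{0,2,3\}+3\cdot[0,k]\mid y,k\in\mathbb N_0\big\}\\ &\quad\cup\big\{(y+2k+4+\{0,2,3\}+3\cdot[0,k])\cup\{y+5k+9\}\mid y,k\in\mathbb N_0\big\}. \end{align*} In particular, the two descriptions of $\mathcal L_3$ define the same family. -/

import Mathlib

namespace SetsOfLengths

open scoped Pointwise

/-- The set of lengths of an element `a` of a commutative monoid, written additively: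
`{0}` if `a` is invertible, and otherwise the set of all positive `k` such that `a` is a sum
of `k` atoms (irreducible elements). -/
def lengths {H : Type*} [AddCommMonoid H] (a : H) : Set ℕ :=
  {k | (IsAddUnit a ∧ k = 0) ∨
    (¬ IsAddUnit a ∧ 0 < k ∧
      ∃ z : Multiset H, z.card = k ∧ (∀ u ∈ z, AddIrreducible u) ∧ z.sum = a)}

/-- The system of sets of lengths of a commutative monoid, written additively. -/
def lengthSystem (H : Type*) [AddCommMonoid H] : Set (Set ℕ) :=
  Set.range (lengths : H → Set ℕ)

/-- The monoid of zero-sum sequences over an abelian group `G`: finite unordered sequences with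
repetition (multisets) of elements of `G` whose sum is zero, under concatenation. -/
def zeroSumSequences (G : Type*) [AddCommGroup G] : AddSubmonoid (Multiset G) where
  carrier := {S | S.sum = 0}
  add_mem' := by
    intro a b ha hb
    change (a + b).sum = 0
    rw [Multiset.sum_add, show a.sum = 0 from ha, show b.sum = 0 from hb, add_zero]
  zero_mem' := Multiset.sum_zero

/-- The dilation `d · L = {d * x | x ∈ L}`. -/
def dilate (d : ℕ) (L : Set ℕ) : Set ℕ := (fun x => d * x) '' L

/-! Below, `+` between sets of natural numbers is the sumset (Minkowski sum), so that
`{y} + L` is the shift of `L` by `y`. -/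

/-- Singletons. -/
def family1 : Set (Set ℕ) := {L | ∃ y : ℕ, L = {y}}

/-- Arithmetical progressions with difference `3`. -/
def family2 : Set (Set ℕ) :=
  {L | ∃ y k : ℕ, L = {y + 2 * k} + dilate 3 (Set.Icc 0 k)}

/-- Intervals, described by five exceptional shapes and an extremality condition. -/
def family3 : Set (Set ℕ) :=
  {L | ∃ y : ℕ, L = {y} + Set.Icc 2 3 ∨ L = {y} + Set.Icc 2 4 ∨ L = {y} + Set.Icc 3 6 ∨
    L = {y} + Set.Icc 3 7 ∨ L = {y} + Set.Icc 4 9} ∪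
  {L | ∃ y k m : ℕ, 6 ≤ k ∧ IsLeast {n : ℕ | (n : ℚ) + k ≤ 5 * n / 2} m ∧
    L = {y} + Set.Icc m (m + k)}

/-- Intervals, described by a closed formula for the minimum. -/
def family3' : Set (Set ℕ) :=
  {L | ∃ y k : ℕ, 1 ≤ k ∧ k ≠ 1 ∧ k ≠ 3 ∧
    L = {y + ⌈(2 * k : ℚ) / 3⌉₊} + Set.Icc 0 k} ∪
  {L | ∃ y : ℕ, L = {y + 3} + Set.Icc 0 3 ∨ L = {y + 2} + Set.Icc 0 1}

/-- Arithmetical progressions with difference `2`. -/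
def family4 : Set (Set ℕ) :=
  {L | ∃ y k : ℕ, L = {y + 2 * k} + dilate 2 (Set.Icc 0 k)}

/-- Intervals with a gap before the maximum. -/
def family5 : Set (Set ℕ) :=
  {L | ∃ y k : ℕ, 1 ≤ k ∧ L = {y + k + 2} + (Set.Icc 0 k ∪ {k + 2})}

/-- Intervals with a gap after the minimum. -/
def family6 : Set (Set ℕ) :=
  {L | ∃ y k : ℕ, (5 ≤ k ∨ k = 3) ∧
    L = {y + 2 * ⌈(k : ℚ) / 3⌉₊ + 2} + ({0} ∪ Set.Icc 2 (k + 2))}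

/-- Multiprogressions with period `{0, 1, 3}`. -/
def family7 : Set (Set ℕ) :=
  {L | ∃ y k : ℕ, L = {y + 2 * k + 3} + {0, 1, 3} + dilate 3 (Set.Icc 0 k)} ∪
  {L | ∃ y k : ℕ, L = ({y + 2 * k + 4} + {0, 1, 3} + dilate 3 (Set.Icc 0 k)) ∪ {y + 5 * k + 8}}

/-- Multiprogressions with period `{0, 2, 3}`. -/
def family8 : Set (Set ℕ) :=
  {L | ∃ y k : ℕ, L = {y + 2 * k + 3} + {0, 2, 3} + dilate 3 (Set.Icc 0 k)} ∪
  {L | ∃ y k : ℕ, L = ({y + 2 * k + 4} + {0, 2, 3} + dilate 3 (Set.Icc 0 k)) ∪ {y + 5 * k + 9}}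

end SetsOfLengths

/-! An atom over $C_2^4$ is the element $0$, a square $g^2$, or a circuit: a zero-sum set of three
to five nonzero elements. There are no larger circuits because five elements are always dependent.
Give a circuit with $n$ elements the weight $n-2$ and the other atoms the weight $0$. Then $2k+w=N$
for a factorization of length $k$ and weight $w$, where $N$ is the number of elements with $0$
counted twice (`card_cover`, `lengths_eq`). Sets of lengths are thus reflected sets of weights. All
weights of a sequence have the same parity and satisfy $5w\le 3|A|$.

The main question is where the set of weights can have a gap: $w$ occurs, something smaller occurs,
but $w-2$ does not. Take a factorization of weight $w$ with as few circuits as possible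
(`ReducedGap`). Replacing two circuits by their symmetric difference and the squares of their common
elements shows that distinct circuits are disjoint, or have five and four elements and share three
(`ReducedGap.pair_cases`). Counting shows that some two circuits, possibly equal, do overlap
(`ReducedGap.exists_not_disjoint`). Finite searches, carried out up to automorphism, then show that
almost any further circuit or square allows the weight to drop by two. What remains (`gap_cases`) is
either a support inside a theta configuration (a five-element circuit together with the sum of two
of its elements), or a square sequence whose only circuits have four elements, with the gap just
below weight $4$.

Without gaps the set of lengths is a singleton or an interval, and $5w\le 3|A|$ bounds its minimum
(`lengthSet_of_no_gap`). In the exceptional square case the weights are $0,4,6,\dots,c$, which gives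
$\mathcal L_5$, or $\mathcal L_4$ if $c=4$. A theta configuration has only three circuits. Its
weights are the numbers $p+2q$ with $p\le x$, $q\le y$, $|p-q|\le z$ and prescribed parities
(`ThetaWeight`), and a case analysis in $z$ and $x$ produces the remaining families.

Conversely, theta sequences realize all families except $\mathcal L_5$ and most of $\mathcal L_3$.
Longer intervals come from two five-element circuits sharing three elements, multiplied by even
powers of a five-element circuit. The family $\mathcal L_5$ comes from three pairs of elements with
a common sum. -/

namespace SetsOfLengths
open scoped Pointwise

/-! ### Circuits, squares and weights -/

/-- The elementary abelian `2`-group of rank `4`. -/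
abbrev E4 := Fin 4 → ZMod 2

theorem E4.add_self (g : E4) : g + g = 0 := by
  funext i; exact CharTwo.add_self_eq_zero (g i)

theorem E4.add_eq_zero_iff (g h : E4) : g + h = 0 ↔ g = h := by
  constructor
  · intro e
    have : g + h + h = 0 + h := by rw [e]
    rwa [add_assoc, E4.add_self, add_zero, zero_add] at this
  · rintro rfl; exact E4.add_self g

theorem E4.sum_two_nsmul (R : Multiset E4) : (2 • R).sum = 0 := by
  rw [Multiset.sum_nsmul, two_nsmul, E4.add_self]

/-- A circuit: a squarefree minimal zero-sum sequence over `C_2^4` without the element `0`. Since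
any nonempty zero-sum set of nonzero elements has at least three elements, zero-sum sets of three
to five nonzero elements are automatically minimal. -/
structure IsCircuit (C : Finset E4) : Prop where
  zero_notMem : (0 : E4) ∉ C
  sum_eq : ∑ x ∈ C, x = 0
  three_le : 3 ≤ C.card
  le_five : C.card ≤ 5

/-- The concatenation of the members of a multiset of sets. -/
def cover (F : Multiset (Finset E4)) : Multiset E4 := (F.map Finset.val).sum

/-- The weight of a multiset of circuits: replacing squares by circuits, half of the weight is
lost in the length of the factorization. -/
def weight (F : Multiset (Finset E4)) : ℕ := (F.map fun C => C.card - 2).sum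

/-- `A` is the product of squares and of circuits of total weight `w`. -/
def HasWeight (A : Multiset E4) (w : ℕ) : Prop :=
  ∃ F : Multiset (Finset E4), ∃ R : Multiset E4,
    (∀ C ∈ F, IsCircuit C) ∧ cover F + 2 • R = A ∧ weight F = w

@[simp] theorem cover_zero : cover 0 = 0 := rfl
@[simp] theorem cover_cons (C : Finset E4) (F) : cover (C ::ₘ F) = C.val + cover F := by
  simp [cover]
@[simp] theorem cover_add (F F') : cover (F + F') = cover F + cover F' := by simp [cover]
@[simp] theorem weight_zero : weight 0 = 0 := rfl
@[simp] theorem weight_cons (C : Finset E4) (F) : weight (C ::ₘ F) = (C.card - 2) + weight F := by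
  simp [weight]
@[simp] theorem weight_add (F F') : weight (F + F') = weight F + weight F' := by simp [weight]
@[simp] theorem cover_replicate (n : ℕ) (C : Finset E4) :
    cover (Multiset.replicate n C) = n • C.val := by simp [cover]
@[simp] theorem weight_replicate (n : ℕ) (C : Finset E4) :
    weight (Multiset.replicate n C) = n * (C.card - 2) := by simp [weight]

/-- A circuit with $n$ elements contributes $n=(n-2)+2$. This identity makes the number of atoms an
affine function of the weight. -/
theorem card_cover {F : Multiset (Finset E4)} (hF : ∀ C ∈ F, IsCircuit C) :
    (cover F).card = weight F + 2 * F.card := by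
  induction F using Multiset.induction with
  | empty => simp
  | cons C F ih =>
    have h1 := ih fun D hD => hF D (Multiset.mem_cons_of_mem hD)
    have h2 := (hF C (Multiset.mem_cons_self C F)).three_le
    simp only [cover_cons, weight_cons, Multiset.card_add, Multiset.card_cons, Finset.card_val, h1]
    omega

theorem weight_le_three_mul_card {F : Multiset (Finset E4)} (hF : ∀ C ∈ F, IsCircuit C) :
    weight F ≤ 3 * F.card := by
  induction F using Multiset.induction with
  | empty => simp
  | cons C F ih =>
    have h1 := ih fun D hD => hF D (Multiset.mem_cons_of_mem hD)
    have h2 := (hF C (Multiset.mem_cons_self C F)).le_five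
    simp only [weight_cons, Multiset.card_cons]
    omega

theorem card_le_weight {F : Multiset (Finset E4)} (hF : ∀ C ∈ F, IsCircuit C) :
    F.card ≤ weight F := by
  induction F using Multiset.induction with
  | empty => simp
  | cons C F ih =>
    have h1 := ih fun D hD => hF D (Multiset.mem_cons_of_mem hD)
    have h2 := (hF C (Multiset.mem_cons_self C F)).three_le
    simp only [weight_cons, Multiset.card_cons]
    omega

theorem sum_cover {F : Multiset (Finset E4)} (hF : ∀ C ∈ F, IsCircuit C) :
    (cover F).sum = 0 := by
  induction F using Multiset.induction with
  | empty => simp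
  | cons C F ih =>
    have h1 := ih fun D hD => hF D (Multiset.mem_cons_of_mem hD)
    have h2 := (hF C (Multiset.mem_cons_self C F)).sum_eq
    rw [cover_cons, Multiset.sum_add, h1, add_zero, ← h2, Finset.sum_val]
    simp

theorem mem_cover {F : Multiset (Finset E4)} {g : E4} : g ∈ cover F ↔ ∃ C ∈ F, g ∈ C := by
  induction F using Multiset.induction with
  | empty => simp
  | cons C F ih => simp [ih]

theorem HasWeight.add {A B : Multiset E4} {v w : ℕ} (hA : HasWeight A v) (hB : HasWeight B w) :
    HasWeight (A + B) (v + w) := by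
  obtain ⟨F, R, hF, rfl, rfl⟩ := hA
  obtain ⟨F', R', hF', rfl, rfl⟩ := hB
  refine ⟨F + F', R + R', ?_, ?_, by simp⟩
  · intro C hC
    rcases Multiset.mem_add.1 hC with h | h
    · exact hF C h
    · exact hF' C h
  · rw [cover_add, smul_add]; abel

theorem HasWeight.squares (R : Multiset E4) : HasWeight (2 • R) 0 :=
  ⟨0, R, by simp, by simp, by simp⟩

theorem HasWeight.add_squares {A : Multiset E4} {w : ℕ} (hA : HasWeight A w) (R : Multiset E4) :
    HasWeight (A + 2 • R) w := by
  simpa using hA.add (HasWeight.squares R)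

theorem HasWeight.of_circuits {F : Multiset (Finset E4)} (hF : ∀ C ∈ F, IsCircuit C) :
    HasWeight (cover F) (weight F) :=
  ⟨F, 0, hF, by simp, rfl⟩

theorem IsCircuit.hasWeight {C : Finset E4} (hC : IsCircuit C) : HasWeight C.val (C.card - 2) := by
  have := HasWeight.of_circuits (F := {C}) (by simpa using hC)
  simpa [cover, weight] using this

/-- For $n\le 5$ one has $5(n-2)\le 3n$, and squares have weight zero. This is the source of the
ratio $5/2$ in `family3`. -/
theorem HasWeight.five_mul_le {A : Multiset E4} {w : ℕ} (h : HasWeight A w) :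
    5 * w ≤ 3 * A.card := by
  obtain ⟨F, R, hF, rfl, rfl⟩ := h
  have h1 := card_cover hF
  have h2 := weight_le_three_mul_card hF
  simp only [Multiset.card_add]
  omega

theorem HasWeight.mod_two {A : Multiset E4} {w : ℕ} (h : HasWeight A w) :
    w % 2 = A.card % 2 := by
  obtain ⟨F, R, hF, rfl, rfl⟩ := h
  have h1 := card_cover hF
  simp only [Multiset.card_add, Multiset.card_nsmul]
  omega

theorem HasWeight.le_card {A : Multiset E4} {w : ℕ} (h : HasWeight A w) : w ≤ A.card := by
  have := h.five_mul_le; omega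

theorem HasWeight.sum_eq {A : Multiset E4} {w : ℕ} (h : HasWeight A w) : A.sum = 0 := by
  obtain ⟨F, R, hF, rfl, rfl⟩ := h
  rw [Multiset.sum_add, sum_cover hF, E4.sum_two_nsmul, add_zero]

/-! ### Zero-sum subsets -/

/-- Five elements of `C_2^4` are dependent. -/
theorem exists_zero_sum_subset {X : Finset E4} (hX : 5 ≤ X.card) :
    ∃ Y ⊆ X, Y.Nonempty ∧ ∑ x ∈ Y, x = 0 := by
  -- At least $2^5$ subsets have their sums in a group of order $16$. Two subsets with equal sums
  -- have a zero-sum symmetric difference.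
  have hc : (Finset.univ : Finset E4).card < X.powerset.card := by
    rw [Finset.card_powerset, Finset.card_univ]
    have : Fintype.card E4 = 16 := by simp [E4]
    rw [this]
    calc 16 < 2 ^ 5 := by norm_num
      _ ≤ 2 ^ X.card := Nat.pow_le_pow_right (by norm_num) hX
  obtain ⟨P, hP, Q, hQ, hne, hs⟩ := Finset.exists_ne_map_eq_of_card_lt_of_maps_to hc
    (f := fun P => ∑ x ∈ P, x) (fun _ _ => by simp)
  rw [Finset.mem_powerset] at hP hQ
  refine ⟨symmDiff P Q, ?_, ?_, ?_⟩
  · intro x hx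
    rcases Finset.mem_symmDiff.1 hx with h | h
    · exact hP h.1
    · exact hQ h.1
  · rw [Finset.nonempty_iff_ne_empty]
    intro h
    exact hne (symmDiff_eq_bot.1 h)
  · have e : symmDiff P Q = (P \ Q) ∪ (Q \ P) := rfl
    rw [e, Finset.sum_union (by
      rw [Finset.disjoint_left]; intro x hx hx'
      simp only [Finset.mem_sdiff] at hx hx'; exact hx.2 hx'.1)]
    have h1 := Finset.sum_sdiff_eq_sub (f := fun x : E4 => x) (Finset.inter_subset_left (s₁ := P) (s₂ := Q))
    have h2 := Finset.sum_sdiff_eq_sub (f := fun x : E4 => x) (Finset.inter_subset_right (s₁ := P) (s₂ := Q))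
    rw [Finset.sdiff_inter_self_left] at h1
    rw [Finset.sdiff_inter_self_right] at h2
    rw [h1, h2, hs]
    exact E4.add_self _

theorem three_le_card_of_sum_eq_zero {X : Finset E4} (h0 : (0 : E4) ∉ X) (hs : ∑ x ∈ X, x = 0)
    (hX : X.Nonempty) : 3 ≤ X.card := by
  have h1 := hX.card_pos
  by_contra h
  have : X.card = 1 ∨ X.card = 2 := by omega
  rcases this with h | h
  · obtain ⟨a, rfl⟩ := Finset.card_eq_one.1 h
    simp at hs h0; exact h0 hs.symm
  · obtain ⟨a, b, hab, rfl⟩ := Finset.card_eq_two.1 h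
    rw [Finset.sum_pair hab, E4.add_eq_zero_iff] at hs
    exact hab hs

/-- A zero-sum set with more than five elements splits. -/
theorem exists_zero_sum_split {X : Finset E4} (h0 : (0 : E4) ∉ X) (hs : ∑ x ∈ X, x = 0)
    (hX : 6 ≤ X.card) :
    ∃ Y ⊆ X, ∑ x ∈ Y, x = 0 ∧ ∑ x ∈ X \ Y, x = 0 ∧ 3 ≤ Y.card ∧ 3 ≤ (X \ Y).card := by
  obtain ⟨a, ha⟩ : X.Nonempty := by rw [← Finset.card_pos]; omega
  -- Erasing `a` first keeps it out of `Y`, so that the complement is nonempty as well.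
  obtain ⟨Y, hY, hne, hsum⟩ := exists_zero_sum_subset (X := X.erase a)
    (by rw [Finset.card_erase_of_mem ha]; omega)
  have hYX : Y ⊆ X := hY.trans (Finset.erase_subset a X)
  have hs' : ∑ x ∈ X \ Y, x = 0 := by
    rw [Finset.sum_sdiff_eq_sub hYX, hs, hsum, sub_zero]
  refine ⟨Y, hYX, hsum, hs', three_le_card_of_sum_eq_zero (fun h => h0 (hYX h)) hsum hne,
    three_le_card_of_sum_eq_zero (fun h => h0 (Finset.mem_sdiff.1 h).1) hs' ⟨a, ?_⟩⟩
  simp only [Finset.mem_sdiff]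
  exact ⟨ha, fun h => Finset.notMem_erase a X (hY h)⟩

/-! ### Atoms, and lengths in terms of weights -/

theorem isAddUnit_zeroSumSequences_iff {u : zeroSumSequences E4} : IsAddUnit u ↔ u.1 = 0 := by
  constructor
  · intro h
    obtain ⟨v, hv⟩ := isAddUnit_iff_exists_neg.1 h
    have : u.1 + v.1 = 0 := congrArg Subtype.val hv
    exact (add_eq_zero.1 this).1
  · intro h
    have : u = 0 := Subtype.ext h
    rw [this]; exact isAddUnit_zero

theorem addIrreducible_iff_minimal {u : zeroSumSequences E4} :
    AddIrreducible u ↔ u.1 ≠ 0 ∧ ∀ B ≤ u.1, B.sum = 0 → B = 0 ∨ B = u.1 := by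
  constructor
  · intro h
    refine ⟨fun h0 => h.not_isAddUnit (isAddUnit_zeroSumSequences_iff.2 h0), ?_⟩
    intro B hB hs
    obtain ⟨D, hD⟩ := Multiset.le_iff_exists_add.1 hB
    have hDs : D.sum = 0 := by
      have : u.1.sum = 0 := u.2
      rwa [hD, Multiset.sum_add, hs, zero_add] at this
    rcases h.isAddUnit_or_isAddUnit (a := ⟨B, hs⟩) (b := ⟨D, hDs⟩) (Subtype.ext hD) with h | h
    · left; exact isAddUnit_zeroSumSequences_iff.1 h
    · right
      have : D = 0 := isAddUnit_zeroSumSequences_iff.1 h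
      rw [hD, this, add_zero]
  · rintro ⟨h0, h⟩
    refine ⟨fun hu => h0 (isAddUnit_zeroSumSequences_iff.1 hu), ?_⟩
    intro a b hab
    have hab' : u.1 = a.1 + b.1 := congrArg Subtype.val hab
    rcases h a.1 (by rw [hab']; exact Multiset.le_add_right _ _) a.2 with h | h
    · left; exact isAddUnit_zeroSumSequences_iff.2 h
    · right
      apply isAddUnit_zeroSumSequences_iff.2
      rw [h] at hab'
      simpa using hab'

theorem addIrreducible_of_isCircuit {u : zeroSumSequences E4} {C : Finset E4} (hC : IsCircuit C)
    (hu : u.1 = C.val) : AddIrreducible u := by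
  rw [addIrreducible_iff_minimal, hu]
  refine ⟨?_, ?_⟩
  · intro h
    have := hC.three_le
    rw [Finset.val_eq_zero] at h
    simp [h] at this
  · intro B hB hs
    have hnd : B.Nodup := Multiset.nodup_of_le hB C.nodup
    set Y : Finset E4 := ⟨B, hnd⟩ with hY
    have hYC : Y ⊆ C := Finset.val_le_iff.1 hB
    have hsY : ∑ x ∈ Y, x = 0 := by rw [← hs]; exact (Finset.sum_val Y).symm
    have hs' : ∑ x ∈ C \ Y, x = 0 := by
      rw [Finset.sum_sdiff_eq_sub hYC, hC.sum_eq, hsY, sub_zero]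
    by_contra hne
    push Not at hne
    have h1 : Y.Nonempty := by
      rw [Finset.nonempty_iff_ne_empty]
      intro h
      exact hne.1 (congrArg Finset.val h)
    have h2 : (C \ Y).Nonempty := by
      rw [Finset.sdiff_nonempty]
      intro h
      exact hne.2 (congrArg Finset.val (Finset.Subset.antisymm hYC h))
    have h3 := three_le_card_of_sum_eq_zero (fun h => hC.zero_notMem (hYC h)) hsY h1
    have h4 := three_le_card_of_sum_eq_zero
      (fun h => hC.zero_notMem (Finset.mem_sdiff.1 h).1) hs' h2
    have h5 := Finset.card_sdiff_add_card_eq_card hYC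
    have := hC.le_five
    omega

theorem addIrreducible_of_eq_square {u : zeroSumSequences E4} {g : E4} (hg : g ≠ 0)
    (hu : u.1 = 2 • {g}) : AddIrreducible u := by
  rw [addIrreducible_iff_minimal, hu]
  refine ⟨by simp [two_nsmul], ?_⟩
  intro B hB hs
  have hB' : B ≤ Multiset.replicate 2 g := by simpa [Multiset.nsmul_singleton] using hB
  obtain ⟨n, hn, rfl⟩ := Multiset.le_replicate_iff.1 hB'
  have : n = 0 ∨ n = 1 ∨ n = 2 := by omega
  rcases this with rfl | rfl | rfl
  · left; simp
  · simp at hs; exact absurd hs hg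
  · right; simp [Multiset.nsmul_singleton]

theorem addIrreducible_of_eq_zero {u : zeroSumSequences E4} (hu : u.1 = {0}) :
    AddIrreducible u := by
  rw [addIrreducible_iff_minimal, hu]
  refine ⟨by simp, ?_⟩
  intro B hB _
  exact Multiset.le_singleton.1 hB

/-- By minimality an atom equals any nonempty zero-sum subsequence it contains: $0$ if it occurs, a
square if an element is repeated. A squarefree atom without $0$ has at most five elements by
`exists_zero_sum_split`. -/
theorem eq_of_addIrreducible {u : zeroSumSequences E4} (hu : AddIrreducible u) :
    u.1 = {0} ∨ (∃ g ≠ 0, u.1 = 2 • {g}) ∨ ∃ C, IsCircuit C ∧ u.1 = C.val := by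
  rw [addIrreducible_iff_minimal] at hu
  obtain ⟨hne, hmin⟩ := hu
  by_cases h0 : (0 : E4) ∈ u.1
  · left
    rcases hmin {0} (Multiset.singleton_le.2 h0) (by simp) with h | h
    · simp at h
    · exact h.symm
  right
  by_cases hnd : u.1.Nodup
  · right
    set C : Finset E4 := ⟨u.1, hnd⟩ with hC
    have hs : ∑ x ∈ C, x = 0 := by
      have : u.1.sum = 0 := u.2
      rw [← this]; exact (Finset.sum_val C).symm
    refine ⟨C, ⟨h0, hs, three_le_card_of_sum_eq_zero h0 hs ?_, ?_⟩, rfl⟩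
    · rw [Finset.nonempty_iff_ne_empty]
      intro h
      exact hne (congrArg Finset.val h)
    · by_contra h6
      obtain ⟨Y, hYC, hsY, hs', hc1, hc2⟩ := exists_zero_sum_split h0 hs (by omega)
      rcases hmin Y.val (Finset.val_le_iff.2 hYC) (by rw [Finset.sum_val]; exact hsY) with h | h
      · rw [Finset.val_eq_zero] at h; simp [h] at hc1
      · have : Y = C := Finset.val_injective h
        simp [this] at hc2
  · left
    rw [Multiset.nodup_iff_le] at hnd
    push Not at hnd
    obtain ⟨g, hg⟩ := hnd
    have e : (g ::ₘ g ::ₘ 0 : Multiset E4) = 2 • {g} := by simp [two_nsmul]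
    rw [e] at hg
    refine ⟨g, ?_, ?_⟩
    · rintro rfl
      exact h0 (Multiset.mem_of_le hg (by simp [two_nsmul]))
    · rcases hmin _ hg (E4.sum_two_nsmul _) with h | h
      · simp [two_nsmul] at h
      · exact h.symm

theorem exists_weight_of_factorization (z : Multiset (zeroSumSequences E4))
    (hz : ∀ u ∈ z, AddIrreducible u) :
    ∃ (F : Multiset (Finset E4)) (R : Multiset E4) (j : ℕ), (∀ C ∈ F, IsCircuit C) ∧
      (0 : E4) ∉ R ∧ z.sum.1 = cover F + 2 • R + Multiset.replicate j 0 ∧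
      z.card = F.card + R.card + j := by
  induction z using Multiset.induction with
  | empty => exact ⟨0, 0, 0, by simp, by simp, by simp, by simp⟩
  | cons u z ih =>
    obtain ⟨F, R, j, hF, hR, hs, hc⟩ := ih fun v hv => hz v (Multiset.mem_cons_of_mem hv)
    have hsum : (u ::ₘ z).sum.1 = u.1 + z.sum.1 := by rw [Multiset.sum_cons]; rfl
    rw [hsum, hs]
    rcases eq_of_addIrreducible (hz u (Multiset.mem_cons_self u z)) with h | ⟨g, hg, h⟩ | ⟨C, hC, h⟩
    · refine ⟨F, R, j + 1, hF, hR, ?_, ?_⟩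
      · rw [h, Multiset.replicate_succ, ← Multiset.singleton_add]; abel
      · simp [hc]; omega
    · refine ⟨F, g ::ₘ R, j, hF, by simpa [hR] using hg.symm, ?_, ?_⟩
      · rw [h, ← Multiset.singleton_add, smul_add]; abel
      · simp [hc]; omega
    · refine ⟨C ::ₘ F, R, j, ?_, hR, ?_, ?_⟩
      · intro D hD
        rcases Multiset.mem_cons.1 hD with rfl | hD
        · exact hC
        · exact hF D hD
      · rw [h, cover_cons]; abel
      · simp [hc]; omega

theorem exists_factorization_of_circuits (F : Multiset (Finset E4)) (hF : ∀ C ∈ F, IsCircuit C) :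
    ∃ z : Multiset (zeroSumSequences E4), z.card = F.card ∧ (∀ u ∈ z, AddIrreducible u) ∧
      z.sum.1 = cover F := by
  induction F using Multiset.induction with
  | empty => exact ⟨0, rfl, by simp, rfl⟩
  | cons C F ih =>
    obtain ⟨z, hc, hz, hs⟩ := ih fun D hD => hF D (Multiset.mem_cons_of_mem hD)
    have hC := hF C (Multiset.mem_cons_self C F)
    let u : zeroSumSequences E4 := ⟨C.val, by
      change C.val.sum = 0; rw [Finset.sum_val]; exact hC.sum_eq⟩
    refine ⟨u ::ₘ z, by simp [hc], ?_, ?_⟩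
    · intro v hv
      rcases Multiset.mem_cons.1 hv with rfl | hv
      · exact addIrreducible_of_isCircuit hC rfl
      · exact hz v hv
    · rw [Multiset.sum_cons, cover_cons, ← hs]; rfl

theorem exists_factorization_of_squares (R : Multiset E4) (hR : (0 : E4) ∉ R) :
    ∃ z : Multiset (zeroSumSequences E4), z.card = R.card ∧ (∀ u ∈ z, AddIrreducible u) ∧
      z.sum.1 = 2 • R := by
  induction R using Multiset.induction with
  | empty => exact ⟨0, rfl, by simp, rfl⟩
  | cons g R ih =>
    simp only [Multiset.mem_cons, not_or] at hR
    obtain ⟨z, hc, hz, hs⟩ := ih hR.2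
    let u : zeroSumSequences E4 := ⟨2 • {g}, E4.sum_two_nsmul _⟩
    refine ⟨u ::ₘ z, by simp [hc], ?_, ?_⟩
    · intro v hv
      rcases Multiset.mem_cons.1 hv with rfl | hv
      · exact addIrreducible_of_eq_square (Ne.symm hR.1) rfl
      · exact hz v hv
    · rw [Multiset.sum_cons, ← Multiset.singleton_add, smul_add, ← hs]; rfl

theorem exists_factorization_of_zeros (j : ℕ) :
    ∃ z : Multiset (zeroSumSequences E4), z.card = j ∧ (∀ u ∈ z, AddIrreducible u) ∧
      z.sum.1 = Multiset.replicate j 0 := by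
  let u : zeroSumSequences E4 := ⟨{0}, by change Multiset.sum _ = 0; simp⟩
  refine ⟨Multiset.replicate j u, by simp, ?_, ?_⟩
  · intro v hv
    rw [Multiset.eq_of_mem_replicate hv]
    exact addIrreducible_of_eq_zero rfl
  · rw [Multiset.sum_replicate]
    change j • ({0} : Multiset E4) = _
    rw [Multiset.nsmul_singleton]

/-- The lengths determined by the weights of a sequence: `N` is the cardinality of the sequence,
where the element `0` counts twice. -/
def lengthSet (W : ℕ → Prop) (N : ℕ) : Set ℕ := {k | ∃ w, W w ∧ 2 * k + w = N}

theorem filter_eq_of_eq_add_replicate {A B : Multiset E4} {j : ℕ} (hB : (0 : E4) ∉ B)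
    (h : A = B + Multiset.replicate j 0) : A.filter (· ≠ 0) = B ∧ A.count 0 = j := by
  subst h
  constructor
  · rw [Multiset.filter_add, Multiset.filter_eq_self.2, Multiset.filter_eq_nil.2, add_zero]
    · intro a ha; simp [Multiset.eq_of_mem_replicate ha]
    · intro a ha h; exact hB (h ▸ ha)
  · simp [Multiset.count_eq_zero_of_notMem hB]

/-- Circuits `F`, squares `R` and $j$ zeros make $|F|+|R|+j$ atoms, and `card_cover` turns this
number into the equation between length and weight. -/
theorem lengths_eq (A : zeroSumSequences E4) :
    lengths A = lengthSet (HasWeight (A.1.filter (· ≠ 0)))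
      ((A.1.filter (· ≠ 0)).card + 2 * A.1.count 0) := by
  ext k
  -- Exactly the unit has the empty factorization, so both cases of the definition merge into one
  -- existence statement.
  have hunit : (IsAddUnit A ∧ k = 0) ∨ (¬ IsAddUnit A ∧ 0 < k ∧
      ∃ z : Multiset (zeroSumSequences E4), z.card = k ∧ (∀ u ∈ z, AddIrreducible u) ∧ z.sum = A) ↔
      ∃ z : Multiset (zeroSumSequences E4), z.card = k ∧ (∀ u ∈ z, AddIrreducible u) ∧
        z.sum = A := by
    constructor
    · rintro (⟨h, rfl⟩ | ⟨-, -, h⟩)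
      · refine ⟨0, rfl, by simp, ?_⟩
        rw [Multiset.sum_zero]
        exact (Subtype.ext (isAddUnit_zeroSumSequences_iff.1 h)).symm
      · exact h
    · rintro ⟨z, hc, hz, hs⟩
      by_cases hu : IsAddUnit A
      · left
        refine ⟨hu, ?_⟩
        by_contra hk
        obtain ⟨u, hu'⟩ := Multiset.card_pos_iff_exists_mem.1 (by omega : 0 < z.card)
        obtain ⟨z', rfl⟩ := Multiset.exists_cons_of_mem hu'
        rw [Multiset.sum_cons] at hs
        rw [isAddUnit_zeroSumSequences_iff, ← hs] at hu
        exact (hz u hu').not_isAddUnit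
          (isAddUnit_zeroSumSequences_iff.2 (add_eq_zero.1 hu).1)
      · right
        refine ⟨hu, ?_, z, hc, hz, hs⟩
        by_contra hk
        have : z = 0 := Multiset.card_eq_zero.1 (by omega)
        rw [this, Multiset.sum_zero] at hs
        exact hu (hs ▸ isAddUnit_zero)
  refine hunit.trans ?_
  constructor
  · rintro ⟨z, hc, hz, rfl⟩
    obtain ⟨F, R, j, hF, hR, hs, hcard⟩ := exists_weight_of_factorization z hz
    have h0 : (0 : E4) ∉ cover F + 2 • R := by
      rw [Multiset.mem_add, mem_cover]
      rintro (⟨C, hC, h⟩ | h)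
      · exact (hF C hC).zero_notMem h
      · exact hR (Multiset.mem_of_mem_nsmul h)
    obtain ⟨h1, h2⟩ := filter_eq_of_eq_add_replicate h0 hs
    refine ⟨weight F, ?_, ?_⟩
    · exact ⟨F, R, hF, h1.symm, rfl⟩
    · rw [h1, h2, Multiset.card_add, card_cover hF, Multiset.card_nsmul]
      omega
  · rintro ⟨w, ⟨F, R, hF, hA, rfl⟩, hk⟩
    have hR : (0 : E4) ∉ R := by
      intro h
      have : (0 : E4) ∈ A.1.filter (· ≠ 0) := by
        rw [← hA]; exact Multiset.mem_add.2 (Or.inr (Multiset.mem_nsmul.2 ⟨by norm_num, h⟩))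
      simp at this
    obtain ⟨z1, hc1, hz1, hs1⟩ := exists_factorization_of_circuits F hF
    obtain ⟨z2, hc2, hz2, hs2⟩ := exists_factorization_of_squares R hR
    obtain ⟨z3, hc3, hz3, hs3⟩ := exists_factorization_of_zeros (A.1.count 0)
    refine ⟨z1 + z2 + z3, ?_, ?_, ?_⟩
    · simp only [Multiset.card_add, hc1, hc2, hc3]
      rw [← hA, Multiset.card_add, card_cover hF, Multiset.card_nsmul] at hk
      omega
    · intro u hu
      simp only [Multiset.mem_add] at hu
      rcases hu with (hu | hu) | hu
      · exact hz1 u hu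
      · exact hz2 u hu
      · exact hz3 u hu
    · apply Subtype.ext
      rw [Multiset.sum_add, Multiset.sum_add]
      change z1.sum.1 + z2.sum.1 + z3.sum.1 = A.1
      rw [hs1, hs2, hs3, hA, ← Multiset.filter_eq' A.1 0]
      have := Multiset.filter_add_not (fun x : E4 => x ≠ 0) A.1
      simpa using this

/-! ### Invariance under automorphisms -/

theorem IsCircuit.map (φ : E4 ≃+ E4) {C : Finset E4} (hC : IsCircuit C) :
    IsCircuit (C.map φ.toEquiv.toEmbedding) where
  zero_notMem := by
    simp only [Finset.mem_map, not_exists, not_and]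
    intro x hx h
    have : φ x = 0 := h
    rw [map_eq_zero_iff φ φ.injective] at this
    exact hC.zero_notMem (this ▸ hx)
  sum_eq := by
    rw [Finset.sum_map]
    change ∑ x ∈ C, φ x = 0
    rw [← map_sum, hC.sum_eq, map_zero]
  three_le := by rw [Finset.card_map]; exact hC.three_le
  le_five := by rw [Finset.card_map]; exact hC.le_five

theorem HasWeight.map (φ : E4 ≃+ E4) {A : Multiset E4} {w : ℕ} (h : HasWeight A w) :
    HasWeight (A.map φ) w := by
  obtain ⟨F, R, hF, rfl, rfl⟩ := h
  refine ⟨F.map fun C => C.map φ.toEquiv.toEmbedding, R.map φ, ?_, ?_, ?_⟩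
  · intro D hD
    obtain ⟨C, hC, rfl⟩ := Multiset.mem_map.1 hD
    exact (hF C hC).map φ
  · rw [Multiset.map_add, Multiset.map_nsmul]
    congr 1
    clear hF
    induction F using Multiset.induction with
    | empty => simp
    | cons C F ih =>
      rw [Multiset.map_cons, cover_cons, cover_cons, Multiset.map_add, ih]; rfl
  · clear hF
    induction F using Multiset.induction with
    | empty => simp
    | cons C F ih => rw [Multiset.map_cons, weight_cons, weight_cons, ih, Finset.card_map]

theorem hasWeight_map_iff (φ : E4 ≃+ E4) {A : Multiset E4} {w : ℕ} :
    HasWeight (A.map φ) w ↔ HasWeight A w := by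
  refine ⟨fun h => ?_, fun h => h.map φ⟩
  have := h.map φ.symm
  rw [Multiset.map_map] at this
  simpa using this

/-! ### Numerical codes and a sound search for decompositions -/

/-- The element of `C_2^4` with the binary digits of `n` as coordinates. -/
def dec (n : ℕ) : E4 := fun i => if n.testBit i then 1 else 0

theorem dec_xor (m n : ℕ) : dec (m ^^^ n) = dec m + dec n := by
  funext i
  simp only [dec, Nat.testBit_xor, Pi.add_apply]
  cases m.testBit i <;> cases n.testBit i <;> decide

theorem dec_zero : dec 0 = 0 := by
  funext i; simp [dec]

theorem dec_ne_zero {n : ℕ} (h : n ∈ List.range' 1 15) : dec n ≠ 0 := by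
  revert n; decide +kernel

theorem dec_injOn {m n : ℕ} (hm : m ∈ List.range' 1 15) (hn : n ∈ List.range' 1 15)
    (h : dec m = dec n) : m = n := by
  have : ∀ m ∈ List.range' 1 15, ∀ n ∈ List.range' 1 15, dec m = dec n → m = n := by
    decide +kernel
  exact this _ hm _ hn h

theorem exists_dec {x : E4} (hx : x ≠ 0) : ∃ n ∈ List.range' 1 15, dec n = x := by
  revert x; decide +kernel

/-- The xor of a list of numbers. -/
def xorSum (l : List ℕ) : ℕ := l.foldr (· ^^^ ·) 0

theorem dec_xorSum (l : List ℕ) : dec (xorSum l) = (l.map dec).sum := by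
  induction l with
  | nil => exact dec_zero
  | cons a l ih => simp only [xorSum, List.foldr_cons, List.map_cons, List.sum_cons] at ih ⊢
                   rw [dec_xor, ih]

theorem xorSum_eq_zero {l : List ℕ} (hl : ∀ n ∈ l, n ∈ List.range' 1 15)
    (h : (l.map dec).sum = 0) : xorSum l = 0 := by
  have hlt : xorSum l < 2 ^ 4 := by
    clear h
    induction l with
    | nil => simp [xorSum]
    | cons a l ih =>
      have h1 := ih fun n hn => hl n (List.mem_cons_of_mem a hn)
      have h2 := hl a List.mem_cons_self
      simp only [List.mem_range'_1] at h2
      exact Nat.xor_lt_two_pow (by omega) h1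
  by_contra hne
  rw [← dec_xorSum] at h
  exact dec_ne_zero (n := xorSum l) (by simp only [List.mem_range'_1]; omega) h

theorem exists_code {X : Finset E4} (h0 : (0 : E4) ∉ X) :
    ∃ l ∈ (List.range' 1 15).sublistsLen X.card, X.val = (l.map dec : List E4) := by
  set l := (List.range' 1 15).filter (fun n => dec n ∈ X) with hl
  have hnd : (l.map dec).Nodup := by
    apply List.Nodup.map_on
    · intro x hx y hy h
      exact dec_injOn (List.mem_of_mem_filter hx) (List.mem_of_mem_filter hy) h
    · exact (List.nodup_range' (s := 1) (n := 15)).filter _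
  have hX : X.val = (l.map dec : List E4) := by
    rw [Multiset.Nodup.ext X.nodup (Multiset.coe_nodup.2 hnd)]
    intro x
    simp only [Finset.mem_val, Multiset.mem_coe, List.mem_map, hl, List.mem_filter,
      decide_eq_true_eq]
    constructor
    · intro hx
      obtain ⟨n, hn, rfl⟩ := exists_dec (x := x) (fun h => h0 (h ▸ hx))
      exact ⟨n, ⟨hn, hx⟩, rfl⟩
    · rintro ⟨n, ⟨_, hn⟩, rfl⟩
      exact hn
  refine ⟨l, List.mem_sublistsLen.2 ⟨List.filter_sublist, ?_⟩, hX⟩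
  have := congrArg Multiset.card hX
  simpa using this.symm

/-- Whether `a` occurs in `l`. -/
def memb (a : ℕ) (l : List ℕ) : Bool := l.any (Nat.beq a)

theorem memb_iff {a : ℕ} {l : List ℕ} : memb a l = true ↔ a ∈ l := by
  simp [memb, List.any_eq_true]

/-- Removes one occurrence of `a` from `l`. -/
def removeCode (a : ℕ) (l : List ℕ) : List ℕ := l.eraseP (Nat.beq a)

theorem removeCode_eq (a : ℕ) (l : List ℕ) : removeCode a l = l.erase a := by
  rw [List.erase_eq_eraseP', removeCode]
  congr 1
  funext x
  rw [Bool.eq_iff_iff, Nat.beq_eq, beq_iff_eq]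
  exact eq_comm

/-- The codes occurring an odd number of times. -/
def oddPart : List ℕ → List ℕ
  | [] => []
  | a :: A => bif memb a (oddPart A) then removeCode a (oddPart A) else a :: oddPart A

/-- A search for a decomposition into circuits with three elements (for every `true` in the
pattern), circuits with four elements (for every `false`), squares, and a last circuit with `k`
elements. -/
def searchPattern : List Bool → ℕ → List ℕ → Bool
  -- The last circuit is forced: modulo squares, what is left is the set of elements of odd
  -- multiplicity, and its sum is automatically zero.
  | [], k, A => Nat.beq (oddPart A).length k
  -- Increasing order makes the elements of a circuit distinct and avoids listing it more than once.
  | true :: p, k, A => A.any fun a => A.any fun b =>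
      Nat.blt a b && (Nat.blt b (a ^^^ b) && (memb (a ^^^ b) A &&
        searchPattern p k (removeCode (a ^^^ b) (removeCode b (removeCode a A)))))
  | false :: p, k, A => A.any fun a => A.any fun b =>
      Nat.blt a b && A.any fun c => Nat.blt b c && (Nat.blt c (a ^^^ b ^^^ c) &&
        (memb (a ^^^ b ^^^ c) A && searchPattern p k
          (removeCode (a ^^^ b ^^^ c) (removeCode c (removeCode b (removeCode a A))))))

/-- The weight of the circuits of a pattern. -/
def patternWeight (p : List Bool) : ℕ := (p.map fun t => bif t then 1 else 2).sum

theorem isCircuit_of_codes {l : List ℕ} (hl : ∀ n ∈ l, n ∈ List.range' 1 15) (hnd : l.Nodup)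
    (hs : (l.map dec).sum = 0) (h3 : 3 ≤ l.length) (h5 : l.length ≤ 5) :
    ∃ C : Finset E4, IsCircuit C ∧ C.val = (l.map dec : List E4) ∧ C.card = l.length := by
  have hnd' : (l.map dec).Nodup := by
    apply List.Nodup.map_on _ hnd
    intro x hx y hy h
    exact dec_injOn (hl x hx) (hl y hy) h
  refine ⟨⟨(l.map dec : List E4), Multiset.coe_nodup.2 hnd'⟩, ⟨?_, ?_, ?_, ?_⟩, rfl, ?_⟩
  · intro h
    obtain ⟨n, hn, h⟩ := List.mem_map.1 (Multiset.mem_coe.1 h)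
    exact dec_ne_zero (hl n hn) h
  · rw [← hs, ← Multiset.sum_coe]
    exact (Finset.sum_val _).symm
  all_goals simp [Finset.card, h3, h5]

theorem exists_add_two_nsmul_iff {α : Type*} [DecidableEq α] {A B : Multiset α} :
    (∃ R, B + 2 • R = A) ↔ ∀ a, B.count a ≤ A.count a ∧ B.count a % 2 = A.count a % 2 := by
  constructor
  · rintro ⟨R, rfl⟩ a
    simp only [Multiset.count_add, Multiset.count_nsmul]
    omega
  · intro h
    have hle : B ≤ A := Multiset.le_iff_count.2 fun a => (h a).1
    refine ⟨∑ a ∈ A.toFinset, Multiset.replicate ((A.count a - B.count a) / 2) a, ?_⟩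
    ext a
    rw [Multiset.count_add, Multiset.count_nsmul, Multiset.count_sum']
    simp only [Multiset.count_replicate, Finset.sum_ite_eq', Multiset.mem_toFinset]
    have := h a
    split_ifs with ha
    · omega
    · have : A.count a = 0 := Multiset.count_eq_zero_of_notMem ha
      omega

theorem oddPart_nodup (A : List ℕ) : (oddPart A).Nodup := by
  induction A with
  | nil => exact List.nodup_nil
  | cons a A ih =>
    rw [oddPart]
    cases h : memb a (oddPart A)
    · rw [cond_false, List.nodup_cons]
      refine ⟨fun h' => ?_, ih⟩
      rw [memb_iff.2 h'] at h
      exact absurd h (by simp)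
    · rw [cond_true, removeCode_eq]
      exact ih.erase a

theorem exists_oddPart_add (A : List ℕ) :
    ∃ R : Multiset ℕ, (oddPart A : Multiset ℕ) + 2 • R = A := by
  induction A with
  | nil => exact ⟨0, rfl⟩
  | cons a A ih =>
    obtain ⟨R, hR⟩ := ih
    rw [oddPart]
    cases h : memb a (oddPart A)
    · refine ⟨R, ?_⟩
      rw [cond_false, ← Multiset.cons_coe, ← Multiset.cons_coe, ← hR, Multiset.cons_add]
    · refine ⟨a ::ₘ R, ?_⟩
      rw [cond_true, removeCode_eq, ← Multiset.cons_coe, ← hR, ← Multiset.coe_erase,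
        ← Multiset.singleton_add, ← Multiset.singleton_add, smul_add]
      have := Multiset.cons_erase (Multiset.mem_coe.2 (memb_iff.1 h))
      rw [← Multiset.singleton_add] at this
      conv_rhs => rw [← this]
      rw [two_nsmul]
      abel

theorem coe_removeCode {a : ℕ} {A : List ℕ} (h : a ∈ A) :
    (A : Multiset ℕ) = a ::ₘ (removeCode a A : List ℕ) := by
  rw [removeCode_eq, ← Multiset.coe_erase, Multiset.cons_erase (Multiset.mem_coe.2 h)]

theorem mem_removeCode_of_ne {a b : ℕ} {A : List ℕ} (h : b ∈ A) (hab : b ≠ a) :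
    b ∈ removeCode a A := by
  rw [removeCode_eq]
  exact (List.mem_erase_of_ne hab).2 h

theorem hasWeight_of_codes_add {c B A : List ℕ} (hA : ∀ n ∈ A, n ∈ List.range' 1 15)
    (hs : (A.map dec).sum = 0) (hc : c.Nodup) (hcs : (c.map dec).sum = 0) (h3 : 3 ≤ c.length)
    (h5 : c.length ≤ 5) (h : (A : Multiset ℕ) = c + B) {w : ℕ}
    (hB : (∀ n ∈ B, n ∈ List.range' 1 15) → (B.map dec).sum = 0 →
      HasWeight (B.map dec : List E4) w) :
    HasWeight (A.map dec : List E4) (c.length - 2 + w) := by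
  have hmem : ∀ n, n ∈ A ↔ n ∈ c ∨ n ∈ B := by
    intro n
    rw [← Multiset.mem_coe, h, Multiset.mem_add, Multiset.mem_coe, Multiset.mem_coe]
  have h' : ((A.map dec : List E4) : Multiset E4) = (c.map dec : List E4) + (B.map dec : List E4) := by
    have := congrArg (Multiset.map dec) h
    simpa only [Multiset.map_add, Multiset.map_coe] using this
  have hBs : (B.map dec).sum = 0 := by
    have := congrArg Multiset.sum h'
    rw [Multiset.sum_add, Multiset.sum_coe, Multiset.sum_coe, Multiset.sum_coe, hcs, hs,
      zero_add] at this
    exact this.symm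
  obtain ⟨C, hC, hv, hcard⟩ := isCircuit_of_codes (l := c)
    (fun n hn => hA n ((hmem n).2 (Or.inl hn))) hc hcs h3 h5
  have h1 := hC.hasWeight
  rw [hv, hcard] at h1
  rw [h']
  exact h1.add (hB (fun n hn => hA n ((hmem n).2 (Or.inr hn))) hBs)

/-- Soundness of the search: each removed circuit leaves a remainder of sum zero, to which induction
applies. A failed search carries no information. -/
theorem hasWeight_of_searchPattern (p : List Bool) (k : ℕ) (hk : 3 ≤ k) (hk' : k ≤ 5)
    (A : List ℕ) (hA : ∀ n ∈ A, n ∈ List.range' 1 15) (hs : (A.map dec).sum = 0)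
    (h : searchPattern p k A = true) :
    HasWeight (A.map dec : List E4) (patternWeight p + (k - 2)) := by
  induction p generalizing A with
  | nil =>
    obtain ⟨R, hR⟩ := exists_oddPart_add A
    have hlen : (oddPart A).length = k := by simpa [searchPattern] using h
    have hmem : ∀ n ∈ oddPart A, n ∈ A := by
      intro n hn
      rw [← Multiset.mem_coe, ← hR]
      exact Multiset.mem_add.2 (Or.inl hn)
    have hR' : ((oddPart A).map dec : List E4) + 2 • R.map dec = (A.map dec : List E4) := by
      rw [← Multiset.map_coe, ← Multiset.map_coe, ← hR, Multiset.map_add, Multiset.map_nsmul]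
    have hs' : ((oddPart A).map dec).sum = 0 := by
      have := congrArg Multiset.sum hR'
      rw [Multiset.sum_add, E4.sum_two_nsmul, add_zero, Multiset.sum_coe, Multiset.sum_coe, hs]
        at this
      exact this
    obtain ⟨C, hC, hv, hc⟩ := isCircuit_of_codes (l := oddPart A)
      (fun n hn => hA n (hmem n hn)) (oddPart_nodup A) hs' (by omega) (by omega)
    have := hC.hasWeight
    rw [hv, hc, hlen] at this
    rw [← hR']
    simpa [patternWeight] using this.add_squares (R.map dec)
  | cons t p ih =>
    cases t
    · simp only [searchPattern, List.any_eq_true, Bool.and_eq_true, Nat.blt_eq, memb_iff] at h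
      obtain ⟨a, ha, b, hb, hab, c, hc, hbc, hcd, hd, h⟩ := h
      have := hasWeight_of_codes_add (c := [a, b, c, a ^^^ b ^^^ c]) hA hs
        (by simp only [List.nodup_cons, List.mem_cons, List.not_mem_nil, or_false, not_or,
          not_false_eq_true, List.nodup_nil, and_true]; omega)
        (by
          rw [← E4.add_self (dec a + dec b + dec c)]
          simp only [List.map_cons, List.map_nil, List.sum_cons, List.sum_nil, dec_xor]
          abel)
        (by simp) (by simp)
        (by
          rw [coe_removeCode ha, coe_removeCode (mem_removeCode_of_ne hb (by omega)),
            coe_removeCode (mem_removeCode_of_ne (mem_removeCode_of_ne hc (by omega)) (by omega)),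
            coe_removeCode (mem_removeCode_of_ne (mem_removeCode_of_ne
              (mem_removeCode_of_ne hd (by omega)) (by omega)) (by omega))]
          rfl)
        (fun h1 h2 => ih _ h1 h2 h)
      simpa [patternWeight, add_assoc] using this
    · simp only [searchPattern, List.any_eq_true, Bool.and_eq_true, Nat.blt_eq, memb_iff] at h
      obtain ⟨a, ha, b, hb, hab, hbc, hc, h⟩ := h
      have := hasWeight_of_codes_add (c := [a, b, a ^^^ b]) hA hs
        (by simp only [List.nodup_cons, List.mem_cons, List.not_mem_nil, or_false, not_or,
          not_false_eq_true, List.nodup_nil, and_true]; omega)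
        (by
          rw [← E4.add_self (dec a + dec b)]
          simp only [List.map_cons, List.map_nil, List.sum_cons, List.sum_nil, dec_xor]
          abel)
        (by simp) (by simp)
        (by
          rw [coe_removeCode ha, coe_removeCode (mem_removeCode_of_ne hb (by omega)),
            coe_removeCode (mem_removeCode_of_ne (mem_removeCode_of_ne hc (by omega)) (by omega))]
          rfl)
        (fun h1 h2 => ih _ h1 h2 h)
      simpa [patternWeight, add_assoc] using this

/-- The codes of the circuits with `n` elements. -/
def circuitCodes (n : ℕ) : List (List ℕ) :=
  ((List.range' 1 15).sublistsLen n).filter fun l => Nat.beq (xorSum l) 0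

/-! ### Normal forms of circuits under automorphisms -/

/-- The fifteen hypotheses express linear independence over `ZMod 2`, so the linear map taking the
standard basis to $a,b,c,d$ is injective, hence bijective. -/
theorem exists_frame {a b c d : E4} (ha : a ≠ 0) (hb : b ≠ 0) (hc : c ≠ 0) (hd : d ≠ 0)
    (hab : a + b ≠ 0) (hac : a + c ≠ 0) (had : a + d ≠ 0) (hbc : b + c ≠ 0) (hbd : b + d ≠ 0)
    (hcd : c + d ≠ 0) (habc : a + b + c ≠ 0) (habd : a + b + d ≠ 0) (hacd : a + c + d ≠ 0)
    (hbcd : b + c + d ≠ 0) (habcd : a + b + c + d ≠ 0) :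
    ∃ φ : E4 ≃+ E4, φ (dec 1) = a ∧ φ (dec 2) = b ∧ φ (dec 4) = c ∧ φ (dec 8) = d := by
  let f : E4 →ₗ[ZMod 2] E4 :=
    (LinearMap.proj 0).smulRight a + (LinearMap.proj 1).smulRight b +
    (LinearMap.proj 2).smulRight c + (LinearMap.proj 3).smulRight d
  have hf : ∀ x, f x = x 0 • a + x 1 • b + x 2 • c + x 3 • d := fun x => rfl
  have key : ∀ t : ZMod 2, t = 0 ∨ t = 1 := by decide
  have hinj : Function.Injective f := by
    rw [← LinearMap.ker_eq_bot, LinearMap.ker_eq_bot']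
    intro x hx
    rw [hf] at hx
    rcases key (x 0) with h0 | h0 <;> rcases key (x 1) with h1 | h1 <;>
      rcases key (x 2) with h2 | h2 <;> rcases key (x 3) with h3 | h3 <;>
      simp only [h0, h1, h2, h3, zero_smul, one_smul, zero_add, add_zero] at hx <;>
      first
      | (exfalso; contradiction)
      | (funext i; fin_cases i <;> assumption)
  have d1 : dec 1 0 = 1 ∧ dec 1 1 = 0 ∧ dec 1 2 = 0 ∧ dec 1 3 = 0 := by decide +kernel
  have d2 : dec 2 0 = 0 ∧ dec 2 1 = 1 ∧ dec 2 2 = 0 ∧ dec 2 3 = 0 := by decide +kernel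
  have d4 : dec 4 0 = 0 ∧ dec 4 1 = 0 ∧ dec 4 2 = 1 ∧ dec 4 3 = 0 := by decide +kernel
  have d8 : dec 8 0 = 0 ∧ dec 8 1 = 0 ∧ dec 8 2 = 0 ∧ dec 8 3 = 1 := by decide +kernel
  refine ⟨(LinearEquiv.ofInjectiveEndo f hinj).toAddEquiv, ?_, ?_, ?_, ?_⟩
  · change f _ = _; rw [hf]; simp [d1]
  · change f _ = _; rw [hf]; simp [d2]
  · change f _ = _; rw [hf]; simp [d4]
  · change f _ = _; rw [hf]; simp [d8]

/-- The image under `φ` of the sequence with the codes `l`. -/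
def coded (φ : E4 ≃+ E4) (l : List ℕ) : Multiset E4 := ((l.map dec : List E4) : Multiset E4).map φ

theorem coded_append (φ : E4 ≃+ E4) (l m : List ℕ) :
    coded φ (l ++ m) = coded φ l + coded φ m := by
  simp [coded, List.map_append, ← Multiset.coe_add]

theorem coded_cons (φ : E4 ≃+ E4) (n : ℕ) (l : List ℕ) :
    coded φ (n :: l) = φ (dec n) ::ₘ coded φ l := by
  simp [coded]

theorem coded_nil (φ : E4 ≃+ E4) : coded φ [] = 0 := rfl

theorem mem_coded {φ : E4 ≃+ E4} {l : List ℕ} {n : ℕ} (h : n ∈ l) : φ (dec n) ∈ coded φ l := by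
  simp only [coded, Multiset.map_coe, Multiset.mem_coe, List.map_map, List.mem_map]
  exact ⟨n, h, rfl⟩

theorem hasWeight_coded {φ : E4 ≃+ E4} {A : List ℕ} (p : List Bool) (k : ℕ) (hk : 3 ≤ k)
    (hk' : k ≤ 5) (hA : ∀ n ∈ A, n ∈ List.range' 1 15) (hs : (coded φ A).sum = 0)
    (h : searchPattern p k A = true) : HasWeight (coded φ A) (patternWeight p + (k - 2)) := by
  apply HasWeight.map
  apply hasWeight_of_searchPattern p k hk hk' A hA _ h
  rw [coded, ← map_multiset_sum] at hs
  rw [← Multiset.sum_coe]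
  exact (map_eq_zero_iff φ φ.injective).1 hs

theorem exists_code_frame (φ : E4 ≃+ E4) {x : E4} (hx : x ≠ 0) :
    ∃ n ∈ List.range' 1 15, φ (dec n) = x := by
  obtain ⟨n, hn, h⟩ := exists_dec (x := φ.symm x) (by simpa using hx)
  exact ⟨n, hn, by rw [h]; simp⟩

theorem IsCircuit.exists_codes {X : Finset E4} (hX : IsCircuit X) (φ : E4 ≃+ E4) :
    ∃ l ∈ circuitCodes X.card, (∀ n ∈ l, n ∈ List.range' 1 15) ∧ X.val = coded φ l := by
  have hX' := hX.map φ.symm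
  obtain ⟨l, hl, h⟩ := exists_code hX'.zero_notMem
  rw [Finset.card_map] at hl
  have hsub := (List.mem_sublistsLen.1 hl).1.subset
  refine ⟨l, ?_, fun n hn => hsub hn, ?_⟩
  · simp only [circuitCodes, List.mem_filter, hl, true_and, Nat.beq_eq]
    apply xorSum_eq_zero fun n hn => hsub hn
    have := hX'.sum_eq
    rw [← Multiset.sum_coe, ← h, Finset.sum_val]
    exact this
  · rw [coded, ← h, Finset.map_val, Multiset.map_map]
    simp

theorem circuit_val_sum {X : Finset E4} (hX : IsCircuit X) : X.val.sum = 0 := by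
  rw [Finset.sum_val]; exact hX.sum_eq

theorem val_toFinset_of_card {l : List E4} (h : l.toFinset.card = l.length) :
    l.Nodup ∧ l.toFinset.val = l := by
  have hnd : l.Nodup := by
    have := Multiset.toFinset_card_eq_card_iff_nodup (m := (l : Multiset E4))
    exact Multiset.coe_nodup.1 (this.1 h)
  exact ⟨hnd, by rw [List.toFinset_val, hnd.dedup]⟩

/-- Four elements of the circuit form a basis and the fifth is their sum. All five-element circuits
are therefore equivalent. -/
theorem exists_frame_five {a b c d e : E4} (h : IsCircuit {a, b, c, d, e})
    (h5 : Finset.card {a, b, c, d, e} = 5) :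
    ∃ φ : E4 ≃+ E4, φ (dec 1) = a ∧ φ (dec 2) = b ∧ φ (dec 4) = c ∧ φ (dec 8) = d ∧
      φ (dec 15) = e ∧ (({a, b, c, d, e} : Finset E4)).val = coded φ [1, 2, 4, 8, 15] := by
  have he' : ({a, b, c, d, e} : Finset E4) = [a, b, c, d, e].toFinset := by simp
  obtain ⟨hnd, hv⟩ := val_toFinset_of_card (l := [a, b, c, d, e]) (by rw [← he']; simpa using h5)
  rw [← he'] at hv
  have h0 := h.zero_notMem
  have hs : a + b + c + d + e = 0 := by
    have := circuit_val_sum h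
    rw [hv, Multiset.sum_coe] at this
    simpa [add_assoc] using this
  have he : e = a + b + c + d := by
    rw [E4.add_eq_zero_iff] at hs; exact hs.symm
  simp only [Finset.mem_insert, Finset.mem_singleton, not_or] at h0
  simp only [List.nodup_cons, List.mem_cons, List.not_mem_nil, or_false, not_or,
    not_false_eq_true, List.nodup_nil, and_true] at hnd
  obtain ⟨⟨hab, hac, had, hae⟩, ⟨hbc, hbd, hbe⟩, ⟨hcd, hce⟩, hde⟩ := hnd
  obtain ⟨ha, hb, hc, hd, he0⟩ := h0
  -- If three of the first four elements had sum zero, the remaining one would equal `e`.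
  have tri : ∀ x y z t : E4, a + b + c + d = x + y + z + t → t ≠ e → x + y + z ≠ 0 := by
    intro x y z t hx ht hxyz
    rw [hxyz, zero_add] at hx
    exact ht (he ▸ hx.symm)
  obtain ⟨φ, h1, h2, h4, h8⟩ := exists_frame (a := a) (b := b) (c := c) (d := d)
    (Ne.symm ha) (Ne.symm hb) (Ne.symm hc) (Ne.symm hd)
    (mt (E4.add_eq_zero_iff _ _).1 hab) (mt (E4.add_eq_zero_iff _ _).1 hac)
    (mt (E4.add_eq_zero_iff _ _).1 had) (mt (E4.add_eq_zero_iff _ _).1 hbc)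
    (mt (E4.add_eq_zero_iff _ _).1 hbd) (mt (E4.add_eq_zero_iff _ _).1 hcd)
    (tri a b c d rfl hde) (tri a b d c (by abel) hce) (tri a c d b (by abel) hbe)
    (tri b c d a (by abel) hae) (by rw [← he]; exact Ne.symm he0)
  have h15 : φ (dec 15) = e := by
    have : dec 15 = dec 1 + dec 2 + dec 4 + dec 8 := by decide +kernel
    rw [this, map_add, map_add, map_add, h1, h2, h4, h8, he]
  refine ⟨φ, h1, h2, h4, h8, h15, ?_⟩
  rw [hv]
  simp [coded, h1, h2, h4, h8, h15]

theorem IsCircuit.exists_frame_of_card_eq_five {U : Finset E4} (hU : IsCircuit U)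
    (h5 : U.card = 5) : ∃ φ : E4 ≃+ E4, U.val = coded φ [1, 2, 4, 8, 15] := by
  obtain ⟨a, U', haU, rfl, h4⟩ := Finset.card_eq_succ.1 h5
  obtain ⟨b, c, d, e, -, -, -, -, -, -, rfl⟩ := Finset.card_eq_four.1 h4
  obtain ⟨φ, -, -, -, -, -, h⟩ := exists_frame_five hU h5
  exact ⟨φ, h⟩

/-- The element of $V$ outside $U$ is the sum of the three common elements, hence also of the other
two elements of $U$; these have the codes 1 and 2, which yields the code 3. -/
theorem exists_frame_five_four {U V : Finset E4} (hU : IsCircuit U) (hV : IsCircuit V)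
    (hU5 : U.card = 5) (hV4 : V.card = 4) (hUV : (U ∩ V).card = 3) :
    ∃ φ : E4 ≃+ E4, U.val = coded φ [1, 2, 4, 8, 15] ∧ V.val = coded φ [3, 4, 8, 15] := by
  obtain ⟨a, b, hab, h1⟩ := Finset.card_eq_two.1 (show (U \ V).card = 2 by
    have := Finset.card_sdiff_add_card_inter U V; omega)
  obtain ⟨c, d, e, hcd, hce, hde, h2⟩ := Finset.card_eq_three.1 hUV
  obtain ⟨g, h3⟩ := Finset.card_eq_one.1 (show (V \ U).card = 1 by
    have := Finset.card_sdiff_add_card_inter V U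
    rw [Finset.inter_comm] at this; omega)
  have hUe : U = {a, b, c, d, e} := by
    rw [← Finset.sdiff_union_inter U V, h1, h2]; ext x; simp; tauto
  have hVe : V = {g, c, d, e} := by
    rw [← Finset.sdiff_union_inter V U, h3, Finset.inter_comm, h2]; ext x; simp; tauto
  have he' : V = [g, c, d, e].toFinset := by simp [hVe]
  obtain ⟨-, hVv⟩ := val_toFinset_of_card (l := [g, c, d, e]) (by rw [← he']; simpa using hV4)
  rw [← he'] at hVv
  subst hUe
  obtain ⟨φ, h1, h2, h4, h8, h15, hUv⟩ := exists_frame_five hU hU5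
  refine ⟨φ, hUv, ?_⟩
  have hg : φ (dec 3) = g := by
    have h3 : dec 3 = dec 4 + dec 8 + dec 15 := by decide +kernel
    rw [h3, map_add, map_add, h4, h8, h15]
    have := circuit_val_sum hV
    rw [hVv, Multiset.sum_coe] at this
    simp only [List.sum_cons, List.sum_nil, add_zero] at this
    rw [E4.add_eq_zero_iff] at this
    rw [this, add_assoc]
  rw [hVv]
  simp [coded, h4, h8, h15, hg]

theorem exists_frame_four_of_notMem {a b c d x : E4} (h : IsCircuit {a, b, c, d})
    (h4 : Finset.card {a, b, c, d} = 4) (hx : x ∉ ({a, b, c, d} : Finset E4)) (hx0 : x ≠ 0)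
    (hx2 : ∀ y ∈ ({a, b, c, d} : Finset E4), ∀ z ∈ ({a, b, c, d} : Finset E4), x ≠ y + z) :
    ∃ φ : E4 ≃+ E4, φ (dec 8) = x ∧
      (({a, b, c, d} : Finset E4)).val = coded φ [1, 2, 4, 7] := by
  have he' : ({a, b, c, d} : Finset E4) = [a, b, c, d].toFinset := by simp
  obtain ⟨hnd, hv⟩ := val_toFinset_of_card (l := [a, b, c, d]) (by rw [← he']; simpa using h4)
  rw [← he'] at hv
  have h0 := h.zero_notMem
  have hs : a + b + c + d = 0 := by
    have := circuit_val_sum h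
    rw [hv, Multiset.sum_coe] at this
    simpa [add_assoc] using this
  have hd : d = a + b + c := by
    rw [E4.add_eq_zero_iff] at hs; exact hs.symm
  simp only [Finset.mem_insert, Finset.mem_singleton, not_or] at h0 hx
  simp only [List.nodup_cons, List.mem_cons, List.not_mem_nil, or_false, not_or,
    not_false_eq_true, List.nodup_nil, and_true] at hnd
  obtain ⟨⟨hab, hac, had⟩, ⟨hbc, hbd⟩, hcd⟩ := hnd
  obtain ⟨ha, hb, hc, hd0⟩ := h0
  obtain ⟨hxa, hxb, hxc, hxd⟩ := hx
  obtain ⟨φ, h1, h2, h4, h8⟩ := exists_frame (a := a) (b := b) (c := c) (d := x)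
    (Ne.symm ha) (Ne.symm hb) (Ne.symm hc) hx0
    (mt (E4.add_eq_zero_iff _ _).1 hab) (mt (E4.add_eq_zero_iff _ _).1 hac)
    (mt (E4.add_eq_zero_iff _ _).1 (Ne.symm hxa)) (mt (E4.add_eq_zero_iff _ _).1 hbc)
    (mt (E4.add_eq_zero_iff _ _).1 (Ne.symm hxb)) (mt (E4.add_eq_zero_iff _ _).1 (Ne.symm hxc))
    (by rw [← hd]; exact Ne.symm hd0)
    (mt (E4.add_eq_zero_iff _ _).1 (Ne.symm (hx2 a (by simp) b (by simp))))
    (mt (E4.add_eq_zero_iff _ _).1 (Ne.symm (hx2 a (by simp) c (by simp))))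
    (mt (E4.add_eq_zero_iff _ _).1 (Ne.symm (hx2 b (by simp) c (by simp))))
    (mt (E4.add_eq_zero_iff _ _).1 (by rw [← hd]; exact Ne.symm hxd))
  have h7 : φ (dec 7) = d := by
    have : dec 7 = dec 1 + dec 2 + dec 4 := by decide +kernel
    rw [this, map_add, map_add, h1, h2, h4, hd]
  refine ⟨φ, h8, ?_⟩
  rw [hv]
  simp [coded, h1, h2, h4, h7]

theorem IsCircuit.exists_frame_of_card_eq_four {V : Finset E4} (hV : IsCircuit V)
    (h4 : V.card = 4) {x : E4} (hx : x ∉ V) (hx0 : x ≠ 0)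
    (hx2 : ∀ y ∈ V, ∀ z ∈ V, x ≠ y + z) :
    ∃ φ : E4 ≃+ E4, φ (dec 8) = x ∧ V.val = coded φ [1, 2, 4, 7] := by
  obtain ⟨a, b, c, d, -, -, -, -, -, -, rfl⟩ := Finset.card_eq_four.1 h4
  exact exists_frame_four_of_notMem hV h4 hx hx0 hx2

/-- The span of $V$ has at most eight elements: $0$, the elements of $V$, and three pair sums, since
complementary pairs have equal sums. -/
theorem IsCircuit.exists_notMem_span {V : Finset E4} (hV : IsCircuit V) (h4 : V.card = 4) :
    ∃ x, x ∉ V ∧ x ≠ 0 ∧ ∀ y ∈ V, ∀ z ∈ V, x ≠ y + z := by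
  obtain ⟨a, b, c, d, -, -, -, -, -, -, rfl⟩ := Finset.card_eq_four.1 h4
  have he' : ({a, b, c, d} : Finset E4) = [a, b, c, d].toFinset := by simp
  obtain ⟨hnd, hv⟩ := val_toFinset_of_card (l := [a, b, c, d]) (by rw [← he']; simpa using h4)
  rw [← he'] at hv
  have hs : a + b + c + d = 0 := by
    have := circuit_val_sum hV
    rw [hv, Multiset.sum_coe] at this
    simpa [add_assoc] using this
  have hd : d = a + b + c := by
    rw [E4.add_eq_zero_iff] at hs; exact hs.symm
  obtain ⟨x, hx⟩ : ∃ x : E4, x ∉ ({0, a, b, c, d, a + b, a + c, b + c} : Finset E4) := by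
    by_contra hcon
    push Not at hcon
    have h1 : (Finset.univ : Finset E4).card ≤ 8 :=
      (Finset.card_le_card (fun x _ => by simpa using hcon x)).trans
        (List.toFinset_card_le [0, a, b, c, d, a + b, a + c, b + c])
    have h2 : (Finset.univ : Finset E4).card = 16 := by simp [Finset.card_univ, E4]
    omega
  simp only [Finset.mem_insert, Finset.mem_singleton, not_or] at hx
  obtain ⟨h0, ha, hb, hc, hd', hab, hac, hbc⟩ := hx
  refine ⟨x, by simp [ha, hb, hc, hd'], h0, ?_⟩
  have e1 : a + d = b + c := by
    rw [hd, ← add_assoc, ← add_assoc, E4.add_self, zero_add]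
  have e2 : b + d = a + c := by
    rw [hd, show b + (a + b + c) = b + b + (a + c) by abel, E4.add_self, zero_add]
  have e3 : c + d = a + b := by
    rw [hd, show c + (a + b + c) = c + c + (a + b) by abel, E4.add_self, zero_add]
  simp only [Finset.mem_insert, Finset.mem_singleton]
  rintro y (rfl | rfl | rfl | rfl) z (rfl | rfl | rfl | rfl)
  all_goals
    simp only [E4.add_self, ne_eq, h0, hab, hac, hbc, e1, e2, e3, not_false_eq_true]
  all_goals
    first
    | done
    | (rw [add_comm]; simp only [hab, hac, hbc, e1, e2, e3, not_false_eq_true])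

theorem any_memb_eq_false {φ : E4 ≃+ E4} {X Y : Finset E4} {l m : List ℕ} (hXY : Disjoint X Y)
    (hX : X.val = coded φ l) (hY : Y.val = coded φ m) : (m.any fun n => memb n l) = false := by
  rw [Bool.eq_false_iff]
  intro h
  obtain ⟨n, hn, hn'⟩ := List.any_eq_true.1 h
  have h1 : φ (dec n) ∈ X := by rw [← Finset.mem_val, hX]; exact mem_coded (memb_iff.1 hn')
  have h2 : φ (dec n) ∈ Y := by rw [← Finset.mem_val, hY]; exact mem_coded hn
  exact Finset.disjoint_left.1 hXY h1 h2

/-! ### Configurations whose weight can drop by two -/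

/-- Two five-element circuits have weight 6, while both patterns have weight 4. In each of the
following searches too, the pattern weighs two less than the given product. The configurations
exempted by the other alternatives are equalities or overlaps. -/
theorem search_five_five : ((circuitCodes 5).all fun l =>
    (l == [1, 2, 4, 8, 15]) || (searchPattern [false] 4 ([1, 2, 4, 8, 15] ++ l) ||
      searchPattern [true, true] 4 ([1, 2, 4, 8, 15] ++ l))) = true := by
  decide +kernel

theorem search_five_four : ((circuitCodes 4).all fun l =>
    (l.any fun n => memb n [1, 2, 4, 8, 15]) ||
      searchPattern [true, true] 3 ([1, 2, 4, 8, 15] ++ l)) = true := by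
  decide +kernel

theorem search_two_five_three : ((circuitCodes 3).all fun l =>
    (l.any fun n => memb n [1, 2, 4, 8, 15]) ||
      searchPattern [false] 5 ([1, 2, 4, 8, 15] ++ [1, 2, 4, 8, 15] ++ l)) = true := by
  decide +kernel

theorem search_two_five_square : ((List.range' 1 15).all fun n =>
    memb n [1, 2, 4, 8, 15] ||
      searchPattern [false] 4 ([1, 2, 4, 8, 15] ++ [1, 2, 4, 8, 15] ++ [n, n])) = true := by
  decide +kernel

theorem search_five_four_three : ((circuitCodes 3).all fun l =>
    (l.any fun n => memb n [1, 2, 4, 8, 15]) || ((l.any fun n => memb n [3, 4, 8, 15]) ||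
      searchPattern [false] 4 ([1, 2, 4, 8, 15] ++ [3, 4, 8, 15] ++ l))) = true := by
  decide +kernel

theorem search_five_four_square : ((List.range' 1 15).all fun n =>
    memb n [1, 2, 4, 8, 15] || (memb n [3, 4, 8, 15] ||
      searchPattern [false] 3 ([1, 2, 4, 8, 15] ++ [3, 4, 8, 15] ++ [n, n]))) = true := by
  decide +kernel

theorem search_two_four_three : ((circuitCodes 3).all fun l =>
    (l.any fun n => memb n [1, 2, 4, 7]) ||
      searchPattern [false] 3 ([1, 2, 4, 7] ++ [1, 2, 4, 7] ++ l)) = true := by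
  decide +kernel

theorem search_two_four_four : ((circuitCodes 4).all fun l =>
    (l.any fun n => memb n [1, 2, 4, 7]) ||
      searchPattern [false] 4 ([1, 2, 4, 7] ++ [1, 2, 4, 7] ++ l)) = true := by
  decide +kernel

theorem forall_mem_append {l m : List ℕ} (hl : ∀ n ∈ l, n ∈ List.range' 1 15)
    (hm : ∀ n ∈ m, n ∈ List.range' 1 15) : ∀ n ∈ l ++ m, n ∈ List.range' 1 15 := by
  intro n hn
  rcases List.mem_append.1 hn with h | h
  · exact hl n h
  · exact hm n h

theorem forall_mem_pair {n : ℕ} (hn : n ∈ List.range' 1 15) :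
    ∀ k ∈ [n, n], k ∈ List.range' 1 15 := by
  intro k hk
  simp only [List.mem_cons, List.not_mem_nil, or_false, or_self] at hk
  exact hk ▸ hn

theorem coded_pair (φ : E4 ≃+ E4) (n : ℕ) : coded φ [n, n] = 2 • {φ (dec n)} := by
  rw [coded_cons, coded_cons, coded_nil, two_nsmul]; rfl

theorem two_nsmul_eq_coded {φ : E4 ≃+ E4} {X : Finset E4} {l : List ℕ} (h : X.val = coded φ l) :
    2 • X.val = coded φ (l ++ l) := by
  rw [coded_append, two_nsmul, h]

variable {U V T : Finset E4}

theorem hasWeight_five_five (hU : IsCircuit U) (hV : IsCircuit V) (hU5 : U.card = 5)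
    (hV5 : V.card = 5) (hne : U ≠ V) : HasWeight (U.val + V.val) 4 := by
  obtain ⟨φ, hφ⟩ := hU.exists_frame_of_card_eq_five hU5
  obtain ⟨l, hl, hr, hv⟩ := hV.exists_codes φ
  rw [hV5] at hl
  have h := List.all_eq_true.1 search_five_five l hl
  simp only [Bool.or_eq_true, beq_iff_eq] at h
  have hs : (coded φ ([1, 2, 4, 8, 15] ++ l)).sum = 0 := by
    rw [coded_append, ← hφ, ← hv, Multiset.sum_add, circuit_val_sum hU, circuit_val_sum hV,
      add_zero]
  have hr' := forall_mem_append (l := [1, 2, 4, 8, 15]) (by decide) hr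
  rw [hφ, hv, ← coded_append]
  rcases h with h | h | h
  · exact absurd (Finset.val_injective (by rw [hφ, hv, h])) hne
  · exact hasWeight_coded [false] 4 (by norm_num) (by norm_num) hr' hs h
  · exact hasWeight_coded [true, true] 4 (by norm_num) (by norm_num) hr' hs h

theorem hasWeight_five_four (hU : IsCircuit U) (hV : IsCircuit V) (hU5 : U.card = 5)
    (hV4 : V.card = 4) (hd : Disjoint U V) : HasWeight (U.val + V.val) 3 := by
  obtain ⟨φ, hφ⟩ := hU.exists_frame_of_card_eq_five hU5
  obtain ⟨l, hl, hr, hv⟩ := hV.exists_codes φ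
  rw [hV4] at hl
  have h := List.all_eq_true.1 search_five_four l hl
  rw [any_memb_eq_false hd hφ hv, Bool.false_or] at h
  have hs : (coded φ ([1, 2, 4, 8, 15] ++ l)).sum = 0 := by
    rw [coded_append, ← hφ, ← hv, Multiset.sum_add, circuit_val_sum hU, circuit_val_sum hV,
      add_zero]
  rw [hφ, hv, ← coded_append]
  exact hasWeight_coded [true, true] 3 (by norm_num) (by norm_num)
    (forall_mem_append (by decide) hr) hs h

theorem hasWeight_two_five_three (hU : IsCircuit U) (hT : IsCircuit T) (hU5 : U.card = 5)
    (hT3 : T.card = 3) (hd : Disjoint U T) : HasWeight (2 • U.val + T.val) 5 := by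
  obtain ⟨φ, hφ⟩ := hU.exists_frame_of_card_eq_five hU5
  obtain ⟨l, hl, hr, hv⟩ := hT.exists_codes φ
  rw [hT3] at hl
  have h := List.all_eq_true.1 search_two_five_three l hl
  rw [any_memb_eq_false hd hφ hv, Bool.false_or] at h
  rw [two_nsmul_eq_coded hφ, hv, ← coded_append]
  refine hasWeight_coded [false] 5 (by norm_num) (by norm_num)
    (forall_mem_append (by decide) hr) ?_ h
  rw [coded_append, ← two_nsmul_eq_coded hφ, ← hv, Multiset.sum_add, E4.sum_two_nsmul,
    circuit_val_sum hT, add_zero]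

theorem hasWeight_two_five_square (hU : IsCircuit U) (hU5 : U.card = 5) {g : E4} (hg : g ≠ 0)
    (hgU : g ∉ U) : HasWeight (2 • U.val + 2 • {g}) 4 := by
  obtain ⟨φ, hφ⟩ := hU.exists_frame_of_card_eq_five hU5
  obtain ⟨n, hn, rfl⟩ := exists_code_frame φ hg
  have h := List.all_eq_true.1 search_two_five_square n hn
  rw [Bool.or_eq_true] at h
  rcases h with h | h
  · exact absurd (by rw [← Finset.mem_val, hφ]; exact mem_coded (memb_iff.1 h)) hgU
  rw [two_nsmul_eq_coded hφ, ← coded_pair, ← coded_append]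
  refine hasWeight_coded [false] 4 (by norm_num) (by norm_num)
    (forall_mem_append (by decide) (forall_mem_pair hn)) ?_ h
  rw [coded_append, ← two_nsmul_eq_coded hφ, coded_pair, Multiset.sum_add, E4.sum_two_nsmul,
    E4.sum_two_nsmul, add_zero]

theorem hasWeight_five_four_three (hU : IsCircuit U) (hV : IsCircuit V) (hT : IsCircuit T)
    (hU5 : U.card = 5) (hV4 : V.card = 4) (hT3 : T.card = 3) (hUV : (U ∩ V).card = 3)
    (hUT : Disjoint U T) (hVT : Disjoint V T) : HasWeight (U.val + V.val + T.val) 4 := by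
  obtain ⟨φ, hφ, hφ'⟩ := exists_frame_five_four hU hV hU5 hV4 hUV
  obtain ⟨l, hl, hr, hv⟩ := hT.exists_codes φ
  rw [hT3] at hl
  have h := List.all_eq_true.1 search_five_four_three l hl
  rw [any_memb_eq_false hUT hφ hv, any_memb_eq_false hVT hφ' hv, Bool.false_or,
    Bool.false_or] at h
  have hs := circuit_val_sum hU
  have hs' := circuit_val_sum hV
  have hs'' := circuit_val_sum hT
  rw [hφ] at hs ⊢
  rw [hφ'] at hs' ⊢
  rw [hv] at hs'' ⊢
  rw [← coded_append, ← coded_append]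
  refine hasWeight_coded [false] 4 (by norm_num) (by norm_num)
    (forall_mem_append (by decide) hr) ?_ h
  rw [coded_append, coded_append, Multiset.sum_add, Multiset.sum_add, hs, hs', hs'', add_zero,
    add_zero]

theorem hasWeight_five_four_square (hU : IsCircuit U) (hV : IsCircuit V)
    (hU5 : U.card = 5) (hV4 : V.card = 4) (hUV : (U ∩ V).card = 3) {g : E4} (hg : g ≠ 0)
    (hgU : g ∉ U) (hgV : g ∉ V) : HasWeight (U.val + V.val + 2 • {g}) 3 := by
  obtain ⟨φ, hφ, hφ'⟩ := exists_frame_five_four hU hV hU5 hV4 hUV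
  obtain ⟨n, hn, rfl⟩ := exists_code_frame φ hg
  have h := List.all_eq_true.1 search_five_four_square n hn
  rw [Bool.or_eq_true, Bool.or_eq_true] at h
  rcases h with h | h | h
  · exact absurd (by rw [← Finset.mem_val, hφ]; exact mem_coded (memb_iff.1 h)) hgU
  · exact absurd (by rw [← Finset.mem_val, hφ']; exact mem_coded (memb_iff.1 h)) hgV
  have hs := circuit_val_sum hU
  have hs' := circuit_val_sum hV
  rw [hφ] at hs ⊢
  rw [hφ'] at hs' ⊢
  rw [← coded_pair, ← coded_append, ← coded_append]
  refine hasWeight_coded [false] 3 (by norm_num) (by norm_num)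
    (forall_mem_append (by decide) (forall_mem_pair hn)) ?_ h
  rw [coded_append, coded_append, coded_pair, Multiset.sum_add, Multiset.sum_add, hs, hs',
    E4.sum_two_nsmul, add_zero, add_zero]

theorem IsCircuit.exists_frame_four (hV : IsCircuit V) (hV4 : V.card = 4) :
    ∃ φ : E4 ≃+ E4, V.val = coded φ [1, 2, 4, 7] := by
  obtain ⟨x, hx, hx0, hx2⟩ := hV.exists_notMem_span hV4
  obtain ⟨φ, -, hφ⟩ := hV.exists_frame_of_card_eq_four hV4 hx hx0 hx2
  exact ⟨φ, hφ⟩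

theorem hasWeight_two_four_three (hV : IsCircuit V) (hT : IsCircuit T) (hV4 : V.card = 4)
    (hT3 : T.card = 3) (hd : Disjoint V T) : HasWeight (2 • V.val + T.val) 3 := by
  obtain ⟨φ, hφ⟩ := hV.exists_frame_four hV4
  obtain ⟨l, hl, hr, hv⟩ := hT.exists_codes φ
  rw [hT3] at hl
  have h := List.all_eq_true.1 search_two_four_three l hl
  rw [any_memb_eq_false hd hφ hv, Bool.false_or] at h
  rw [two_nsmul_eq_coded hφ, hv, ← coded_append]
  refine hasWeight_coded [false] 3 (by norm_num) (by norm_num)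
    (forall_mem_append (by decide) hr) ?_ h
  rw [coded_append, ← two_nsmul_eq_coded hφ, ← hv, Multiset.sum_add, E4.sum_two_nsmul,
    circuit_val_sum hT, add_zero]

theorem hasWeight_two_four_four {V' : Finset E4} (hV : IsCircuit V) (hV' : IsCircuit V')
    (hV4 : V.card = 4) (hV4' : V'.card = 4) (hd : Disjoint V V') :
    HasWeight (2 • V.val + V'.val) 4 := by
  obtain ⟨φ, hφ⟩ := hV.exists_frame_four hV4
  obtain ⟨l, hl, hr, hv⟩ := hV'.exists_codes φ
  rw [hV4'] at hl
  have h := List.all_eq_true.1 search_two_four_four l hl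
  rw [any_memb_eq_false hd hφ hv, Bool.false_or] at h
  rw [two_nsmul_eq_coded hφ, hv, ← coded_append]
  refine hasWeight_coded [false] 4 (by norm_num) (by norm_num)
    (forall_mem_append (by decide) hr) ?_ h
  rw [coded_append, ← two_nsmul_eq_coded hφ, ← hv, Multiset.sum_add, E4.sum_two_nsmul,
    circuit_val_sum hV', add_zero]

/-! ### Exchange of two circuits for their symmetric difference -/

/-- Common elements turn into squares. This is the basic exchange applied to pairs of overlapping
circuits. -/
theorem val_add_val (U V : Finset E4) :
    U.val + V.val = (symmDiff U V).val + 2 • (U ∩ V).val := by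
  ext x
  have hc : ∀ X : Finset E4, X.val.count x = if x ∈ X then 1 else 0 := by
    intro X
    split_ifs with h
    · exact Multiset.count_eq_one_of_mem X.nodup h
    · exact Multiset.count_eq_zero_of_notMem h
  simp only [Multiset.count_add, Multiset.count_nsmul, hc, Finset.mem_symmDiff, Finset.mem_inter]
  by_cases h1 : x ∈ U <;> by_cases h2 : x ∈ V <;> simp [h1, h2]

theorem card_symmDiff_add (U V : Finset E4) :
    (symmDiff U V).card + 2 * (U ∩ V).card = U.card + V.card := by
  have := congrArg Multiset.card (val_add_val U V)
  simp only [Multiset.card_add, Multiset.card_nsmul, Finset.card_val] at this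
  omega

theorem sum_symmDiff (hU : IsCircuit U) (hV : IsCircuit V) : ∑ x ∈ symmDiff U V, x = 0 := by
  have := congrArg Multiset.sum (val_add_val U V)
  rw [Multiset.sum_add, Multiset.sum_add, E4.sum_two_nsmul, circuit_val_sum hU,
    circuit_val_sum hV, add_zero, add_zero, Finset.sum_val] at this
  exact this.symm

theorem zero_notMem_symmDiff (hU : IsCircuit U) (hV : IsCircuit V) : (0 : E4) ∉ symmDiff U V := by
  rw [Finset.mem_symmDiff]
  rintro (h | h)
  · exact hU.zero_notMem h.1
  · exact hV.zero_notMem h.1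

theorem three_le_card_symmDiff (hU : IsCircuit U) (hV : IsCircuit V) (hne : U ≠ V) :
    3 ≤ (symmDiff U V).card := by
  apply three_le_card_of_sum_eq_zero (zero_notMem_symmDiff hU hV) (sum_symmDiff hU hV)
  rw [Finset.nonempty_iff_ne_empty]
  exact fun h => hne (symmDiff_eq_bot.1 h)

theorem IsCircuit.symmDiff (hU : IsCircuit U) (hV : IsCircuit V) (hne : U ≠ V)
    (h5 : (symmDiff U V).card ≤ 5) : IsCircuit (symmDiff U V) :=
  ⟨zero_notMem_symmDiff hU hV, sum_symmDiff hU hV, three_le_card_symmDiff hU hV hne, h5⟩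

/-- The symmetric difference splits into two zero-sum sets with at least three elements each, hence
at most five, so both are circuits. -/
theorem hasWeight_of_card_symmDiff (hU : IsCircuit U) (hV : IsCircuit V)
    (h6 : 6 ≤ (symmDiff U V).card) (h8 : (symmDiff U V).card ≤ 8) :
    HasWeight (U.val + V.val) ((symmDiff U V).card - 4) := by
  obtain ⟨Y, hY, hs, hs', h3, h3'⟩ :=
    exists_zero_sum_split (zero_notMem_symmDiff hU hV) (sum_symmDiff hU hV) h6
  have hc := Finset.card_sdiff_add_card_eq_card hY
  have c1 : IsCircuit Y := ⟨fun h => zero_notMem_symmDiff hU hV (hY h), hs, h3, by omega⟩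
  have c2 : IsCircuit (_root_.symmDiff U V \ Y) :=
    ⟨fun h => zero_notMem_symmDiff hU hV (Finset.mem_sdiff.1 h).1, hs', h3', by omega⟩
  have hv : (_root_.symmDiff U V).val = Y.val + (_root_.symmDiff U V \ Y).val := by
    rw [Finset.sdiff_val, add_tsub_cancel_of_le (Finset.val_le_iff.2 hY)]
  rw [val_add_val, hv]
  have := (c1.hasWeight.add c2.hasWeight).add_squares (U ∩ V).val
  convert this using 1
  omega

theorem hasWeight_two_three (hT : IsCircuit T) (hT3 : T.card = 3) : HasWeight (2 • T.val) 2 := by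
  have := hT.hasWeight.add hT.hasWeight
  rwa [hT3, ← two_nsmul] at this

/-- The five elements of $U$ and their ten pair sums exhaust the fifteen nonzero elements. -/
theorem exists_add_of_mem_notMem {g : E4} (hU : IsCircuit U) (hU5 : U.card = 5) (hg : g ≠ 0)
    (hgU : g ∉ U) : ∃ x ∈ U, ∃ y ∈ U, x ≠ y ∧ g = x + y := by
  obtain ⟨φ, hφ⟩ := hU.exists_frame_of_card_eq_five hU5
  obtain ⟨n, hn, rfl⟩ := exists_code_frame φ hg
  have key : ∀ n ∈ List.range' 1 15, n ∈ [1, 2, 4, 8, 15] ∨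
      ∃ x ∈ [1, 2, 4, 8, 15], ∃ y ∈ [1, 2, 4, 8, 15], dec x ≠ dec y ∧ n = x ^^^ y := by
    decide +kernel
  have hmem : ∀ k ∈ [1, 2, 4, 8, 15], φ (dec k) ∈ U := by
    intro k hk
    rw [← Finset.mem_val, hφ]; exact mem_coded hk
  rcases key n hn with h | ⟨x, hx, y, hy, hxy, rfl⟩
  · exact absurd (hmem n h) hgU
  · exact ⟨_, hmem x hx, _, hmem y hy, fun h => hxy (φ.injective h), by rw [dec_xor, map_add]⟩

theorem isCircuit_triple {x y : E4} (hx : x ≠ 0) (hy : y ≠ 0) (hxy : x ≠ y) :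
    IsCircuit {x + y, x, y} ∧ Finset.card {x + y, x, y} = 3 := by
  have h1 : x + y ≠ x := by simpa using hy
  have h2 : x + y ≠ y := by simpa using hx
  have h3 : x + y ≠ 0 := mt (E4.add_eq_zero_iff _ _).1 hxy
  have hc : Finset.card {x + y, x, y} = 3 := Finset.card_eq_three.2 ⟨_, _, _, h1, h2, hxy, rfl⟩
  refine ⟨⟨?_, ?_, hc.ge, by rw [hc]; norm_num⟩, hc⟩
  · simp [h3.symm, hx.symm, hy.symm]
  · rw [Finset.sum_insert (by simp [h1, h2]), Finset.sum_pair hxy, E4.add_self]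

/-! ### Reduced factorizations above a gap -/

theorem weight_le_mul_card {F : Multiset (Finset E4)} {c : ℕ} (hF : ∀ C ∈ F, C.card ≤ c + 2) :
    weight F ≤ c * F.card := by
  induction F using Multiset.induction with
  | empty => simp
  | cons C F ih =>
    have h1 := ih fun D hD => hF D (Multiset.mem_cons_of_mem hD)
    have h2 := hF C (Multiset.mem_cons_self C F)
    simp only [weight_cons, Multiset.card_cons, mul_add, mul_one]
    omega

theorem nodup_cover {F : Multiset (Finset E4)} (H : ∀ C D, C ::ₘ {D} ≤ F → Disjoint C D) :
    (cover F).Nodup := by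
  induction F using Multiset.induction with
  | empty => simp
  | cons C F ih =>
    rw [cover_cons, Multiset.nodup_add]
    refine ⟨C.nodup, ih fun D D' h => H D D' (h.trans (Multiset.le_cons_self F C)), ?_⟩
    rw [Multiset.disjoint_left]
    intro x hx hx'
    obtain ⟨D, hD, hxD⟩ := mem_cover.1 hx'
    exact Finset.disjoint_left.1
      (H C D (Multiset.cons_le_cons C (Multiset.singleton_le.2 hD))) hx hxD

theorem pair_le_of_mem_of_ne {α : Type*} {F : Multiset α} {C D : α} (hC : C ∈ F) (hD : D ∈ F)
    (hne : C ≠ D) : C ::ₘ {D} ≤ F := by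
  obtain ⟨F', rfl⟩ := Multiset.exists_cons_of_mem hC
  refine Multiset.cons_le_cons C (Multiset.singleton_le.2 ?_)
  rcases Multiset.mem_cons.1 hD with h | h
  · exact absurd h.symm hne
  · exact h

theorem cons_pair_le_of_mem {α : Type*} {F : Multiset α} {B C D : α} (hB : B ∈ F)
    (h : C ::ₘ {D} ≤ F) (hC : B ≠ C) (hD : B ≠ D) : B ::ₘ C ::ₘ {D} ≤ F := by
  obtain ⟨F', rfl⟩ := Multiset.le_iff_exists_add.1 h
  have hB' : B ∈ F' := by
    rcases Multiset.mem_add.1 hB with h | h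
    · simp [hC, hD] at h
    · exact h
  rw [← Multiset.singleton_add, add_comm]
  exact add_le_add_right (Multiset.singleton_le.2 hB') _

/-- A factorization with circuits `F` and squares `R` of weight `w` with the least possible number
of circuits, such that there is none of weight `w - 2`. -/
structure ReducedGap (A : Multiset E4) (F : Multiset (Finset E4)) (R : Multiset E4) : Prop where
  circuits : ∀ C ∈ F, IsCircuit C
  eq : cover F + 2 • R = A
  gap : ¬ HasWeight A (weight F - 2)
  minimal : ∀ F' R', (∀ C ∈ F', IsCircuit C) → cover F' + 2 • R' = A → weight F' = weight F →
    F.card ≤ F'.card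

theorem exists_reducedGap {A : Multiset E4} {w : ℕ} (hw : HasWeight A w)
    (hgap : ¬ HasWeight A (w - 2)) : ∃ F R, ReducedGap A F R ∧ weight F = w := by
  classical
  have hex : ∃ n, ∃ F : Multiset (Finset E4), ∃ R : Multiset E4,
      (∀ C ∈ F, IsCircuit C) ∧ cover F + 2 • R = A ∧ weight F = w ∧ F.card = n := by
    obtain ⟨F, R, hF, hA, hwt⟩ := hw
    exact ⟨_, F, R, hF, hA, hwt, rfl⟩
  obtain ⟨F, R, hF, hA, hwt, hc⟩ := Nat.find_spec hex
  refine ⟨F, R, ⟨hF, hA, hwt ▸ hgap, ?_⟩, hwt⟩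
  intro F' R' hF' hA' hwt'
  rw [hc]
  exact Nat.find_min' hex ⟨F', R', hF', hA', hwt'.trans hwt, rfl⟩

namespace ReducedGap

variable {A : Multiset E4} {F : Multiset (Finset E4)} {R : Multiset E4}

/-- Lowering the weight of a part by two, with the rest untouched, lowers the total weight by two
and contradicts the gap. -/
theorem no_drop (h : ReducedGap A F R) {F₀ : Multiset (Finset E4)} {R₀ : Multiset E4} {v : ℕ}
    (hF : F₀ ≤ F) (hR : R₀ ≤ R) (hv : v + 2 = weight F₀) :
    ¬ HasWeight (cover F₀ + 2 • R₀) v := by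
  intro hw
  obtain ⟨F₁, rfl⟩ := Multiset.le_iff_exists_add.1 hF
  obtain ⟨R₁, rfl⟩ := Multiset.le_iff_exists_add.1 hR
  apply h.gap
  have h1 : HasWeight (cover F₁) (weight F₁) :=
    HasWeight.of_circuits fun C hC => h.circuits C (Multiset.mem_add.2 (Or.inr hC))
  have h2 := (hw.add h1).add_squares R₁
  rw [← h.eq, cover_add, smul_add, weight_add]
  convert h2 using 1
  · abel
  · omega

theorem no_drop_pair (h : ReducedGap A F R) (hF : U ::ₘ {V} ≤ F) {v : ℕ}
    (hv : v + 6 = U.card + V.card) : ¬ HasWeight (U.val + V.val) v := by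
  have hU := h.circuits U (Multiset.mem_of_le hF (by simp))
  have hV := h.circuits V (Multiset.mem_of_le hF (by simp))
  have := h.no_drop (v := v) hF (Multiset.zero_le R) (by
    have := hU.three_le; have := hV.three_le
    simp [weight]; omega)
  simpa [cover] using this

/-- Let $i$ be the number of common elements. If the symmetric difference is a circuit, the exchange
changes the weight by $2-2i$: for $i=1$ it saves a circuit, against minimality, and for $i=2$ it
contradicts the gap. For $i\ge 3$ one needs $|U|+|V|\ge 9$. Two distinct five-element circuits, and
disjoint circuits with five and four elements, are excluded by search. -/
theorem pair_cases (h : ReducedGap A F R) (hF : U ::ₘ {V} ≤ F) (hne : U ≠ V) :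
    (Disjoint U V ∧ U.card + V.card ≤ 8) ∨
    (U.card + V.card = 9 ∧ (U ∩ V).card = 3) := by
  have hU := h.circuits U (Multiset.mem_of_le hF (by simp))
  have hV := h.circuits V (Multiset.mem_of_le hF (by simp))
  have hU3 := hU.three_le
  have hV3 := hV.three_le
  have hU5 := hU.le_five
  have hV5 := hV.le_five
  have hlt : ¬ (U.card = 5 ∧ V.card = 5) := fun ⟨h1, h2⟩ =>
    h.no_drop_pair hF (by omega) (hasWeight_five_five hU hV h1 h2 hne)
  have hn := three_le_card_symmDiff hU hV hne
  have hcard := card_symmDiff_add U V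
  by_cases hd : Disjoint U V
  · left
    refine ⟨hd, ?_⟩
    by_contra h9
    have : (U.card = 5 ∧ V.card = 4) ∨ (U.card = 4 ∧ V.card = 5) := by omega
    rcases this with ⟨h1, h2⟩ | ⟨h1, h2⟩
    · exact h.no_drop_pair hF (by omega) (hasWeight_five_four hU hV h1 h2 hd)
    · refine h.no_drop_pair hF (v := 3) (by omega) ?_
      rw [add_comm]
      exact hasWeight_five_four hV hU h2 h1 hd.symm
  · right
    have hi : 0 < (U ∩ V).card := by
      rw [Finset.card_pos, Finset.nonempty_iff_ne_empty]
      exact fun h => hd (Finset.disjoint_iff_inter_eq_empty.2 h)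
    by_cases h5 : (symmDiff U V).card ≤ 5
    · have hC := hU.symmDiff hV hne h5
      by_cases h1 : (U ∩ V).card = 1
      · exfalso
        obtain ⟨F₁, rfl⟩ := Multiset.le_iff_exists_add.1 hF
        have := h.minimal (symmDiff U V ::ₘ F₁) ((U ∩ V).val + R) (by
          intro C hC'
          rcases Multiset.mem_cons.1 hC' with rfl | hC'
          · exact hC
          · exact h.circuits C (Multiset.mem_add.2 (Or.inr hC')))
          (by
            rw [← h.eq, cover_cons, cover_add, cover_cons, smul_add]
            have := val_add_val U V
            have e : cover {V} = V.val := by simp [cover]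
            rw [e, this]; abel)
          (by simp [weight]; omega)
        simp at this
      · by_cases h2 : (U ∩ V).card = 2
        · exfalso
          refine h.no_drop_pair hF (v := (symmDiff U V).card - 2) (by omega) ?_
          rw [val_add_val]
          exact hC.hasWeight.add_squares _
        · omega
    -- The total is at most 9, so a symmetric difference with at least six elements leaves $i=1$.
    -- Splitting it into two circuits loses weight two.
    · exfalso
      by_cases h1 : (U ∩ V).card = 1
      · refine h.no_drop_pair hF (v := (symmDiff U V).card - 4) (by omega) ?_
        exact hasWeight_of_card_symmDiff hU hV (by omega) (by omega)
      · omega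

theorem card_ne_three (h : ReducedGap A F R) (hF : T ::ₘ {T} ≤ F) : T.card ≠ 3 := by
  intro h3
  refine h.no_drop_pair hF (v := 0) (by omega) ?_
  rw [← two_nsmul]
  exact HasWeight.squares _

/-- In a reduced factorization below a gap some circuits overlap. -/
theorem exists_not_disjoint (h : ReducedGap A F R) (hlt : ∃ v < weight F, HasWeight A v) :
    ∃ C D, C ::ₘ {D} ≤ F ∧ ¬ Disjoint C D := by
  by_contra H
  push Not at H
  have hnd := nodup_cover H
  have hc := card_cover h.circuits
  have h16 : (cover F).card ≤ 16 := by
    have := Finset.card_le_univ (⟨cover F, hnd⟩ : Finset E4)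
    have h2 : Fintype.card E4 = 16 := by simp [E4]
    rw [h2] at this
    exact this
  obtain ⟨v, hv, hAv⟩ := hlt
  -- All weights have the same parity, and the gap excludes `weight F - 2`.
  have hv4 : v + 4 ≤ weight F := by
    have h1 := hAv.mod_two
    have h2 : HasWeight A (weight F) := ⟨F, R, h.circuits, h.eq, rfl⟩
    have h3 := h2.mod_two
    have h4 : v ≠ weight F - 2 := fun e => h.gap (e ▸ hAv)
    omega
  obtain ⟨F', R', hF', hA', rfl⟩ := hAv
  -- If the circuits are pairwise disjoint, each of their elements has odd multiplicity in `A`, so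
  -- the circuits of any other factorization cover it too.
  have hle : (cover F).card ≤ (cover F').card := by
    apply Multiset.card_le_card
    rw [Multiset.le_iff_subset hnd]
    intro x hx
    have h1 := congrArg (Multiset.count x) (h.eq.trans hA'.symm)
    rw [Multiset.count_add, Multiset.count_add, Multiset.count_nsmul, Multiset.count_nsmul,
      Multiset.count_eq_one_of_mem hnd hx] at h1
    rw [← Multiset.count_pos]
    omega
  rw [card_cover hF', hc] at hle
  have hcw := card_le_weight hF'
  -- Now $w+2|F|\le 3v\le 3(w-4)$ with $w$ the weight of `F`, so $|F|+6\le w$. Next to a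
  -- five-element circuit all others are triples, and $w\le |F|+2$. Otherwise $w\le 2|F|$, which is
  -- incompatible with $w+2|F|\le 16$.
  by_cases h5 : ∃ U ∈ F, U.card = 5
  · obtain ⟨U, hU, hU5⟩ := h5
    obtain ⟨F₁, rfl⟩ := Multiset.exists_cons_of_mem hU
    have := weight_le_mul_card (F := F₁) (c := 1) (by
      intro C hC
      have hle : U ::ₘ {C} ≤ U ::ₘ F₁ := Multiset.cons_le_cons U (Multiset.singleton_le.2 hC)
      have hUC : U ≠ C := by
        rintro rfl
        have := H U U hle
        rw [disjoint_self, Finset.bot_eq_empty] at this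
        simp [this] at hU5
      rcases h.pair_cases hle hUC with h' | h'
      · omega
      · have := H U C hle
        rw [Finset.disjoint_iff_inter_eq_empty] at this
        simp [this] at h')
    simp only [weight_cons, Multiset.card_cons] at *
    omega
  · push Not at h5
    have := weight_le_mul_card (F := F) (c := 2) (by
      intro C hC
      have h1 := (h.circuits C hC).le_five
      have h2 := h5 C hC
      omega)
    omega

theorem zero_notMem_squares (h : ReducedGap A F R) (h0 : (0 : E4) ∉ A) : (0 : E4) ∉ R := by
  intro h'
  apply h0
  rw [← h.eq]
  exact Multiset.mem_add.2 (Or.inr (Multiset.mem_nsmul.2 ⟨by norm_num, h'⟩))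

theorem mem_cases (h : ReducedGap A F R) {x : E4} (hx : x ∈ A) :
    (∃ C ∈ F, x ∈ C) ∨ x ∈ R := by
  rw [← h.eq, Multiset.mem_add, mem_cover] at hx
  rcases hx with hx | hx
  · exact Or.inl hx
  · exact Or.inr (Multiset.mem_of_mem_nsmul hx)

/-- By `pair_cases` a third circuit would be a triple disjoint from both, which allows a drop, or
would meet $U$ in three elements and be disjoint from $V$. The latter is impossible: two disjoint
triples do not fit into $U$. A square outside $U\cup V$ allows a drop as well. -/
theorem support_of_five_four (h : ReducedGap A F R) (h0 : (0 : E4) ∉ A) (hF : U ::ₘ {V} ≤ F)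
    (hU5 : U.card = 5) (hV4 : V.card = 4) : (U ∩ V).card = 3 ∧ ∀ x ∈ A, x ∈ U ∨ x ∈ V := by
  have hUF := Multiset.mem_of_le hF (by simp : U ∈ U ::ₘ {V})
  have hVF := Multiset.mem_of_le hF (by simp : V ∈ U ::ₘ {V})
  have hU := h.circuits U hUF
  have hV := h.circuits V hVF
  have hUV : U ≠ V := by rintro rfl; omega
  have hi : (U ∩ V).card = 3 := by
    rcases h.pair_cases hF hUV with h' | h'
    · omega
    · exact h'.2
  refine ⟨hi, ?_⟩
  have hall : ∀ C ∈ F, C = U ∨ C = V := by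
    intro C hC
    by_contra hne
    push Not at hne
    have hCU := h.pair_cases (pair_le_of_mem_of_ne hC hUF hne.1) hne.1
    have hCV := h.pair_cases (pair_le_of_mem_of_ne hC hVF hne.2) hne.2
    have hC3 := (h.circuits C hC).three_le
    rcases hCU with ⟨d1, c1⟩ | ⟨c1, i1⟩
    · rcases hCV with ⟨d2, c2⟩ | ⟨c2, i2⟩
      · have hw := hasWeight_five_four_three hU hV (h.circuits C hC) hU5 hV4 (by omega) hi d1.symm
          d2.symm
        refine h.no_drop (cons_pair_le_of_mem hC hF hne.1 hne.2) (Multiset.zero_le R) (v := 4) ?_ ?_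
        · simp [weight]; omega
        · convert hw using 1
          simp [cover]; abel
      · omega
    · rcases hCV with ⟨d2, c2⟩ | ⟨c2, i2⟩
      · have hdis : Disjoint (C ∩ U) (U ∩ V) :=
          (d2.mono Finset.inter_subset_left Finset.inter_subset_right)
        have h1 := Finset.card_union_of_disjoint hdis
        have h2 : C ∩ U ∪ U ∩ V ⊆ U :=
          Finset.union_subset Finset.inter_subset_right Finset.inter_subset_left
        have h3 := Finset.card_le_card h2
        omega
      · omega
  intro x hx
  rcases h.mem_cases hx with ⟨C, hC, hxC⟩ | hxR
  · rcases hall C hC with rfl | rfl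
    · exact Or.inl hxC
    · exact Or.inr hxC
  · by_contra hne
    push Not at hne
    have hx0 : x ≠ 0 := fun e => h0 (e ▸ hx)
    refine h.no_drop hF (Multiset.singleton_le.2 hxR) (v := 3) ?_ ?_
    · simp [weight]; omega
    · have := hasWeight_five_four_square hU hV hU5 hV4 hi hx0 hne.1 hne.2
      convert this using 1
      simp [cover]

/-- Without four-element circuits, `pair_cases` leaves only triples disjoint from $U$ as further
circuits. These, and squares outside $U$, allow a drop. -/
theorem support_of_two_five (h : ReducedGap A F R) (h0 : (0 : E4) ∉ A) (hF : U ::ₘ {U} ≤ F)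
    (hU5 : U.card = 5) (h4 : ∀ V ∈ F, V.card ≠ 4) : ∀ x ∈ A, x ∈ U := by
  have hUF := Multiset.mem_of_le hF (by simp : U ∈ U ::ₘ {U})
  have hU := h.circuits U hUF
  have hall : ∀ C ∈ F, C = U := by
    intro C hC
    by_contra hne
    have hC3 := (h.circuits C hC).three_le
    have := h4 C hC
    rcases h.pair_cases (pair_le_of_mem_of_ne hC hUF hne) hne with ⟨d1, c1⟩ | ⟨c1, -⟩
    · have hw := hasWeight_two_five_three hU (h.circuits C hC) hU5 (by omega) d1.symm
      refine h.no_drop (cons_pair_le_of_mem hC hF hne hne) (Multiset.zero_le R) (v := 5) ?_ ?_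
      · simp [weight]; omega
      · convert hw using 1
        simp [cover, two_nsmul]; abel
    · omega
  intro x hx
  rcases h.mem_cases hx with ⟨C, hC, hxC⟩ | hxR
  · exact hall C hC ▸ hxC
  · by_contra hne
    have hx0 : x ≠ 0 := fun e => h0 (e ▸ hx)
    refine h.no_drop hF (Multiset.singleton_le.2 hxR) (v := 4) ?_ ?_
    · simp [weight]; omega
    · have := hasWeight_two_five_square hU hU5 hx0 hne
      convert this using 1
      simp [cover, two_nsmul]

/-- Without five-element circuits, any other circuit is disjoint from $V$ and has three or four
elements. In both cases, together with $V^2$ it allows a drop. -/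
theorem eq_replicate_of_two_four (h : ReducedGap A F R) (hF : V ::ₘ {V} ≤ F)
    (hV4 : V.card = 4) (h5 : ∀ U ∈ F, U.card ≠ 5) :
    F = Multiset.replicate F.card V ∧ 2 ≤ F.card := by
  have hVF := Multiset.mem_of_le hF (by simp : V ∈ V ::ₘ {V})
  have hV := h.circuits V hVF
  refine ⟨Multiset.eq_replicate_card.2 ?_, by simpa using Multiset.card_le_card hF⟩
  intro C hC
  by_contra hne
  have hC3 := (h.circuits C hC).three_le
  have := h5 C hC
  rcases h.pair_cases (pair_le_of_mem_of_ne hC hVF hne) hne with ⟨d1, c1⟩ | ⟨c1, -⟩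
  · have : C.card = 3 ∨ C.card = 4 := by omega
    rcases this with hc | hc
    · have hw := hasWeight_two_four_three hV (h.circuits C hC) hV4 hc d1.symm
      refine h.no_drop (cons_pair_le_of_mem hC hF hne hne) (Multiset.zero_le R) (v := 3) ?_ ?_
      · simp [weight]; omega
      · convert hw using 1
        simp [cover, two_nsmul]; abel
    · have hw := hasWeight_two_four_four hV (h.circuits C hC) hV4 hc d1.symm
      refine h.no_drop (cons_pair_le_of_mem hC hF hne hne) (Multiset.zero_le R) (v := 4) ?_ ?_
      · simp [weight]; omega
      · convert hw using 1
        simp [cover, two_nsmul]; abel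
  · omega

end ReducedGap

/-! ### Gaps force theta supports or squares -/

/-- The support of `A` consists of a circuit with five elements and the sum of two of them (or
of some of these elements). -/
def ThetaSupport (A : Multiset E4) : Prop :=
  ∃ φ : E4 ≃+ E4, ∀ x ∈ A, x ∈ coded φ [1, 2, 4, 8, 15, 3]

theorem thetaSupport_of_five_four {A : Multiset E4} (hU : IsCircuit U) (hV : IsCircuit V)
    (hU5 : U.card = 5) (hV4 : V.card = 4) (hUV : (U ∩ V).card = 3)
    (hA : ∀ x ∈ A, x ∈ U ∨ x ∈ V) : ThetaSupport A := by
  obtain ⟨φ, h1, h2⟩ := exists_frame_five_four hU hV hU5 hV4 hUV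
  refine ⟨φ, fun x hx => ?_⟩
  rcases hA x hx with h | h
  · rw [← Finset.mem_val, h1] at h
    simp only [coded_cons, coded_nil, Multiset.mem_cons, Multiset.notMem_zero] at h ⊢
    tauto
  · rw [← Finset.mem_val, h2] at h
    simp only [coded_cons, coded_nil, Multiset.mem_cons, Multiset.notMem_zero] at h ⊢
    tauto

theorem thetaSupport_of_five {A : Multiset E4} (hU : IsCircuit U) (hU5 : U.card = 5)
    (hA : ∀ x ∈ A, x ∈ U) : ThetaSupport A := by
  obtain ⟨φ, h1⟩ := hU.exists_frame_of_card_eq_five hU5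
  refine ⟨φ, fun x hx => ?_⟩
  have h := hA x hx
  rw [← Finset.mem_val, h1] at h
  simp only [coded_cons, coded_nil, Multiset.mem_cons, Multiset.notMem_zero] at h ⊢
  tauto

/-- Three elements of $V$, the element $g$ and the sum of these four form a five-element circuit
that shares three elements with $V$. This fifth element need not occur in $A$. -/
theorem thetaSupport_of_four {A : Multiset E4} (hV : IsCircuit V) (hV4 : V.card = 4) {g : E4}
    (hg : g ∉ V) (hg0 : g ≠ 0) (hg2 : ∀ y ∈ V, ∀ z ∈ V, g ≠ y + z)
    (hA : ∀ x ∈ A, x ∈ V ∨ x = g) : ThetaSupport A := by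
  obtain ⟨φ, h8, hφ⟩ := hV.exists_frame_of_card_eq_four hV4 hg hg0 hg2
  have hs : ([1, 2, 4, 8, 15].map dec).sum = 0 := by decide +kernel
  obtain ⟨U, hU, hUv, hU5⟩ := isCircuit_of_codes (l := [1, 2, 4, 8, 15]) (by decide) (by decide)
    hs (by decide) (by decide)
  have hs' : ([1, 2, 4, 7].map dec).sum = 0 := by decide +kernel
  obtain ⟨W, -, hWv, -⟩ := isCircuit_of_codes (l := [1, 2, 4, 7]) (by decide) (by decide)
    hs' (by decide) (by decide)
  have hVW : V = W.map φ.toEquiv.toEmbedding := by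
    apply Finset.val_injective
    rw [Finset.map_val, hWv, hφ]; rfl
  have hUe : U = ([1, 2, 4, 8, 15].map dec).toFinset := by
    ext x; rw [← Finset.mem_val, hUv, Multiset.mem_coe, List.mem_toFinset]
  have hWe : W = ([1, 2, 4, 7].map dec).toFinset := by
    ext x; rw [← Finset.mem_val, hWv, Multiset.mem_coe, List.mem_toFinset]
  refine thetaSupport_of_five_four (hU.map φ) hV (by rw [Finset.card_map]; exact hU5) hV4 ?_ ?_
  · rw [hVW, ← Finset.map_inter, Finset.card_map, hUe, hWe]
    decide +kernel
  · intro x hx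
    rcases hA x hx with h | rfl
    · exact Or.inr h
    · left
      rw [← h8, Finset.mem_map]
      exact ⟨dec 8, by rw [hUe]; simp, rfl⟩

/-- With $V$ coded by 1, 2, 4, 7 and $g$ by 8, all codes except 11, 13, 14 lie in $V\cup\{g\}$ or
are sums of two of its elements. For these three the search lowers the weight of $V^3g^2h^2$ from 6
to 4. -/
theorem search_three_four : ((List.range' 1 15).all fun n =>
    memb n [1, 2, 4, 7] || (Nat.beq n 8 ||
      (([1, 2, 4, 7, 8].any fun x => [1, 2, 4, 7, 8].any fun y =>
        Nat.blt x y && Nat.beq n (x ^^^ y)) ||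
      searchPattern [false] 4 ([1, 2, 4, 7] ++ ([1, 2, 4, 7] ++ [1, 2, 4, 7]) ++
        ([8, 8] ++ [n, n]))))) = true := by
  decide +kernel

/-- In the presence of a cube of a circuit with four elements, two further squares produce either
a circuit with three elements or a factorization of smaller weight. -/
theorem three_four_cases (hV : IsCircuit V) (hV4 : V.card = 4) {g h : E4} (hgV : g ∉ V)
    (hg0 : g ≠ 0) (hg2 : ∀ y ∈ V, ∀ z ∈ V, g ≠ y + z) (hhV : h ∉ V) (hh0 : h ≠ 0) (hgh : g ≠ h) :
    (∃ T, IsCircuit T ∧ T.card = 3 ∧ ∀ x ∈ T, x ∈ V ∨ x = g ∨ x = h) ∨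
      HasWeight (V.val + 2 • V.val + 2 • {g, h}) 4 := by
  obtain ⟨φ, h8, hφ⟩ := hV.exists_frame_of_card_eq_four hV4 hgV hg0 hg2
  obtain ⟨n, hn, rfl⟩ := exists_code_frame φ hh0
  have hmem : ∀ k ∈ [1, 2, 4, 7], φ (dec k) ∈ V := by
    intro k hk
    rw [← Finset.mem_val, hφ]; exact mem_coded hk
  have key := List.all_eq_true.1 search_three_four n hn
  simp only [Bool.or_eq_true, Nat.beq_eq] at key
  rcases key with h | h | h | h
  · exact absurd (hmem n (memb_iff.1 h)) hhV
  · exact absurd (by rw [h, h8]) hgh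
  · left
    simp only [List.any_eq_true, Bool.and_eq_true, Nat.blt_eq, Nat.beq_eq] at h
    obtain ⟨x, hx, y, hy, hxy, rfl⟩ := h
    have hr : ∀ k ∈ [1, 2, 4, 7, 8], k ∈ List.range' 1 15 := by decide
    have hmem' : ∀ k ∈ [1, 2, 4, 7, 8], φ (dec k) ∈ V ∨ φ (dec k) = g := by
      intro k hk
      have : k ∈ [1, 2, 4, 7] ∨ k = 8 := by
        simp only [List.mem_cons, List.not_mem_nil, or_false] at hk ⊢; omega
      rcases this with h | rfl
      · exact Or.inl (hmem k h)
      · exact Or.inr h8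
    have hz : ∀ k ∈ [1, 2, 4, 7, 8], φ (dec k) ≠ 0 := fun k hk => by
      rw [ne_eq, map_eq_zero_iff φ φ.injective]; exact dec_ne_zero (hr k hk)
    obtain ⟨hT, hT3⟩ := isCircuit_triple (hz x hx) (hz y hy)
      (fun e => by have := dec_injOn (hr x hx) (hr y hy) (φ.injective e); omega)
    refine ⟨_, hT, hT3, ?_⟩
    intro t ht
    simp only [Finset.mem_insert, Finset.mem_singleton] at ht
    rcases ht with rfl | rfl | rfl
    · right; right; rw [dec_xor, map_add]
    · rcases hmem' x hx with h | h
      · exact Or.inl h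
      · exact Or.inr (Or.inl h)
    · rcases hmem' y hy with h | h
      · exact Or.inl h
      · exact Or.inr (Or.inl h)
  · right
    have e : V.val + 2 • V.val + 2 • {g, φ (dec n)} =
        coded φ ([1, 2, 4, 7] ++ ([1, 2, 4, 7] ++ [1, 2, 4, 7]) ++ ([8, 8] ++ [n, n])) := by
      rw [coded_append, coded_append, ← two_nsmul_eq_coded hφ, ← hφ, coded_append, coded_pair,
        coded_pair, h8, ← smul_add]
      rfl
    have hs : (V.val + 2 • V.val + 2 • {g, φ (dec n)}).sum = 0 := by
      rw [Multiset.sum_add, Multiset.sum_add, E4.sum_two_nsmul, E4.sum_two_nsmul,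
        circuit_val_sum hV, add_zero, add_zero]
    rw [e] at hs ⊢
    exact hasWeight_coded [false] 4 (by norm_num) (by norm_num)
      (forall_mem_append (by decide) (forall_mem_append (by decide) (forall_mem_pair hn))) hs h

namespace ReducedGap

variable {A : Multiset E4} {F : Multiset (Finset E4)} {R : Multiset E4}

/-- The product of $V^2$ and all the squares is the square of $VR$. A triple $T$ inside $VR$ turns
the weight 4 of $V^2$ into the weight 2 of $T^2$. -/
theorem no_three (h : ReducedGap A F R) (hF : V ::ₘ {V} ≤ F) (hV4 : V.card = 4)
    (hT : IsCircuit T) (hT3 : T.card = 3) (hTA : ∀ x ∈ T, x ∈ V ∨ x ∈ R) : False := by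
  refine h.no_drop hF le_rfl (v := 2) (by simp [weight]; omega) ?_
  have hle : T.val ≤ V.val + R := by
    rw [Multiset.le_iff_subset T.nodup]
    intro x hx
    exact Multiset.mem_add.2 (hTA x hx)
  obtain ⟨Q, hQ⟩ := Multiset.le_iff_exists_add.1 hle
  have e : cover (V ::ₘ {V}) + 2 • R = 2 • T.val + 2 • Q := by
    rw [← smul_add, ← hQ, smul_add]
    simp [cover, two_nsmul]
  rw [e]
  exact (hasWeight_two_three hT hT3).add_squares Q

/-- Only copies of $V$ occur. With two copies, $A$ is a square of weight 4, and circuits of odd size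
are excluded because they lead to triples. With at least three copies, `three_four_cases` permits at
most one element outside $V$, and it is not in the span of $V$. -/
theorem gap_cases_of_two_four (h : ReducedGap A F R) (h0 : (0 : E4) ∉ A) (hF : V ::ₘ {V} ≤ F)
    (hV4 : V.card = 4) (h5 : ∀ U ∈ F, U.card ≠ 5) :
    ThetaSupport A ∨ (weight F = 4 ∧ (∃ Q, A = 2 • Q) ∧
      ∀ C, IsCircuit C → (∀ x ∈ C, x ∈ A) → C.card = 4) := by
  have hVF := Multiset.mem_of_le hF (by simp : V ∈ V ::ₘ {V})
  have hV := h.circuits V hVF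
  obtain ⟨hrep, hcard⟩ := h.eq_replicate_of_two_four hF hV4 h5
  have hA : ∀ x ∈ A, x ∈ V ∨ x ∈ R := by
    intro x hx
    rcases h.mem_cases hx with ⟨C, hC, hxC⟩ | hxR
    · rw [hrep] at hC
      rw [Multiset.eq_of_mem_replicate hC] at hxC
      exact Or.inl hxC
    · exact Or.inr hxR
  have hR0 := h.zero_notMem_squares h0
  have hVA : ∀ x ∈ V, x ∈ A := by
    intro x hx
    rw [← h.eq]
    exact Multiset.mem_add.2 (Or.inl (mem_cover.2 ⟨V, hVF, hx⟩))
  by_cases hb : F.card = 2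
  · right
    rw [hb] at hrep
    refine ⟨by rw [hrep, weight_replicate]; omega, ⟨V.val + R, ?_⟩, ?_⟩
    · rw [← h.eq, hrep, cover_replicate, smul_add]
    · intro C hC hCA
      have h3 := hC.three_le
      have h5' := hC.le_five
      by_contra hne
      have : C.card = 3 ∨ C.card = 5 := by omega
      rcases this with hc | hc
      · exact h.no_three hF hV4 hC hc fun x hx => hA x (hCA x hx)
      -- $V\subseteq C$ would leave a single element of sum zero. An element of $V$ outside $C$ is a
      -- sum of two elements of $C$, which gives a forbidden triple.
      · obtain ⟨g, hgV, hgC⟩ : ∃ g ∈ V, g ∉ C := by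
          by_contra hsub
          push Not at hsub
          have hs : ∑ x ∈ C \ V, x = 0 := by
            rw [Finset.sum_sdiff_eq_sub hsub, hC.sum_eq, hV.sum_eq, sub_zero]
          have h1 := Finset.card_sdiff_add_card_eq_card hsub
          have := three_le_card_of_sum_eq_zero
            (fun h => hC.zero_notMem (Finset.mem_sdiff.1 h).1) hs
            (by rw [← Finset.card_pos]; omega)
          omega
        obtain ⟨x, hx, y, hy, hxy, rfl⟩ := exists_add_of_mem_notMem hC hc
          (fun e => hV.zero_notMem (e ▸ hgV)) hgC
        obtain ⟨hT, hT3⟩ := isCircuit_triple (fun e => hC.zero_notMem (e ▸ hx))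
          (fun e => hC.zero_notMem (e ▸ hy)) hxy
        refine h.no_three hF hV4 hT hT3 ?_
        intro t ht
        simp only [Finset.mem_insert, Finset.mem_singleton] at ht
        rcases ht with rfl | rfl | rfl
        · exact Or.inl hgV
        · exact hA _ (hCA _ hx)
        · exact hA _ (hCA _ hy)
  · left
    have hspan : ∀ g ∈ R, g ∉ V → ∀ y ∈ V, ∀ z ∈ V, g ≠ y + z := by
      rintro g hg hgV y hy z hz rfl
      obtain ⟨hT, hT3⟩ := isCircuit_triple (x := y) (y := z) (fun e => hV.zero_notMem (e ▸ hy))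
        (fun e => hV.zero_notMem (e ▸ hz)) (fun e => hR0 (by
          rw [e, E4.add_self] at hg; exact hg))
      refine h.no_three hF hV4 hT hT3 ?_
      intro t ht
      simp only [Finset.mem_insert, Finset.mem_singleton] at ht
      rcases ht with rfl | rfl | rfl
      · exact Or.inr hg
      · exact Or.inl hy
      · exact Or.inl hz
    by_cases hQ : ∃ g ∈ R, g ∉ V
    · obtain ⟨g, hg, hgV⟩ := hQ
      have hg0 : g ≠ 0 := fun e => hR0 (e ▸ hg)
      refine thetaSupport_of_four hV hV4 hgV hg0 (hspan g hg hgV) ?_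
      intro x hx
      rcases hA x hx with hx | hx
      · exact Or.inl hx
      by_contra hne
      push Not at hne
      rcases three_four_cases hV hV4 hgV hg0 (hspan g hg hgV) hne.1 (fun e => hR0 (e ▸ hx))
        (Ne.symm hne.2) with ⟨T, hT, hT3, hTs⟩ | hw
      · refine h.no_three hF hV4 hT hT3 fun t ht => ?_
        rcases hTs t ht with h' | rfl | rfl
        · exact Or.inl h'
        · exact Or.inr hg
        · exact Or.inr hx
      · have h3 : Multiset.replicate 3 V ≤ F := by
          rw [hrep]
          exact Multiset.replicate_le_replicate V |>.2 (by omega)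
        refine h.no_drop h3 (pair_le_of_mem_of_ne hg hx (Ne.symm hne.2)) (v := 4) ?_ ?_
        · rw [weight_replicate]; omega
        · convert hw using 1
          rw [cover_replicate, show (3 : ℕ) = 1 + 2 from rfl, add_smul, one_smul]
          rfl
    · push Not at hQ
      obtain ⟨x, hx, hx0, hx2⟩ := hV.exists_notMem_span hV4
      refine thetaSupport_of_four hV hV4 hx hx0 hx2 fun t ht => ?_
      rcases hA t ht with h' | h'
      · exact Or.inl h'
      · exact Or.inl (hQ t h')

end ReducedGap

/-- Gaps in the set of weights occur only over very special supports. -/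
theorem gap_cases {A : Multiset E4} {w : ℕ} (h0 : (0 : E4) ∉ A) (hw : HasWeight A w)
    (hgap : ¬ HasWeight A (w - 2)) (hlt : ∃ v < w, HasWeight A v) :
    ThetaSupport A ∨ (w = 4 ∧ (∃ Q, A = 2 • Q) ∧
      ∀ C, IsCircuit C → (∀ x ∈ C, x ∈ A) → C.card = 4) := by
  obtain ⟨F, R, h, rfl⟩ := exists_reducedGap hw hgap
  have five_four : ∀ U V, U ::ₘ {V} ≤ F → U.card = 5 → V.card = 4 → ThetaSupport A := by
    intro U V hF hU5 hV4
    obtain ⟨h1, h2⟩ := h.support_of_five_four h0 hF hU5 hV4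
    exact thetaSupport_of_five_four (h.circuits U (Multiset.mem_of_le hF (by simp)))
      (h.circuits V (Multiset.mem_of_le hF (by simp))) hU5 hV4 h1 h2
  obtain ⟨C, D, hCD, hd⟩ := h.exists_not_disjoint hlt
  have hCF := Multiset.mem_of_le hCD (by simp : C ∈ C ::ₘ {D})
  have hDF := Multiset.mem_of_le hCD (by simp : D ∈ C ::ₘ {D})
  have hC3 := (h.circuits C hCF).three_le
  have hC5 := (h.circuits C hCF).le_five
  have hD5 := (h.circuits D hDF).le_five
  by_cases hne : C = D
  · subst hne
    have h3 := h.card_ne_three hCD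
    have : C.card = 4 ∨ C.card = 5 := by omega
    rcases this with hc | hc
    · by_cases h5 : ∃ U ∈ F, U.card = 5
      · obtain ⟨U, hU, hU5⟩ := h5
        left
        exact five_four U C (pair_le_of_mem_of_ne hU hCF (by rintro rfl; omega)) hU5 hc
      · push Not at h5
        exact h.gap_cases_of_two_four h0 hCD hc h5
    · left
      by_cases h4 : ∃ V ∈ F, V.card = 4
      · obtain ⟨V, hV, hV4⟩ := h4
        exact five_four C V (pair_le_of_mem_of_ne hCF hV (by rintro rfl; omega)) hc hV4
      · push Not at h4
        exact thetaSupport_of_five (h.circuits C hCF) hc (h.support_of_two_five h0 hCD hc h4)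
  · left
    rcases h.pair_cases hCD hne with ⟨h1, -⟩ | ⟨h1, -⟩
    · exact absurd h1 hd
    · have : (C.card = 5 ∧ D.card = 4) ∨ (D.card = 5 ∧ C.card = 4) := by omega
      rcases this with ⟨h5, h4⟩ | ⟨h5, h4⟩
      · exact five_four C D hCD h5 h4
      · exact five_four D C (pair_le_of_mem_of_ne hDF hCF (Ne.symm hne)) h5 h4

/-! ### Existence of weights and the role of the element zero -/

theorem exists_hasWeight_finset (X : Finset E4) (h0 : (0 : E4) ∉ X) (hs : ∑ x ∈ X, x = 0) :
    ∃ w, HasWeight X.val w := by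
  induction hn : X.card using Nat.strong_induction_on generalizing X with
  | _ n ih =>
    subst hn
    by_cases hX : X.Nonempty
    · have h3 := three_le_card_of_sum_eq_zero h0 hs hX
      by_cases h5 : X.card ≤ 5
      · exact ⟨_, IsCircuit.hasWeight ⟨h0, hs, h3, h5⟩⟩
      · obtain ⟨Y, hY, hs1, hs2, hc1, hc2⟩ := exists_zero_sum_split h0 hs (by omega)
        have hc := Finset.card_sdiff_add_card_eq_card hY
        obtain ⟨v, hv⟩ := ih Y.card (by omega) Y (fun h => h0 (hY h)) hs1 rfl
        obtain ⟨w, hw⟩ := ih (X \ Y).card (by omega) (X \ Y)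
          (fun h => h0 (Finset.mem_sdiff.1 h).1) hs2 rfl
        refine ⟨v + w, ?_⟩
        have e : X.val = Y.val + (X \ Y).val := by
          rw [Finset.sdiff_val, add_tsub_cancel_of_le (Finset.val_le_iff.2 hY)]
        rw [e]
        exact hv.add hw
    · rw [Finset.not_nonempty_iff_eq_empty] at hX
      subst hX
      exact ⟨0, by simpa using HasWeight.squares 0⟩

theorem exists_hasWeight {A : Multiset E4} (h0 : (0 : E4) ∉ A) (hs : A.sum = 0) :
    ∃ w, HasWeight A w := by
  let X : Finset E4 := A.toFinset.filter fun x => A.count x % 2 = 1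
  obtain ⟨R, hR⟩ := (exists_add_two_nsmul_iff (A := A) (B := X.val)).2 (by
    intro a
    by_cases ha : a ∈ X
    · rw [Multiset.count_eq_one_of_mem X.nodup ha]
      have := (Finset.mem_filter.1 ha).2
      omega
    · rw [Multiset.count_eq_zero_of_notMem ha]
      by_cases haA : a ∈ A
      · have : ¬ A.count a % 2 = 1 := fun h =>
          ha (Finset.mem_filter.2 ⟨Multiset.mem_toFinset.2 haA, h⟩)
        omega
      · simp [Multiset.count_eq_zero_of_notMem haA])
  have hXs : ∑ x ∈ X, x = 0 := by
    have := congrArg Multiset.sum hR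
    rw [Multiset.sum_add, E4.sum_two_nsmul, add_zero, hs, Finset.sum_val] at this
    exact this
  obtain ⟨w, hw⟩ := exists_hasWeight_finset X
    (fun h => h0 (Multiset.mem_toFinset.1 (Finset.mem_filter.1 h).1)) hXs
  exact ⟨w, hR ▸ hw.add_squares R⟩

theorem mem_lengthSystem_iff {L : Set ℕ} :
    L ∈ lengthSystem (zeroSumSequences E4) ↔ ∃ (B : Multiset E4) (y : ℕ), (0 : E4) ∉ B ∧
      B.sum = 0 ∧ L = lengthSet (HasWeight B) (B.card + 2 * y) := by
  constructor
  · rintro ⟨A, rfl⟩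
    refine ⟨A.1.filter (· ≠ 0), A.1.count 0, by simp, ?_, lengths_eq A⟩
    have hA : A.1.sum = 0 := A.2
    have := congrArg Multiset.sum (Multiset.filter_add_not (fun x : E4 => x ≠ 0) A.1)
    rw [Multiset.sum_add, hA, Multiset.sum_eq_zero (s := Multiset.filter (fun x => ¬ x ≠ 0) A.1)
      (by simp), add_zero] at this
    exact this
  · rintro ⟨B, y, h0, hs, rfl⟩
    let A : zeroSumSequences E4 := ⟨B + Multiset.replicate y 0, by
      change Multiset.sum _ = 0
      rw [Multiset.sum_add, hs, Multiset.sum_replicate, smul_zero, add_zero]⟩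
    obtain ⟨h1, h2⟩ := filter_eq_of_eq_add_replicate (A := A.1) h0 rfl
    refine ⟨A, ?_⟩
    rw [lengths_eq, h1, h2]

/-! ### The theta configuration -/

/-- The circuit with five elements in the standard theta configuration. -/
def thetaFive : Finset E4 := {dec 1, dec 2, dec 4, dec 8, dec 15}
/-- The circuit with four elements in the standard theta configuration. -/
def thetaFour : Finset E4 := {dec 3, dec 4, dec 8, dec 15}
/-- The circuit with three elements in the standard theta configuration. -/
def thetaThree : Finset E4 := {dec 3, dec 1, dec 2}
/-- The support of the standard theta configuration. -/
def thetaSet : Finset E4 := {dec 1, dec 2, dec 4, dec 8, dec 15, dec 3}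

theorem isCircuit_thetaFive : IsCircuit thetaFive :=
  ⟨by decide +kernel, by decide +kernel, by decide +kernel, by decide +kernel⟩
theorem isCircuit_thetaFour : IsCircuit thetaFour :=
  ⟨by decide +kernel, by decide +kernel, by decide +kernel, by decide +kernel⟩
theorem isCircuit_thetaThree : IsCircuit thetaThree :=
  ⟨by decide +kernel, by decide +kernel, by decide +kernel, by decide +kernel⟩

/-- The six elements behave like the edges of a theta graph with the paths $\{1,2\}$, $\{4,8,15\}$
and $\{3\}$. Each circuit is the union of two of the three paths. -/
theorem circuitCodes_theta : ([3, 4, 5].all fun n => (circuitCodes n).all fun l =>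
    !(l.all fun k => memb k [1, 2, 4, 8, 15, 3]) ||
      (l == [1, 2, 4, 8, 15] || (l == [3, 4, 8, 15] || l == [1, 2, 3]))) = true := by
  decide +kernel

theorem eq_of_subset_thetaSet {C : Finset E4} (hC : IsCircuit C) (h : C ⊆ thetaSet) :
    C = thetaFive ∨ C = thetaFour ∨ C = thetaThree := by
  obtain ⟨l, hl, hr, hv⟩ := hC.exists_codes (AddEquiv.refl E4)
  have hv' : C.val = (l.map dec : List E4) := by rw [hv]; simp [coded]
  have hCl : C = (l.map dec).toFinset := by
    ext x; rw [← Finset.mem_val, hv', Multiset.mem_coe, List.mem_toFinset]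
  have hcard : C.card ∈ [3, 4, 5] := by
    have := hC.three_le
    have := hC.le_five
    simp only [List.mem_cons, List.not_mem_nil, or_false]; omega
  have key := List.all_eq_true.1 (List.all_eq_true.1 circuitCodes_theta _ hcard) l hl
  have hall : (l.all fun k => memb k [1, 2, 4, 8, 15, 3]) = true := by
    rw [List.all_eq_true]
    intro k hk
    rw [memb_iff]
    have hkC : dec k ∈ thetaSet := h (by rw [← Finset.mem_val, hv]; exact mem_coded hk)
    simp only [thetaSet, Finset.mem_insert, Finset.mem_singleton] at hkC
    rcases hkC with e | e | e | e | e | e <;>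
      rw [dec_injOn (hr k hk) (by decide) e] <;> decide
  rw [hall, Bool.not_true, Bool.false_or] at key
  simp only [Bool.or_eq_true, beq_iff_eq] at key
  rcases key with rfl | rfl | rfl
  · left; rw [hCl]; simp [thetaFive]
  · right; left; rw [hCl]; simp [thetaFour]
  · right; right; rw [hCl]; ext x; simp [thetaThree]; tauto

theorem cover_of_subset_thetaSet {F : Multiset (Finset E4)} (hF : ∀ C ∈ F, IsCircuit C)
    (hsub : ∀ C ∈ F, C ⊆ thetaSet) : ∃ u t s : ℕ, weight F = 3 * u + t + 2 * s ∧
      cover F = u • thetaFive.val + t • thetaThree.val + s • thetaFour.val := by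
  have c5 : thetaFive.card = 5 := by decide +kernel
  have c4 : thetaFour.card = 4 := by decide +kernel
  have c3 : thetaThree.card = 3 := by decide +kernel
  induction F using Multiset.induction with
  | empty => exact ⟨0, 0, 0, by simp, by simp⟩
  | cons C F ih =>
    obtain ⟨u, t, s, hw, hc⟩ := ih (fun D hD => hF D (Multiset.mem_cons_of_mem hD))
      (fun D hD => hsub D (Multiset.mem_cons_of_mem hD))
    have hC := Multiset.mem_cons_self C F
    rw [weight_cons, cover_cons, hw, hc]
    rcases eq_of_subset_thetaSet (hF C hC) (hsub C hC) with rfl | rfl | rfl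
    · exact ⟨u + 1, t, s, by omega, by rw [add_smul, one_smul]; abel⟩
    · exact ⟨u, t, s + 1, by omega, by rw [add_smul _ _ thetaFour.val, one_smul]; abel⟩
    · exact ⟨u, t + 1, s, by omega, by rw [add_smul _ _ thetaThree.val, one_smul]; abel⟩

theorem count_theta (u t s : ℕ) (x : E4) :
    (u • thetaFive.val + t • thetaThree.val + s • thetaFour.val).count x =
      u * (if x ∈ thetaFive then 1 else 0) + t * (if x ∈ thetaThree then 1 else 0) +
      s * (if x ∈ thetaFour then 1 else 0) := by
  have hc : ∀ X : Finset E4, X.val.count x = if x ∈ X then 1 else 0 := by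
    intro X
    split_ifs with h
    · exact Multiset.count_eq_one_of_mem X.nodup h
    · exact Multiset.count_eq_zero_of_notMem h
  simp only [Multiset.count_add, Multiset.count_nsmul, hc]

theorem count_theta_cases (u t s : ℕ) :
    let M := u • thetaFive.val + t • thetaThree.val + s • thetaFour.val
    M.count (dec 1) = u + t ∧ M.count (dec 2) = u + t ∧ M.count (dec 4) = u + s ∧
    M.count (dec 8) = u + s ∧ M.count (dec 15) = u + s ∧ M.count (dec 3) = t + s := by
  have h1 : dec 1 ∈ thetaFive ∧ dec 1 ∈ thetaThree ∧ dec 1 ∉ thetaFour := by decide +kernel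
  have h2 : dec 2 ∈ thetaFive ∧ dec 2 ∈ thetaThree ∧ dec 2 ∉ thetaFour := by decide +kernel
  have h3 : dec 3 ∉ thetaFive ∧ dec 3 ∈ thetaThree ∧ dec 3 ∈ thetaFour := by decide +kernel
  have h4 : dec 4 ∈ thetaFive ∧ dec 4 ∉ thetaThree ∧ dec 4 ∈ thetaFour := by decide +kernel
  have h8 : dec 8 ∈ thetaFive ∧ dec 8 ∉ thetaThree ∧ dec 8 ∈ thetaFour := by decide +kernel
  have h15 : dec 15 ∈ thetaFive ∧ dec 15 ∉ thetaThree ∧ dec 15 ∈ thetaFour := by decide +kernel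
  simp only [count_theta, h1, h2, h3, h4, h8, h15, if_true, if_false, mul_one, mul_zero,
    add_zero, zero_add, and_self]

theorem forall_mem_thetaSet {P : E4 → Prop} : (∀ x ∈ thetaSet, P x) ↔
    P (dec 1) ∧ P (dec 2) ∧ P (dec 4) ∧ P (dec 8) ∧ P (dec 15) ∧ P (dec 3) := by
  simp [thetaSet]

theorem hasWeight_theta_iff {B : Multiset E4} (hB : ∀ x ∈ B, x ∈ thetaSet) {w : ℕ} :
    HasWeight B w ↔ ∃ u t s : ℕ, w = 3 * u + t + 2 * s ∧
      (u + t ≤ B.count (dec 1) ∧ (u + t) % 2 = B.count (dec 1) % 2) ∧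
      (u + t ≤ B.count (dec 2) ∧ (u + t) % 2 = B.count (dec 2) % 2) ∧
      (u + s ≤ B.count (dec 4) ∧ (u + s) % 2 = B.count (dec 4) % 2) ∧
      (u + s ≤ B.count (dec 8) ∧ (u + s) % 2 = B.count (dec 8) % 2) ∧
      (u + s ≤ B.count (dec 15) ∧ (u + s) % 2 = B.count (dec 15) % 2) ∧
      (t + s ≤ B.count (dec 3) ∧ (t + s) % 2 = B.count (dec 3) % 2) := by
  constructor
  · rintro ⟨F, R, hF, hA, rfl⟩
    obtain ⟨u, t, s, hw, hc⟩ := cover_of_subset_thetaSet hF (by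
      intro C hC x hx
      apply hB
      rw [← hA]
      exact Multiset.mem_add.2 (Or.inl (mem_cover.2 ⟨C, hC, hx⟩)))
    refine ⟨u, t, s, hw, ?_⟩
    have h := (exists_add_two_nsmul_iff (A := B) (B := cover F)).1 ⟨R, hA⟩
    rw [hc] at h
    obtain ⟨h1, h2, h4, h8, h15, h3⟩ := count_theta_cases u t s
    refine ⟨?_, ?_, ?_, ?_, ?_, ?_⟩
    · rw [← h1]; exact h _
    · rw [← h2]; exact h _
    · rw [← h4]; exact h _
    · rw [← h8]; exact h _
    · rw [← h15]; exact h _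
    · rw [← h3]; exact h _
  · rintro ⟨u, t, s, rfl, H⟩
    have hc : ∀ x, (u • thetaFive.val + t • thetaThree.val + s • thetaFour.val).count x ≤
        B.count x ∧ (u • thetaFive.val + t • thetaThree.val + s • thetaFour.val).count x % 2 =
        B.count x % 2 := by
      intro x
      by_cases hx : x ∈ thetaSet
      · revert x
        rw [forall_mem_thetaSet]
        obtain ⟨h1, h2, h4, h8, h15, h3⟩ := count_theta_cases u t s
        rw [h1, h2, h4, h8, h15, h3]
        exact H
      · rw [Multiset.count_eq_zero_of_notMem (fun h => hx (hB x h)), count_theta]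
        have s5 : thetaFive ⊆ thetaSet := by decide +kernel
        have s4 : thetaFour ⊆ thetaSet := by decide +kernel
        have s3 : thetaThree ⊆ thetaSet := by decide +kernel
        simp [show x ∉ thetaFive from fun h => hx (s5 h),
          show x ∉ thetaFour from fun h => hx (s4 h),
          show x ∉ thetaThree from fun h => hx (s3 h)]
    obtain ⟨R, hR⟩ := exists_add_two_nsmul_iff.2 hc
    have c5 : thetaFive.card = 5 := by decide +kernel
    have c4 : thetaFour.card = 4 := by decide +kernel
    have c3 : thetaThree.card = 3 := by decide +kernel
    refine ⟨Multiset.replicate u thetaFive + Multiset.replicate t thetaThree +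
      Multiset.replicate s thetaFour, R, ?_, ?_, ?_⟩
    · intro C hC
      simp only [Multiset.mem_add] at hC
      rcases hC with (h | h) | h
      · rw [Multiset.eq_of_mem_replicate h]; exact isCircuit_thetaFive
      · rw [Multiset.eq_of_mem_replicate h]; exact isCircuit_thetaThree
      · rw [Multiset.eq_of_mem_replicate h]; exact isCircuit_thetaFour
    · simpa using hR
    · simp [c5, c4, c3]; ring

/-- The weights of the theta configuration with `x` parallel copies of the path with two elements,
`y` of the path with three elements and `z` of the single element. -/
def ThetaWeight (x y z w : ℕ) : Prop :=
  ∃ p q, p ≤ x ∧ p % 2 = x % 2 ∧ q ≤ y ∧ q % 2 = y % 2 ∧ p ≤ q + z ∧ q ≤ p + z ∧ w = p + 2 * q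

/-- Here $u,t,s$ count the circuits with five, three and four elements, and $p=u+t$, $q=u+s$ count
those through the paths with two and three elements. For given $p,q$ the single element is used
least often, namely $|p-q|$ times, when $u=\min(p,q)$. -/
theorem thetaWeight_iff {x y z w : ℕ} (hxyz : (x + y + z) % 2 = 0) :
    ThetaWeight x y z w ↔ ∃ u t s, w = 3 * u + t + 2 * s ∧ (u + t ≤ x ∧ (u + t) % 2 = x % 2) ∧
      (u + s ≤ y ∧ (u + s) % 2 = y % 2) ∧ (t + s ≤ z ∧ (t + s) % 2 = z % 2) := by
  constructor
  · rintro ⟨p, q, hp, hp', hq, hq', h1, h2, rfl⟩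
    rcases le_total p q with h | h
    · exact ⟨p, 0, q - p, by omega, ⟨by omega, by omega⟩, ⟨by omega, by omega⟩, by omega, by omega⟩
    · exact ⟨q, p - q, 0, by omega, ⟨by omega, by omega⟩, ⟨by omega, by omega⟩, by omega, by omega⟩
  · rintro ⟨u, t, s, rfl, ⟨h1, h1'⟩, ⟨h2, h2'⟩, h3, -⟩
    exact ⟨u + t, u + s, h1, h1', h2, h2', by omega, by omega, by ring⟩

theorem le_mod_min_iff {a b n : ℕ} (h : a % 2 = b % 2) :
    (n ≤ min a b ∧ n % 2 = min a b % 2) ↔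
      (n ≤ a ∧ n % 2 = a % 2) ∧ (n ≤ b ∧ n % 2 = b % 2) := by
  rcases le_total a b with hab | hab
  · rw [min_eq_left hab]; omega
  · rw [min_eq_right hab]; omega

theorem min_mod_two {a b : ℕ} (h : a % 2 = b % 2) : min a b % 2 = a % 2 := by
  rcases le_total a b with hab | hab
  · rw [min_eq_left hab]
  · rw [min_eq_right hab, h]

theorem card_eq_sum_count {B : Multiset E4} (hB : ∀ x ∈ B, x ∈ thetaSet) :
    B.card = B.count (dec 1) + B.count (dec 2) + B.count (dec 4) + B.count (dec 8) +
      B.count (dec 15) + B.count (dec 3) := by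
  have h1 := Multiset.sum_count_eq_card (s := thetaSet) (m := B) hB
  rw [← h1, thetaSet]
  have hd : [dec 1, dec 2, dec 4, dec 8, dec 15, dec 3].Nodup := by decide +kernel
  simp only [List.nodup_cons, List.mem_cons, List.not_mem_nil, or_false, not_or] at hd
  obtain ⟨a1, a2, a3, a4, a5, -⟩ := hd
  rw [Finset.sum_insert (by simpa using a1), Finset.sum_insert (by simpa using a2),
    Finset.sum_insert (by simpa using a3), Finset.sum_insert (by simpa using a4),
    Finset.sum_pair a5]
  ring

/-- Every circuit uses a path entirely or not at all. Multiplicities along a path therefore agree in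
parity, and only the smallest one restricts. -/
theorem thetaSet_hasWeight {B : Multiset E4} (hB : ∀ x ∈ B, x ∈ thetaSet) (hs : B.sum = 0) :
    ∃ x y z : ℕ, (x + y + z) % 2 = 0 ∧ 2 * x + 3 * y + z ≤ B.card ∧
      ∀ w, HasWeight B w ↔ ThetaWeight x y z w := by
  have h0 : (0 : E4) ∉ B := fun h => absurd (hB 0 h) (by decide +kernel)
  obtain ⟨v, hv⟩ := exists_hasWeight h0 hs
  rw [hasWeight_theta_iff hB] at hv
  obtain ⟨u, t, s, -, ⟨-, p1⟩, ⟨-, p2⟩, ⟨-, p4⟩, ⟨-, p8⟩, ⟨-, p15⟩, ⟨-, p3⟩⟩ := hv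
  have p12 := p1.symm.trans p2
  have p815 := p8.symm.trans p15
  have p48 : B.count (dec 4) % 2 = min (B.count (dec 8)) (B.count (dec 15)) % 2 := by
    rw [min_mod_two p815, ← p4, ← p8]
  have hpar : (min (B.count (dec 1)) (B.count (dec 2)) + min (B.count (dec 4))
      (min (B.count (dec 8)) (B.count (dec 15))) + B.count (dec 3)) % 2 = 0 := by
    rw [Nat.add_mod, Nat.add_mod (min _ _), min_mod_two p12, min_mod_two p48, ← p1, ← p4, ← p3]
    omega
  refine ⟨min (B.count (dec 1)) (B.count (dec 2)),
    min (B.count (dec 4)) (min (B.count (dec 8)) (B.count (dec 15))), B.count (dec 3), ?_, ?_, ?_⟩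
  · exact hpar
  · rw [card_eq_sum_count hB]
    have h1 := min_le_left (B.count (dec 1)) (B.count (dec 2))
    have h2 := min_le_right (B.count (dec 1)) (B.count (dec 2))
    have h3 := min_le_left (B.count (dec 4)) (min (B.count (dec 8)) (B.count (dec 15)))
    have h4 := min_le_right (B.count (dec 4)) (min (B.count (dec 8)) (B.count (dec 15)))
    have h5 := min_le_left (B.count (dec 8)) (B.count (dec 15))
    have h6 := min_le_right (B.count (dec 8)) (B.count (dec 15))
    linarith
  · intro w
    rw [hasWeight_theta_iff hB, thetaWeight_iff hpar]
    simp only [le_mod_min_iff p12, le_mod_min_iff p48, le_mod_min_iff p815, and_assoc]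

theorem ThetaSupport.exists_weight {A : Multiset E4} (hA : ThetaSupport A) (hs : A.sum = 0) :
    ∃ x y z : ℕ, (x + y + z) % 2 = 0 ∧ 2 * x + 3 * y + z ≤ A.card ∧
      ∀ w, HasWeight A w ↔ ThetaWeight x y z w := by
  obtain ⟨φ, hφ⟩ := hA
  obtain ⟨x, y, z, h1, h2, h3⟩ := thetaSet_hasWeight (B := A.map φ.symm) (by
    intro b hb
    obtain ⟨a, ha, rfl⟩ := Multiset.mem_map.1 hb
    have := hφ a ha
    simp only [coded_cons, coded_nil, Multiset.mem_cons, Multiset.notMem_zero, or_false] at this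
    rcases this with rfl | rfl | rfl | rfl | rfl | rfl <;> simp [thetaSet])
    (by rw [← map_multiset_sum, hs, map_zero])
  refine ⟨x, y, z, h1, by simpa using h2, fun w => ?_⟩
  rw [← h3, hasWeight_map_iff]

/-- The sequence with exactly the given multiplicities in the theta configuration. -/
def thetaSeq (x y z : ℕ) : Multiset E4 :=
  Multiset.replicate x (dec 1) + Multiset.replicate x (dec 2) + Multiset.replicate y (dec 4) +
    Multiset.replicate y (dec 8) + Multiset.replicate y (dec 15) + Multiset.replicate z (dec 3)

theorem lengthSet_theta_mem {x y z : ℕ} (hxyz : (x + y + z) % 2 = 0) (j : ℕ) :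
    lengthSet (ThetaWeight x y z) (2 * x + 3 * y + z + 2 * j) ∈
      lengthSystem (zeroSumSequences E4) := by
  have hB : ∀ a ∈ thetaSeq x y z, a ∈ thetaSet := by
    intro a ha
    simp only [thetaSeq, Multiset.mem_add, Multiset.mem_replicate] at ha
    simp only [thetaSet, Finset.mem_insert, Finset.mem_singleton]
    tauto
  have h0 : (0 : E4) ∉ thetaSeq x y z := fun h => absurd (hB 0 h) (by decide +kernel)
  have hcard : (thetaSeq x y z).card = 2 * x + 3 * y + z := by
    simp [thetaSeq]; ring
  have hd : [dec 1, dec 2, dec 4, dec 8, dec 15, dec 3].Nodup := by decide +kernel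
  simp only [List.nodup_cons, List.mem_cons, List.not_mem_nil, or_false, not_or] at hd
  obtain ⟨⟨a1, a2, a3, a4, a5⟩, ⟨b1, b2, b3, b4⟩, ⟨c1, c2, c3⟩, ⟨d1, d2⟩, e1, -⟩ := hd
  have hcount : (thetaSeq x y z).count (dec 1) = x ∧ (thetaSeq x y z).count (dec 2) = x ∧
      (thetaSeq x y z).count (dec 4) = y ∧ (thetaSeq x y z).count (dec 8) = y ∧
      (thetaSeq x y z).count (dec 15) = y ∧ (thetaSeq x y z).count (dec 3) = z := by
    simp only [thetaSeq, Multiset.count_add, Multiset.count_replicate]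
    simp [a1, a2, a3, a4, a5, b1, b2, b3, b4, c1, c2, c3, d1, d2, e1, Ne.symm a1, Ne.symm a2,
      Ne.symm a3, Ne.symm a4, Ne.symm a5, Ne.symm b1, Ne.symm b2, Ne.symm b3, Ne.symm b4,
      Ne.symm c1, Ne.symm c2, Ne.symm c3, Ne.symm d1, Ne.symm d2, Ne.symm e1]
  obtain ⟨k1, k2, k4, k8, k15, k3⟩ := hcount
  have hw : ∀ w, HasWeight (thetaSeq x y z) w ↔ ThetaWeight x y z w := by
    intro w
    rw [hasWeight_theta_iff hB, k1, k2, k4, k8, k15, k3, thetaWeight_iff hxyz]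
    constructor
    · rintro ⟨u, t, s, rfl, h1, -, h4, -, -, h3⟩
      exact ⟨u, t, s, rfl, h1, h4, h3⟩
    · rintro ⟨u, t, s, rfl, h1, h4, h3⟩
      exact ⟨u, t, s, rfl, h1, h1, h4, h4, h4, h3⟩
  -- A sequence that has some weight has sum zero, so one admissible pair $(p,q)$ suffices.
  have hs : (thetaSeq x y z).sum = 0 := by
    have : ThetaWeight x y z (x % 2 + 2 * (y % 2)) :=
      ⟨x % 2, y % 2, by omega, by omega, by omega, by omega, by omega, by omega, rfl⟩
    exact ((hw _).2 this).sum_eq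
  rw [mem_lengthSystem_iff]
  refine ⟨thetaSeq x y z, j, h0, hs, ?_⟩
  rw [hcard]
  congr 1
  funext w
  exact propext (hw w).symm

/-! ### Arithmetic normal forms of the families -/

theorem mem_singleton_add {a n : ℕ} {S : Set ℕ} : n ∈ ({a} : Set ℕ) + S ↔ ∃ s ∈ S, n = a + s := by
  rw [Set.singleton_add]
  simp [eq_comm]

theorem mem_dilate_Icc {d k n : ℕ} : n ∈ dilate d (Set.Icc 0 k) ↔ ∃ i ≤ k, n = d * i := by
  simp [dilate, eq_comm]

theorem ceil_div_three (k : ℕ) : ⌈(k : ℚ) / 3⌉₊ = (k + 2) / 3 := by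
  apply le_antisymm
  · rw [Nat.ceil_le, div_le_iff₀ (by norm_num)]
    have : k ≤ (k + 2) / 3 * 3 := by omega
    exact_mod_cast this
  · have h := Nat.le_ceil ((k : ℚ) / 3)
    rw [div_le_iff₀ (by norm_num)] at h
    have : k ≤ ⌈(k : ℚ) / 3⌉₊ * 3 := by exact_mod_cast h
    omega

theorem mem_family1_iff {L : Set ℕ} : L ∈ family1 ↔ ∃ m, ∀ n, n ∈ L ↔ n = m := by
  simp only [family1, Set.mem_ofPred_eq, Set.ext_iff, Set.mem_singleton_iff]

/-- As in the criteria for the other families, the minimum $m$ replaces the shift $y$, which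
survives only as a lower bound for $m$. -/
theorem mem_family2_iff {L : Set ℕ} :
    L ∈ family2 ↔ ∃ m k, 2 * k ≤ m ∧ ∀ n, n ∈ L ↔ ∃ i ≤ k, n = m + 3 * i := by
  simp only [family2, Set.mem_ofPred_eq, Set.ext_iff, mem_singleton_add, mem_dilate_Icc]
  constructor
  · rintro ⟨y, k, h⟩
    refine ⟨y + 2 * k, k, by omega, fun n => (h n).trans ?_⟩
    constructor
    · rintro ⟨_, ⟨i, hi, rfl⟩, rfl⟩; exact ⟨i, hi, rfl⟩
    · rintro ⟨i, hi, rfl⟩; exact ⟨_, ⟨i, hi, rfl⟩, rfl⟩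
  · rintro ⟨m, k, hm, h⟩
    refine ⟨m - 2 * k, k, fun n => (h n).trans ?_⟩
    rw [Nat.sub_add_cancel hm]
    constructor
    · rintro ⟨i, hi, rfl⟩; exact ⟨_, ⟨i, hi, rfl⟩, rfl⟩
    · rintro ⟨_, ⟨i, hi, rfl⟩, rfl⟩; exact ⟨i, hi, rfl⟩

theorem mem_family4_iff {L : Set ℕ} :
    L ∈ family4 ↔ ∃ m k, 2 * k ≤ m ∧ ∀ n, n ∈ L ↔ ∃ i ≤ k, n = m + 2 * i := by
  simp only [family4, Set.mem_ofPred_eq, Set.ext_iff, mem_singleton_add, mem_dilate_Icc]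
  constructor
  · rintro ⟨y, k, h⟩
    refine ⟨y + 2 * k, k, by omega, fun n => (h n).trans ?_⟩
    constructor
    · rintro ⟨_, ⟨i, hi, rfl⟩, rfl⟩; exact ⟨i, hi, rfl⟩
    · rintro ⟨i, hi, rfl⟩; exact ⟨_, ⟨i, hi, rfl⟩, rfl⟩
  · rintro ⟨m, k, hm, h⟩
    refine ⟨m - 2 * k, k, fun n => (h n).trans ?_⟩
    rw [Nat.sub_add_cancel hm]
    constructor
    · rintro ⟨i, hi, rfl⟩; exact ⟨_, ⟨i, hi, rfl⟩, rfl⟩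
    · rintro ⟨_, ⟨i, hi, rfl⟩, rfl⟩; exact ⟨i, hi, rfl⟩

theorem mem_add_Icc {a b c n : ℕ} :
    n ∈ ({a} : Set ℕ) + Set.Icc b c ↔ a + b ≤ n ∧ n ≤ a + c := by
  rw [mem_singleton_add]
  constructor
  · rintro ⟨s, ⟨h1, h2⟩, rfl⟩; omega
  · rintro ⟨h1, h2⟩; exact ⟨n - a, ⟨by omega, by omega⟩, by omega⟩

/-- The intervals that are sets of lengths. -/
def IsLengthInterval (L : Set ℕ) : Prop :=
  ∃ m k, 1 ≤ k ∧ 2 * k ≤ 3 * m ∧ (k = 1 → 2 ≤ m) ∧ (k = 3 → 3 ≤ m) ∧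
    ∀ n, n ∈ L ↔ m ≤ n ∧ n ≤ m + k

/-- The condition amounts to $2k\le 3n$, with least solution $\lceil 2k/3\rceil$. This reconciles
the two descriptions of the intervals. -/
theorem isLeast_iff {k m : ℕ} :
    IsLeast {n : ℕ | (n : ℚ) + k ≤ 5 * n / 2} m ↔ m = (2 * k + 2) / 3 := by
  have h : {n : ℕ | (n : ℚ) + k ≤ 5 * n / 2} = {n : ℕ | 2 * k ≤ 3 * n} := by
    ext n
    simp only [Set.mem_ofPred_eq]
    rw [le_div_iff₀ (by norm_num)]
    constructor
    · intro h
      have : ((n : ℚ) + k) * 2 ≤ 5 * n := h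
      norm_cast at this
      omega
    · intro h
      have : (n + k) * 2 ≤ 5 * n := by omega
      exact_mod_cast this
  rw [h]
  constructor
  · rintro ⟨h1, h2⟩
    have h3 : m ≤ (2 * k + 2) / 3 := h2 (by simp only [Set.mem_ofPred_eq]; omega)
    simp only [Set.mem_ofPred_eq] at h1
    omega
  · rintro rfl
    refine ⟨by simp only [Set.mem_ofPred_eq]; omega, ?_⟩
    intro n hn
    simp only [Set.mem_ofPred_eq] at hn
    omega

theorem mem_family3_iff {L : Set ℕ} : L ∈ family3 ↔ IsLengthInterval L := by
  simp only [family3, Set.mem_union, Set.mem_ofPred_eq, isLeast_iff, Set.ext_iff, mem_add_Icc,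
    IsLengthInterval]
  constructor
  · rintro (⟨y, h | h | h | h | h⟩ | ⟨y, k, m, hk, rfl, h⟩)
    · exact ⟨y + 2, 1, by omega, by omega, by omega, by omega, fun n => (h n).trans (by omega)⟩
    · exact ⟨y + 2, 2, by omega, by omega, by omega, by omega, fun n => (h n).trans (by omega)⟩
    · exact ⟨y + 3, 3, by omega, by omega, by omega, by omega, fun n => (h n).trans (by omega)⟩
    · exact ⟨y + 3, 4, by omega, by omega, by omega, by omega, fun n => (h n).trans (by omega)⟩
    · exact ⟨y + 4, 5, by omega, by omega, by omega, by omega, fun n => (h n).trans (by omega)⟩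
    · exact ⟨y + (2 * k + 2) / 3, k, by omega, by omega, by omega, by omega,
        fun n => (h n).trans (by omega)⟩
  · rintro ⟨m, k, hk, hm, h1, h3, h⟩
    by_cases hk6 : 6 ≤ k
    · right
      exact ⟨m - (2 * k + 2) / 3, k, _, hk6, rfl, fun n => (h n).trans (by omega)⟩
    · left
      have : k = 1 ∨ k = 2 ∨ k = 3 ∨ k = 4 ∨ k = 5 := by omega
      rcases this with rfl | rfl | rfl | rfl | rfl
      · exact ⟨m - 2, Or.inl fun n => (h n).trans (by omega)⟩
      · exact ⟨m - 2, Or.inr (Or.inl fun n => (h n).trans (by omega))⟩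
      · exact ⟨m - 3, Or.inr (Or.inr (Or.inl fun n => (h n).trans (by omega)))⟩
      · exact ⟨m - 3, Or.inr (Or.inr (Or.inr (Or.inl fun n => (h n).trans (by omega))))⟩
      · exact ⟨m - 4, Or.inr (Or.inr (Or.inr (Or.inr fun n => (h n).trans (by omega))))⟩

theorem mem_family3'_iff {L : Set ℕ} : L ∈ family3' ↔ IsLengthInterval L := by
  have hceil : ∀ k : ℕ, ⌈(2 * k : ℚ) / 3⌉₊ = (2 * k + 2) / 3 := by
    intro k
    have := ceil_div_three (2 * k)
    push_cast at this
    exact this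
  simp only [family3', Set.mem_union, Set.mem_ofPred_eq, hceil, Set.ext_iff, mem_add_Icc,
    IsLengthInterval]
  constructor
  · rintro (⟨y, k, hk, hk1, hk3, h⟩ | ⟨y, h | h⟩)
    · exact ⟨y + (2 * k + 2) / 3, k, by omega, by omega, by omega, by omega,
        fun n => (h n).trans (by omega)⟩
    · exact ⟨y + 3, 3, by omega, by omega, by omega, by omega, fun n => (h n).trans (by omega)⟩
    · exact ⟨y + 2, 1, by omega, by omega, by omega, by omega, fun n => (h n).trans (by omega)⟩
  · rintro ⟨m, k, hk, hm, h1, h3, h⟩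
    by_cases hk1 : k = 1
    · subst hk1
      exact Or.inr ⟨m - 2, Or.inr fun n => (h n).trans (by omega)⟩
    by_cases hk3 : k = 3
    · subst hk3
      exact Or.inr ⟨m - 3, Or.inl fun n => (h n).trans (by omega)⟩
    exact Or.inl ⟨m - (2 * k + 2) / 3, k, hk, hk1, hk3, fun n => (h n).trans (by omega)⟩

theorem mem_family5_iff {L : Set ℕ} : L ∈ family5 ↔ ∃ m k, 1 ≤ k ∧ k + 2 ≤ m ∧
    ∀ n, n ∈ L ↔ (m ≤ n ∧ n ≤ m + k) ∨ n = m + k + 2 := by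
  simp only [family5, Set.mem_ofPred_eq, Set.ext_iff, mem_singleton_add, Set.mem_union,
    Set.mem_Icc, Set.mem_singleton_iff]
  have key : ∀ a k n : ℕ, (∃ s, (0 ≤ s ∧ s ≤ k ∨ s = k + 2) ∧ n = a + s) ↔
      (a ≤ n ∧ n ≤ a + k) ∨ n = a + k + 2 := by
    intro a k n
    constructor
    · rintro ⟨s, h, rfl⟩; omega
    · intro h; exact ⟨n - a, by omega, by omega⟩
  simp only [key]
  constructor
  · rintro ⟨y, k, hk, h⟩
    exact ⟨y + k + 2, k, hk, by omega, h⟩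
  · rintro ⟨m, k, hk, hm, h⟩
    exact ⟨m - (k + 2), k, hk, fun n => (h n).trans (by omega)⟩

theorem mem_family6_iff {L : Set ℕ} : L ∈ family6 ↔ ∃ m k, (5 ≤ k ∨ k = 3) ∧
    2 * ((k + 2) / 3) + 2 ≤ m ∧ ∀ n, n ∈ L ↔ n = m ∨ (m + 2 ≤ n ∧ n ≤ m + k + 2) := by
  simp only [family6, Set.mem_ofPred_eq, Set.ext_iff, mem_singleton_add, Set.mem_union,
    Set.mem_Icc, Set.mem_singleton_iff, ceil_div_three]
  have key : ∀ a k n : ℕ, (∃ s, (s = 0 ∨ 2 ≤ s ∧ s ≤ k + 2) ∧ n = a + s) ↔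
      n = a ∨ (a + 2 ≤ n ∧ n ≤ a + k + 2) := by
    intro a k n
    constructor
    · rintro ⟨s, h, rfl⟩; omega
    · intro h; exact ⟨n - a, by omega, by omega⟩
  simp only [key]
  constructor
  · rintro ⟨y, k, hk, h⟩
    exact ⟨y + 2 * ((k + 2) / 3) + 2, k, hk, by omega, h⟩
  · rintro ⟨m, k, hk, hm, h⟩
    exact ⟨m - (2 * ((k + 2) / 3) + 2), k, hk, fun n => (h n).trans (by omega)⟩

theorem mem_period_iff {a b c k n : ℕ} :
    n ∈ ({a} : Set ℕ) + {0, b, c} + dilate 3 (Set.Icc 0 k) ↔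
      ∃ i ≤ k, n = a + 3 * i ∨ n = a + b + 3 * i ∨ n = a + c + 3 * i := by
  rw [Set.mem_add]
  simp only [mem_singleton_add, mem_dilate_Icc, Set.mem_insert_iff, Set.mem_singleton_iff]
  constructor
  · rintro ⟨_, ⟨s, rfl | rfl | rfl, rfl⟩, _, ⟨i, hi, rfl⟩, rfl⟩
    · exact ⟨i, hi, Or.inl rfl⟩
    · exact ⟨i, hi, Or.inr (Or.inl rfl)⟩
    · exact ⟨i, hi, Or.inr (Or.inr rfl)⟩
  · rintro ⟨i, hi, rfl | rfl | rfl⟩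
    · exact ⟨a + 0, ⟨0, Or.inl rfl, rfl⟩, _, ⟨i, hi, rfl⟩, rfl⟩
    · exact ⟨a + b, ⟨b, Or.inr (Or.inl rfl), rfl⟩, _, ⟨i, hi, rfl⟩, rfl⟩
    · exact ⟨a + c, ⟨c, Or.inr (Or.inr rfl), rfl⟩, _, ⟨i, hi, rfl⟩, rfl⟩

theorem mem_family7_iff {L : Set ℕ} : L ∈ family7 ↔
    (∃ m k, 2 * k + 3 ≤ m ∧ ∀ n, n ∈ L ↔
      ∃ i ≤ k, n = m + 3 * i ∨ n = m + 1 + 3 * i ∨ n = m + 3 + 3 * i) ∨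
    ∃ m k, 2 * k + 4 ≤ m ∧ ∀ n, n ∈ L ↔
      (∃ i ≤ k, n = m + 3 * i ∨ n = m + 1 + 3 * i ∨ n = m + 3 + 3 * i) ∨ n = m + 3 * k + 4 := by
  simp only [family7, Set.mem_union, Set.mem_ofPred_eq, Set.ext_iff, mem_period_iff,
    Set.mem_singleton_iff]
  refine or_congr ?_ ?_
  · constructor
    · rintro ⟨y, k, h⟩
      exact ⟨y + 2 * k + 3, k, by omega, h⟩
    · rintro ⟨m, k, hm, h⟩
      refine ⟨m - (2 * k + 3), k, ?_⟩
      rw [add_assoc, Nat.sub_add_cancel hm]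
      exact h
  · constructor
    · rintro ⟨y, k, h⟩
      refine ⟨y + 2 * k + 4, k, by omega, ?_⟩
      rw [show y + 2 * k + 4 + 3 * k + 4 = y + 5 * k + 8 by ring]
      exact h
    · rintro ⟨m, k, hm, h⟩
      refine ⟨m - (2 * k + 4), k, ?_⟩
      rw [add_assoc, Nat.sub_add_cancel hm,
        show m - (2 * k + 4) + 5 * k + 8 = m + 3 * k + 4 by omega]
      exact h

theorem mem_family8_iff {L : Set ℕ} : L ∈ family8 ↔
    (∃ m k, 2 * k + 3 ≤ m ∧ ∀ n, n ∈ L ↔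
      ∃ i ≤ k, n = m + 3 * i ∨ n = m + 2 + 3 * i ∨ n = m + 3 + 3 * i) ∨
    ∃ m k, 2 * k + 4 ≤ m ∧ ∀ n, n ∈ L ↔
      (∃ i ≤ k, n = m + 3 * i ∨ n = m + 2 + 3 * i ∨ n = m + 3 + 3 * i) ∨ n = m + 3 * k + 5 := by
  simp only [family8, Set.mem_union, Set.mem_ofPred_eq, Set.ext_iff, mem_period_iff,
    Set.mem_singleton_iff]
  refine or_congr ?_ ?_
  · constructor
    · rintro ⟨y, k, h⟩
      exact ⟨y + 2 * k + 3, k, by omega, h⟩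
    · rintro ⟨m, k, hm, h⟩
      refine ⟨m - (2 * k + 3), k, ?_⟩
      rw [add_assoc, Nat.sub_add_cancel hm]
      exact h
  · constructor
    · rintro ⟨y, k, h⟩
      refine ⟨y + 2 * k + 4, k, by omega, ?_⟩
      rw [show y + 2 * k + 4 + 3 * k + 5 = y + 5 * k + 9 by ring]
      exact h
    · rintro ⟨m, k, hm, h⟩
      refine ⟨m - (2 * k + 4), k, ?_⟩
      rw [add_assoc, Nat.sub_add_cancel hm,
        show m - (2 * k + 4) + 5 * k + 9 = m + 3 * k + 5 by omega]
      exact h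

/-- The union of the eight families. -/
def families : Set (Set ℕ) :=
  family1 ∪ family2 ∪ family3 ∪ family4 ∪ family5 ∪ family6 ∪ family7 ∪ family8

theorem mem_families_iff {L : Set ℕ} : L ∈ families ↔ L ∈ family1 ∨ L ∈ family2 ∨ L ∈ family3 ∨
    L ∈ family4 ∨ L ∈ family5 ∨ L ∈ family6 ∨ L ∈ family7 ∨ L ∈ family8 := by
  simp only [families, Set.mem_union, or_assoc]

/-! ### Weights without gaps -/

theorem exists_min_max {P : ℕ → Prop} (h : ∃ n, P n) {b : ℕ} (hb : ∀ n, P n → n ≤ b) :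
    ∃ a c, P a ∧ P c ∧ ∀ n, P n → a ≤ n ∧ n ≤ c := by
  classical
  obtain ⟨n, hn⟩ := h
  exact ⟨Nat.find ⟨n, hn⟩, Nat.findGreatest P b, Nat.find_spec ⟨n, hn⟩,
    Nat.findGreatest_spec (hb n hn) hn, fun k hk =>
      ⟨Nat.find_min' ⟨n, hn⟩ hk, Nat.le_findGreatest (hb k hk) hk⟩⟩

theorem down_closed {P : ℕ → Prop} {a c : ℕ} (hc : P c)
    (hstep : ∀ w, P w → a < w → w ≤ c → P (w - 2)) {w : ℕ} (haw : a ≤ w) (hwc : w ≤ c)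
    (hpar : w % 2 = c % 2) : P w := by
  obtain ⟨j, hj⟩ : ∃ j, c = w + 2 * j := ⟨(c - w) / 2, by omega⟩
  induction j generalizing w with
  | zero => rw [show w = c by omega]; exact hc
  | succ j ih =>
    have := hstep (w + 2) (ih (by omega) (by omega) (by omega) (by omega)) (by omega) (by omega)
    simpa using this

/-- Otherwise `A` is a single circuit. A second factorization would have no squares and at least two
circuits, hence at least six elements. -/
theorem HasWeight.add_four_le {A : Multiset E4} {v w : ℕ} (hv : HasWeight A v)
    (hw : HasWeight A w) (hvw : v < w) : w + 4 ≤ A.card := by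
  obtain ⟨F, R, hF, hA, rfl⟩ := hw
  have hc := congrArg Multiset.card hA
  rw [Multiset.card_add, card_cover hF, Multiset.card_nsmul] at hc
  by_contra hlt
  have hR : R = 0 := Multiset.card_eq_zero.1 (by
    by_contra hR
    have hF0 : F.card = 0 := by omega
    rw [Multiset.card_eq_zero.1 hF0] at hvw
    simp at hvw)
  have hF1 : F.card = 1 := by
    have : F.card ≠ 0 := fun h0 => by
      rw [Multiset.card_eq_zero.1 h0] at hvw; simp at hvw
    omega
  obtain ⟨C, rfl⟩ := Multiset.card_eq_one.1 hF1
  have hA' : A = C.val := by rw [← hA, hR]; simp [cover]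
  have hC := hF C (by simp)
  obtain ⟨F', R', hF', hA'', rfl⟩ := hv
  have hR' : R' = 0 := by
    by_contra hne
    obtain ⟨x, hx⟩ := Multiset.exists_mem_of_ne_zero hne
    have h1 := congrArg (Multiset.count x) hA''
    rw [Multiset.count_add, Multiset.count_nsmul] at h1
    have h2 := Multiset.count_pos.2 hx
    have h3 : A.count x ≤ 1 := by rw [hA']; exact Multiset.nodup_iff_count_le_one.1 C.nodup x
    omega
  have hc' := congrArg Multiset.card hA''
  rw [hR', Multiset.card_add, card_cover hF', Multiset.card_nsmul] at hc'
  have h5 := hC.le_five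
  have h6 := card_le_weight hF'
  have h7 : A.card = C.card := by rw [hA']; rfl
  simp only [Multiset.card_zero, mul_zero, add_zero] at hc'
  have h8 : weight {C} = C.card - 2 := by simp [weight]
  have := hC.three_le
  omega

/-- Weight 6 forces two five-element circuits, and weight 0 makes all multiplicities even, so
$A=U^2$. The only circuit inside $U$ is $U$, so every weight is a multiple of 3. -/
theorem not_hasWeight_of_card_eq_ten {A : Multiset E4} (hA : A.card = 10) (h6 : HasWeight A 6)
    (h4 : HasWeight A 4) (h0 : HasWeight A 0) : False := by
  obtain ⟨F, R, hF, hAF, hw⟩ := h6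
  have hc := congrArg Multiset.card hAF
  rw [Multiset.card_add, card_cover hF, Multiset.card_nsmul, hw] at hc
  have h3 := weight_le_three_mul_card hF
  have hF2 : F.card = 2 := by omega
  have hR : R = 0 := Multiset.card_eq_zero.1 (by omega)
  obtain ⟨U, V, rfl⟩ := Multiset.card_eq_two.1 hF2
  have hU := hF U (by simp)
  have hV := hF V (by simp)
  have hAe : A = U.val + V.val := by rw [← hAF, hR]; simp [cover]
  have hw' : U.card - 2 + (V.card - 2) = 6 := by rw [← hw]; simp [weight]
  have hU5 : U.card = 5 := by have := hU.le_five; have := hV.le_five; omega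
  obtain ⟨F', R', hF', hA', hw0⟩ := h0
  have hF'0 : F' = 0 := Multiset.card_eq_zero.1 (by have := card_le_weight hF'; omega)
  have heven : ∀ x, (U.val + V.val).count x % 2 = 0 := by
    intro x
    rw [← hAe, ← hA', hF'0, cover_zero, zero_add, Multiset.count_nsmul]
    omega
  have hUV : U = V := by
    ext x
    have h := heven x
    rw [Multiset.count_add] at h
    constructor
    · intro hx
      by_contra hx'
      rw [Multiset.count_eq_one_of_mem U.nodup hx, Multiset.count_eq_zero_of_notMem hx'] at h
      omega
    · intro hx
      by_contra hx'
      rw [Multiset.count_eq_one_of_mem V.nodup hx, Multiset.count_eq_zero_of_notMem hx'] at h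
      omega
  subst hUV
  obtain ⟨F'', R'', hF'', hA'', hw4⟩ := h4
  have hall : ∀ C ∈ F'', C = U := by
    intro C hC
    have hsub : C ⊆ U := by
      intro x hx
      have : x ∈ A := by
        rw [← hA'']; exact Multiset.mem_add.2 (Or.inl (mem_cover.2 ⟨C, hC, hx⟩))
      rw [hAe] at this
      simpa using this
    by_contra hne
    have hCc := hF'' C hC
    have hs : ∑ x ∈ U \ C, x = 0 := by
      rw [Finset.sum_sdiff_eq_sub hsub, hU.sum_eq, hCc.sum_eq, sub_zero]
    have h1 := Finset.card_sdiff_add_card_eq_card hsub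
    have := three_le_card_of_sum_eq_zero (fun h => hU.zero_notMem (Finset.mem_sdiff.1 h).1) hs
      (Finset.sdiff_nonempty.2 fun h => hne (Finset.Subset.antisymm hsub h))
    have := hCc.three_le
    omega
  rw [Multiset.eq_replicate_card.2 hall, weight_replicate, hU5] at hw4
  omega

/-- If the weights have no gaps, then the set of lengths is a singleton or an interval. -/
theorem lengthSet_of_no_gap {A : Multiset E4} (h0 : (0 : E4) ∉ A) (hs : A.sum = 0) (y : ℕ)
    (hgap : ∀ w, HasWeight A w → (∃ v < w, HasWeight A v) → HasWeight A (w - 2)) :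
    lengthSet (HasWeight A) (A.card + 2 * y) ∈ families := by
  obtain ⟨a, c, ha, hc, hac⟩ := exists_min_max (exists_hasWeight h0 hs) (fun w hw => hw.le_card)
  have hpa := ha.mod_two
  have hpc := hc.mod_two
  have hmem : ∀ w, HasWeight A w ↔ a ≤ w ∧ w ≤ c ∧ w % 2 = c % 2 := by
    intro w
    refine ⟨fun hw => ⟨(hac w hw).1, (hac w hw).2, hw.mod_two.trans hpc.symm⟩, ?_⟩
    rintro ⟨h1, h2, h3⟩
    exact down_closed hc (fun w hw haw _ => hgap w hw ⟨a, haw, ha⟩) h1 h2 h3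
  have hcc := hc.five_mul_le
  have hle := (hac a ha).2
  have hL : ∀ n, n ∈ lengthSet (HasWeight A) (A.card + 2 * y) ↔
      (A.card + 2 * y - c) / 2 ≤ n ∧ n ≤ (A.card + 2 * y - c) / 2 + (c - a) / 2 := by
    intro n
    simp only [lengthSet, Set.mem_ofPred_eq, hmem]
    constructor
    · rintro ⟨w, hw, h⟩; omega
    · intro h
      exact ⟨A.card + 2 * y - 2 * n, by omega, by omega⟩
  rw [mem_families_iff]
  by_cases hca : a = c
  · left
    rw [mem_family1_iff]
    exact ⟨(A.card + 2 * y - c) / 2, fun n => (hL n).trans (by omega)⟩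
  · right; right; left
    rw [mem_family3_iff]
    have h4 := ha.add_four_le hc (by omega)
    -- The bound $5c\le 3|A|$ gives $2k\le 3m$, and `add_four_le` gives $m\ge 2$. The remaining case
    -- $k=3$, $m=2$ forces ten elements and weights from 0 to 6.
    refine ⟨(A.card + 2 * y - c) / 2, (c - a) / 2, by omega, by omega, by omega, ?_, hL⟩
    intro h3
    by_contra hm
    have : A.card = 10 ∧ c = 6 ∧ a = 0 := by omega
    obtain ⟨h10, rfl, rfl⟩ := this
    exact not_hasWeight_of_card_eq_ten h10 hc ((hmem 4).2 (by omega)) ha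

/-! ### Shapes of sets of lengths over theta supports -/

theorem mem_lengthSet_theta {x y z N n : ℕ} : n ∈ lengthSet (ThetaWeight x y z) N ↔
    ∃ p q, p ≤ x ∧ p % 2 = x % 2 ∧ q ≤ y ∧ q % 2 = y % 2 ∧ p ≤ q + z ∧ q ≤ p + z ∧
      2 * n + p + 2 * q = N := by
  simp only [lengthSet, ThetaWeight, Set.mem_ofPred_eq]
  constructor
  · rintro ⟨w, ⟨p, q, h1, h2, h3, h4, h5, h6, rfl⟩, h⟩
    exact ⟨p, q, h1, h2, h3, h4, h5, h6, by omega⟩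
  · rintro ⟨p, q, h1, h2, h3, h4, h5, h6, h⟩
    exact ⟨_, ⟨p, q, h1, h2, h3, h4, h5, h6, rfl⟩, by omega⟩

section shapes

variable {x y z N : ℕ}

/-- Here $z=0$ forces $p=q$ and weight $3p$; since $p$ moves in steps of two, lengths move in steps
of three. -/
theorem lengthSet_theta_zero (hxy : x % 2 = y % 2) (hN : N % 2 = x % 2)
    (hle : 2 * x + 3 * y ≤ N) {P : ℕ} (hP : P = min x y) (n : ℕ) :
    n ∈ lengthSet (ThetaWeight x y 0) N ↔ ∃ i ≤ P / 2, n = (N - 3 * P) / 2 + 3 * i := by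
  rw [mem_lengthSet_theta]
  constructor
  · rintro ⟨p, q, h1, h2, h3, h4, h5, h6, h7⟩
    exact ⟨(P - p) / 2, by omega, by omega⟩
  · rintro ⟨i, hi, rfl⟩
    exact ⟨P - 2 * i, P - 2 * i, by omega, by omega, by omega, by omega, by omega, by omega,
      by omega⟩

/-- Weights `2, 4, 8, 10, …, 6 i + 2, 6 i + 4, 6 i + 8`. -/
theorem lengthSet_theta_even_lt {i : ℕ} (hy : 2 * i + 2 < y) (hy' : y % 2 = 1)
    (hN : N % 2 = 0) (hle : 10 * i + 14 ≤ N) (n : ℕ) :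
    n ∈ lengthSet (ThetaWeight (2 * i + 2) y 1) N ↔ ∃ j ≤ i, n = (N - 6 * i - 8) / 2 + 3 * j ∨
      n = (N - 6 * i - 8) / 2 + 2 + 3 * j ∨ n = (N - 6 * i - 8) / 2 + 3 + 3 * j := by
  rw [mem_lengthSet_theta]
  constructor
  · rintro ⟨p, q, h1, h2, h3, h4, h5, h6, h7⟩
    -- For $z=1$ the parities force $|p-q|=1$, so the weight is $3p+2$ or $3p-2$, according to which
    -- of $p,q$ is smaller.
    by_cases hpq : p < q
    · by_cases hp : p = 0
      · exact ⟨i, le_rfl, by omega⟩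
      · exact ⟨(2 * i + 2 - p) / 2, by omega, by omega⟩
    · exact ⟨(2 * i + 2 - p) / 2, by omega, by omega⟩
  · rintro ⟨j, hj, h | h | h⟩
    · exact ⟨2 * i + 2 - 2 * j, 2 * i + 3 - 2 * j, by omega, by omega, by omega, by omega, by omega,
        by omega, by omega⟩
    · exact ⟨2 * i + 2 - 2 * j, 2 * i + 1 - 2 * j, by omega, by omega, by omega, by omega, by omega,
        by omega, by omega⟩
    · exact ⟨2 * i - 2 * j, 2 * i + 1 - 2 * j, by omega, by omega, by omega, by omega, by omega,
        by omega, by omega⟩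

/-- Weights `2, 4, 8, 10, …, 6 i + 8, 6 i + 10`. -/
theorem lengthSet_theta_even_gt {i : ℕ} (hx : 2 * i + 3 < x) (hx' : x % 2 = 0)
    (hN : N % 2 = 0) (hle : 10 * i + 18 ≤ N) (n : ℕ) :
    n ∈ lengthSet (ThetaWeight x (2 * i + 3) 1) N ↔ (∃ j ≤ i, n = (N - 6 * i - 10) / 2 + 3 * j ∨
      n = (N - 6 * i - 10) / 2 + 1 + 3 * j ∨ n = (N - 6 * i - 10) / 2 + 3 + 3 * j) ∨
      n = (N - 6 * i - 10) / 2 + 3 * i + 4 := by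
  rw [mem_lengthSet_theta]
  constructor
  · rintro ⟨p, q, h1, h2, h3, h4, h5, h6, h7⟩
    by_cases hpq : p < q
    · by_cases hp : p = 0
      · right; omega
      · left; exact ⟨(2 * i + 3 - q) / 2, by omega, by omega⟩
    · by_cases hq : q = 1
      · left; exact ⟨i, le_rfl, by omega⟩
      · left; exact ⟨(2 * i + 3 - q) / 2, by omega, by omega⟩
  · rintro (⟨j, hj, h | h | h⟩ | h)
    · exact ⟨2 * i + 4 - 2 * j, 2 * i + 3 - 2 * j, by omega, by omega, by omega, by omega, by omega,
        by omega, by omega⟩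
    · exact ⟨2 * i + 2 - 2 * j, 2 * i + 3 - 2 * j, by omega, by omega, by omega, by omega, by omega,
        by omega, by omega⟩
    · exact ⟨2 * i + 2 - 2 * j, 2 * i + 1 - 2 * j, by omega, by omega, by omega, by omega, by omega,
        by omega, by omega⟩
    · exact ⟨0, 1, by omega, by omega, by omega, by omega, by omega, by omega, by omega⟩

/-- Weights `1, 5, 7, …, 6 i + 5, 6 i + 7, 6 i + 11`. -/
theorem lengthSet_theta_odd_lt {i : ℕ} (hy : 2 * i + 3 < y) (hy' : y % 2 = 0)
    (hN : N % 2 = 1) (hle : 10 * i + 19 ≤ N) (n : ℕ) :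
    n ∈ lengthSet (ThetaWeight (2 * i + 3) y 1) N ↔ (∃ j ≤ i, n = (N - 6 * i - 11) / 2 + 3 * j ∨
      n = (N - 6 * i - 11) / 2 + 2 + 3 * j ∨ n = (N - 6 * i - 11) / 2 + 3 + 3 * j) ∨
      n = (N - 6 * i - 11) / 2 + 3 * i + 5 := by
  rw [mem_lengthSet_theta]
  constructor
  · rintro ⟨p, q, h1, h2, h3, h4, h5, h6, h7⟩
    by_cases hpq : p < q
    · by_cases hp : p = 1
      · left; exact ⟨i, le_rfl, by omega⟩
      · left; exact ⟨(2 * i + 3 - p) / 2, by omega, by omega⟩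
    · by_cases hq : q = 0
      · right; omega
      · left; exact ⟨(2 * i + 3 - p) / 2, by omega, by omega⟩
  · rintro (⟨j, hj, h | h | h⟩ | h)
    · exact ⟨2 * i + 3 - 2 * j, 2 * i + 4 - 2 * j, by omega, by omega, by omega, by omega, by omega,
        by omega, by omega⟩
    · exact ⟨2 * i + 3 - 2 * j, 2 * i + 2 - 2 * j, by omega, by omega, by omega, by omega, by omega,
        by omega, by omega⟩
    · exact ⟨2 * i + 1 - 2 * j, 2 * i + 2 - 2 * j, by omega, by omega, by omega, by omega, by omega,
        by omega, by omega⟩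
    · exact ⟨1, 0, by omega, by omega, by omega, by omega, by omega, by omega, by omega⟩

/-- Weights `1, 5, 7, …, 6 i + 5, 6 i + 7`. -/
theorem lengthSet_theta_odd_gt {i : ℕ} (hx : 2 * i + 2 < x) (hx' : x % 2 = 1)
    (hN : N % 2 = 1) (hle : 10 * i + 13 ≤ N) (n : ℕ) :
    n ∈ lengthSet (ThetaWeight x (2 * i + 2) 1) N ↔ ∃ j ≤ i, n = (N - 6 * i - 7) / 2 + 3 * j ∨
      n = (N - 6 * i - 7) / 2 + 1 + 3 * j ∨ n = (N - 6 * i - 7) / 2 + 3 + 3 * j := by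
  rw [mem_lengthSet_theta]
  constructor
  · rintro ⟨p, q, h1, h2, h3, h4, h5, h6, h7⟩
    by_cases hpq : p < q
    · exact ⟨(2 * i + 2 - q) / 2, by omega, by omega⟩
    · by_cases hq : q = 0
      · exact ⟨i, le_rfl, by omega⟩
      · exact ⟨(2 * i + 2 - q) / 2, by omega, by omega⟩
  · rintro ⟨j, hj, h | h | h⟩
    · exact ⟨2 * i + 3 - 2 * j, 2 * i + 2 - 2 * j, by omega, by omega, by omega, by omega, by omega,
        by omega, by omega⟩
    · exact ⟨2 * i + 1 - 2 * j, 2 * i + 2 - 2 * j, by omega, by omega, by omega, by omega, by omega,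
        by omega, by omega⟩
    · exact ⟨2 * i + 1 - 2 * j, 2 * i - 2 * j, by omega, by omega, by omega, by omega, by omega,
        by omega, by omega⟩

/-- Now $p=x$ is fixed, and $q$ moves in steps of two, so lengths move in steps of two. -/
theorem lengthSet_theta_le_one (hx : x ≤ 1) (hz : 2 ≤ z) (hxyz : (x + y + z) % 2 = 0)
    (hN : N % 2 = x % 2) (hle : 2 * x + 3 * y + z ≤ N) {Q : ℕ} (hQ : Q = min y (x + z)) (n : ℕ) :
    n ∈ lengthSet (ThetaWeight x y z) N ↔ ∃ i ≤ Q / 2, n = (N - x - 2 * Q) / 2 + 2 * i := by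
  rw [mem_lengthSet_theta]
  constructor
  · rintro ⟨p, q, h1, h2, h3, h4, h5, h6, h7⟩
    exact ⟨(Q - q) / 2, by omega, by omega⟩
  · rintro ⟨i, hi, rfl⟩
    exact ⟨x, Q - 2 * i, by omega, by omega, by omega, by omega, by omega, by omega, by omega⟩

/-- Lower $p$ by two. If $p<2$ or $q=p+z$ forbids this, raise $p$ and lower $q$ by two instead. The
only obstructions are the minimal weight and the corner $(p,q)=(x,x+z)$. -/
theorem ThetaWeight.sub_two (hx : 2 ≤ x) (hz : 2 ≤ z) (hxyz : (x + y + z) % 2 = 0) {w : ℕ}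
    (hw : ThetaWeight x y z w) (hmin : x % 2 + 2 * (y % 2) < w) (hmax : w ≠ 3 * x + 2 * z) :
    ThetaWeight x y z (w - 2) := by
  obtain ⟨p, q, h1, h2, h3, h4, h5, h6, rfl⟩ := hw
  by_cases hp : 2 ≤ p ∧ q + 2 ≤ p + z
  · exact ⟨p - 2, q, by omega, by omega, by omega, by omega, by omega, by omega, by omega⟩
  · refine ⟨p + 2, q - 2, ?_, by omega, by omega, ?_, ?_, by omega, ?_⟩
    · omega
    · omega
    · omega
    · omega

theorem theta_large_cases (hx : 2 ≤ x) (hz : 2 ≤ z) (hxyz : (x + y + z) % 2 = 0) {k : ℕ}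
    (hk : 2 * k + 4 + x % 2 + 2 * (y % 2) = 3 * x + 2 * z) : 5 ≤ k ∨ k = 3 := by
  obtain ⟨a, rfl | rfl⟩ := Nat.even_or_odd' x <;> obtain ⟨b, rfl | rfl⟩ := Nat.even_or_odd' z <;>
    obtain ⟨c, rfl | rfl⟩ := Nat.even_or_odd' y <;> omega

theorem theta_large_bound (hx : 2 ≤ x) (hz : 2 ≤ z) (hxyz : (x + y + z) % 2 = 0) {k : ℕ}
    (hk : 2 * k + 4 + x % 2 + 2 * (y % 2) = 3 * x + 2 * z) :
    2 * ((k + 2) / 3) + 2 ≤ x + z := by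
  obtain ⟨a, rfl | rfl⟩ := Nat.even_or_odd' x <;> obtain ⟨b, rfl | rfl⟩ := Nat.even_or_odd' z <;>
    obtain ⟨c, rfl | rfl⟩ := Nat.even_or_odd' y <;> omega

/-- The corner $(x,x+z)$ gives the top weight. The pair $(x,x+z-2)$ lies four below it, and any
$p\le x-2$ at least six below. So exactly the weight two below the top is missing. -/
theorem lengthSet_theta_large (hx : 2 ≤ x) (hz : 2 ≤ z) (hxyz : (x + y + z) % 2 = 0)
    (hy : x + z ≤ y) (hN : N % 2 = x % 2) (hle : 2 * x + 3 * y + z ≤ N) {k : ℕ}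
    (hk : 2 * k + 4 + x % 2 + 2 * (y % 2) = 3 * x + 2 * z) (n : ℕ) :
    n ∈ lengthSet (ThetaWeight x y z) N ↔ n = (N - 3 * x - 2 * z) / 2 ∨
      ((N - 3 * x - 2 * z) / 2 + 2 ≤ n ∧ n ≤ (N - 3 * x - 2 * z) / 2 + k + 2) := by
  constructor
  · rw [mem_lengthSet_theta]
    rintro ⟨p, q, h1, h2, h3, h4, h5, h6, h7⟩
    by_cases hp : p = x
    · subst hp
      by_cases hq : q = p + z
      · left; omega
      · right; omega
    · right; omega
  · intro h
    refine ⟨N - 2 * n, ?_, by omega⟩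
    rcases h with h | h
    · exact ⟨x, x + z, by omega, by omega, by omega, by omega, by omega, by omega, by omega⟩
    · have htop : ThetaWeight x y z (3 * x + 2 * z - 4) :=
        ⟨x, x + z - 2, by omega, by omega, by omega, by omega, by omega, by omega, by omega⟩
      refine down_closed (P := ThetaWeight x y z) (a := x % 2 + 2 * (y % 2)) htop ?_ ?_ ?_ ?_
      · intro w hw h1 h2
        exact hw.sub_two hx hz hxyz h1 (by omega)
      · omega
      · omega
      · omega

end shapes

/-! ### Every set of lengths lies in one of the families -/

theorem lengthSet_congr {W W' : ℕ → Prop} (h : ∀ w, W w ↔ W' w) (N : ℕ) :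
    lengthSet W N = lengthSet W' N := by
  have : W = W' := funext fun w => propext (h w)
  rw [this]

theorem lengthSet_mem_of_thetaSupport {A : Multiset E4} (h0 : (0 : E4) ∉ A) (hs : A.sum = 0)
    (hA : ThetaSupport A) (j : ℕ) :
    lengthSet (HasWeight A) (A.card + 2 * j) ∈ families := by
  obtain ⟨x, y, z, hxyz, hle, hw⟩ := hA.exists_weight hs
  have hpar : A.card % 2 = x % 2 := by
    have : ThetaWeight x y z (x % 2 + 2 * (y % 2)) :=
      ⟨x % 2, y % 2, by omega, by omega, by omega, by omega, by omega, by omega, rfl⟩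
    have := ((hw _).2 this).mod_two
    omega
  -- If $y<x+z$, the corner $(x,x+z)$ is out of reach and nothing obstructs `ThetaWeight.sub_two`.
  by_cases hgapless : 2 ≤ x ∧ 2 ≤ z ∧ y < x + z
  · obtain ⟨hx, hz, hy⟩ := hgapless
    refine lengthSet_of_no_gap h0 hs j fun w hww hv => ?_
    rw [hw] at hww ⊢
    obtain ⟨v, hvw, hv⟩ := hv
    rw [hw] at hv
    refine hww.sub_two hx hz hxyz ?_ ?_
    · obtain ⟨p, q, h1, h2, h3, h4, h5, h6, rfl⟩ := hv
      omega
    · obtain ⟨p, q, h1, h2, h3, h4, h5, h6, rfl⟩ := hww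
      omega
  rw [lengthSet_congr hw]
  generalize hNe : A.card + 2 * j = N
  have hN : N % 2 = x % 2 := by omega
  have hle' : 2 * x + 3 * y + z ≤ N := by omega
  clear hle hpar hNe hw
  rw [mem_families_iff]
  by_cases hz0 : z = 0
  · subst hz0
    right; left
    rw [mem_family2_iff]
    exact ⟨_, _, by omega, lengthSet_theta_zero (by omega) hN (by omega) rfl⟩
  by_cases hz1 : z = 1
  · subst hz1
    rcases Nat.lt_or_gt_of_ne (show x ≠ y by omega) with hxy | hxy
    · rcases Nat.mod_two_eq_zero_or_one x with hx | hx
      · by_cases hx0 : x = 0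
        · left
          rw [mem_family1_iff]
          refine ⟨(N - 2) / 2, fun n => ?_⟩
          rw [mem_lengthSet_theta]
          constructor
          · rintro ⟨p, q, h1, h2, h3, h4, h5, h6, h7⟩; omega
          · rintro rfl
            exact ⟨0, 1, by omega, by omega, by omega, by omega, by omega, by omega, by omega⟩
        · obtain ⟨i, rfl⟩ : ∃ i, x = 2 * i + 2 := ⟨(x - 2) / 2, by omega⟩
          right; right; right; right; right; right; right
          rw [mem_family8_iff]
          left
          exact ⟨_, _, by omega, lengthSet_theta_even_lt hxy (by omega) (by omega) (by omega)⟩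
      · by_cases hx1 : x = 1
        · subst hx1
          right; right; right; left
          rw [mem_family4_iff]
          refine ⟨(N - 5) / 2, 1, by omega, fun n => ?_⟩
          rw [mem_lengthSet_theta]
          constructor
          · rintro ⟨p, q, h1, h2, h3, h4, h5, h6, h7⟩
            exact ⟨(2 - q) / 2, by omega, by omega⟩
          · rintro ⟨i, hi, rfl⟩
            exact ⟨1, 2 - 2 * i, by omega, by omega, by omega, by omega, by omega, by omega,
              by omega⟩
        · obtain ⟨i, rfl⟩ : ∃ i, x = 2 * i + 3 := ⟨(x - 3) / 2, by omega⟩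
          right; right; right; right; right; right; right
          rw [mem_family8_iff]
          right
          exact ⟨_, _, by omega, lengthSet_theta_odd_lt hxy (by omega) (by omega) (by omega)⟩
    · rcases Nat.mod_two_eq_zero_or_one x with hx | hx
      · by_cases hy1 : y = 1
        · subst hy1
          right; right; left
          rw [mem_family3_iff]
          refine ⟨(N - 4) / 2, 1, by omega, by omega, by omega, by omega, fun n => ?_⟩
          rw [mem_lengthSet_theta]
          constructor
          · rintro ⟨p, q, h1, h2, h3, h4, h5, h6, h7⟩; omega
          · intro h
            by_cases hn : n = (N - 4) / 2
            · exact ⟨2, 1, by omega, by omega, by omega, by omega, by omega, by omega, by omega⟩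
            · exact ⟨0, 1, by omega, by omega, by omega, by omega, by omega, by omega, by omega⟩
        · obtain ⟨i, rfl⟩ : ∃ i, y = 2 * i + 3 := ⟨(y - 3) / 2, by omega⟩
          right; right; right; right; right; right; left
          rw [mem_family7_iff]
          right
          exact ⟨_, _, by omega, lengthSet_theta_even_gt hxy hx (by omega) (by omega)⟩
      · by_cases hy0 : y = 0
        · left
          subst hy0
          rw [mem_family1_iff]
          refine ⟨(N - 1) / 2, fun n => ?_⟩
          rw [mem_lengthSet_theta]
          constructor
          · rintro ⟨p, q, h1, h2, h3, h4, h5, h6, h7⟩; omega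
          · rintro rfl
            exact ⟨1, 0, by omega, by omega, by omega, by omega, by omega, by omega, by omega⟩
        · obtain ⟨i, rfl⟩ : ∃ i, y = 2 * i + 2 := ⟨(y - 2) / 2, by omega⟩
          right; right; right; right; right; right; left
          rw [mem_family7_iff]
          left
          exact ⟨_, _, by omega, lengthSet_theta_odd_gt hxy hx (by omega) (by omega)⟩
  by_cases hx1 : x ≤ 1
  · right; right; right; left
    rw [mem_family4_iff]
    exact ⟨_, _, by omega, lengthSet_theta_le_one hx1 (by omega) hxyz hN hle' rfl⟩
  · right; right; right; right; right; left
    rw [mem_family6_iff]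
    obtain ⟨k, hk⟩ : ∃ k, 2 * k + 4 + x % 2 + 2 * (y % 2) = 3 * x + 2 * z :=
      ⟨(3 * x + 2 * z - 4 - x % 2 - 2 * (y % 2)) / 2, by omega⟩
    refine ⟨_, k, ?_, ?_, lengthSet_theta_large (by omega) (by omega) hxyz (by omega) hN hle' hk⟩
    · exact theta_large_cases (by omega) (by omega) hxyz hk
    · have := theta_large_bound (by omega) (by omega) hxyz hk
      omega

theorem two_mul_weight_le {A : Multiset E4} {w : ℕ}
    (hA : ∀ C, IsCircuit C → (∀ x ∈ C, x ∈ A) → C.card = 4) (hw : HasWeight A w) :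
    2 * w ≤ A.card := by
  obtain ⟨F, R, hF, hAF, rfl⟩ := hw
  have h4 : ∀ C ∈ F, C.card = 4 := fun C hC => hA C (hF C hC) fun x hx => by
    rw [← hAF]; exact Multiset.mem_add.2 (Or.inl (mem_cover.2 ⟨C, hC, hx⟩))
  have h1 := card_cover hF
  have h2 := weight_le_mul_card (F := F) (c := 2) fun C hC => (h4 C hC).le
  rw [← hAF, Multiset.card_add]
  omega

/-- Outside theta supports the only possible gap is the missing weight 2 below 4, in a square
sequence; the weights are then $0,4,6,\dots,c$. All circuits have four elements, so $2c\le |A|$,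
which is the lower bound for the minimum in `family5`. -/
theorem lengthSet_mem_families {A : Multiset E4} (h0 : (0 : E4) ∉ A) (hs : A.sum = 0) (j : ℕ) :
    lengthSet (HasWeight A) (A.card + 2 * j) ∈ families := by
  by_cases hθ : ThetaSupport A
  · exact lengthSet_mem_of_thetaSupport h0 hs hθ j
  have hgap : ∀ w, HasWeight A w → (∃ v < w, HasWeight A v) → ¬ HasWeight A (w - 2) →
      w = 4 ∧ (∃ Q, A = 2 • Q) ∧ ∀ C, IsCircuit C → (∀ x ∈ C, x ∈ A) → C.card = 4 :=
    fun w hw hv hn => (gap_cases h0 hw hn hv).resolve_left hθ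
  by_cases hno : ∀ w, HasWeight A w → (∃ v < w, HasWeight A v) → HasWeight A (w - 2)
  · exact lengthSet_of_no_gap h0 hs j hno
  push Not at hno
  obtain ⟨w, hw, hv, hn⟩ := hno
  obtain ⟨rfl, ⟨Q, hQ⟩, h4⟩ := hgap w hw hv hn
  have hA0 : HasWeight A 0 := hQ ▸ HasWeight.squares Q
  obtain ⟨a, c, -, hc, hac⟩ := exists_min_max ⟨0, hA0⟩ (fun w hw => hw.le_card)
  have hc4 := (hac 4 hw).2
  have hcc := two_mul_weight_le h4 hc
  have hpc := hc.mod_two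
  have hp4 := hw.mod_two
  have hmem : ∀ w, HasWeight A w ↔ w = 0 ∨ (4 ≤ w ∧ w ≤ c ∧ w % 2 = 0) := by
    intro v
    constructor
    · intro hv
      have h1 := hv.mod_two
      have h2 := (hac v hv).2
      have h3 : v ≠ 2 := fun e => hn (by simpa [e] using hv)
      omega
    · rintro (rfl | ⟨h1, h2, h3⟩)
      · exact hA0
      · refine down_closed hc (a := 4) ?_ h1 h2 (by omega)
        intro u hu hu4 _
        by_contra hcon
        have := (hgap u hu ⟨4, hu4, hw⟩ hcon).1
        omega
  have hL : ∀ n, n ∈ lengthSet (HasWeight A) (A.card + 2 * j) ↔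
      ((A.card + 2 * j - c) / 2 ≤ n ∧ n ≤ (A.card + 2 * j - c) / 2 + (c - 4) / 2) ∨
        n = (A.card + 2 * j - c) / 2 + (c - 4) / 2 + 2 := by
    intro n
    simp only [lengthSet, Set.mem_ofPred_eq, hmem]
    constructor
    · rintro ⟨w, hw, h⟩; omega
    · intro h
      exact ⟨A.card + 2 * j - 2 * n, by omega, by omega⟩
  rw [mem_families_iff]
  by_cases hc' : c = 4
  · right; right; right; left
    rw [mem_family4_iff]
    refine ⟨(A.card + 2 * j - c) / 2, 1, by omega, fun n => (hL n).trans ?_⟩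
    constructor
    · rintro (h | h)
      · exact ⟨0, by omega, by omega⟩
      · exact ⟨1, by omega, by omega⟩
    · rintro ⟨i, hi, h⟩; omega
  · right; right; right; right; left
    rw [mem_family5_iff]
    exact ⟨_, _, by omega, by omega, hL⟩

/-! ### Realization by theta sequences -/

theorem mem_lengthSystem_of_theta {L : Set ℕ} {x y z : ℕ} (hxyz : (x + y + z) % 2 = 0) (j : ℕ)
    (h : ∀ n, n ∈ L ↔ n ∈ lengthSet (ThetaWeight x y z) (2 * x + 3 * y + z + 2 * j)) :
    L ∈ lengthSystem (zeroSumSequences E4) := by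
  rw [Set.ext h]
  exact lengthSet_theta_mem hxyz j

theorem family1_subset {L : Set ℕ} (hL : L ∈ family1) :
    L ∈ lengthSystem (zeroSumSequences E4) := by
  obtain ⟨m, h⟩ := mem_family1_iff.1 hL
  refine mem_lengthSystem_of_theta (x := 0) (y := 0) (z := 0) rfl m fun n => (h n).trans ?_
  rw [lengthSet_theta_zero rfl (by omega) (by omega) rfl]
  constructor
  · rintro rfl; exact ⟨0, by omega, by omega⟩
  · rintro ⟨i, hi, rfl⟩; omega

theorem family2_subset {L : Set ℕ} (hL : L ∈ family2) :
    L ∈ lengthSystem (zeroSumSequences E4) := by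
  obtain ⟨m, k, hm, h⟩ := mem_family2_iff.1 hL
  refine mem_lengthSystem_of_theta (x := 2 * k) (y := 2 * k) (z := 0) (by omega) (m - 2 * k)
    fun n => (h n).trans ?_
  rw [lengthSet_theta_zero rfl (by omega) (by omega) rfl, min_self,
    show 2 * k / 2 = k by omega,
    show (2 * (2 * k) + 3 * (2 * k) + 0 + 2 * (m - 2 * k) - 3 * (2 * k)) / 2 = m by omega]

theorem family4_subset {L : Set ℕ} (hL : L ∈ family4) :
    L ∈ lengthSystem (zeroSumSequences E4) := by
  obtain ⟨m, k, hm, h⟩ := mem_family4_iff.1 hL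
  by_cases hk : k = 0
  · refine family1_subset (mem_family1_iff.2 ⟨m, fun n => (h n).trans ?_⟩)
    constructor
    · rintro ⟨i, hi, rfl⟩; omega
    · rintro rfl; exact ⟨0, by omega, rfl⟩
  refine mem_lengthSystem_of_theta (x := 0) (y := 2 * k) (z := 2 * k) (by omega) (m - 2 * k)
    fun n => (h n).trans ?_
  rw [lengthSet_theta_le_one (by omega) (by omega) (by omega) (by omega) (by omega) rfl, zero_add,
    min_self, show 2 * k / 2 = k by omega,
    show (2 * 0 + 3 * (2 * k) + 2 * k + 2 * (m - 2 * k) - 0 - 2 * (2 * k)) / 2 = m by omega]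

theorem family6_subset {L : Set ℕ} (hL : L ∈ family6) :
    L ∈ lengthSystem (zeroSumSequences E4) := by
  obtain ⟨m, k, hk, hm, h⟩ := mem_family6_iff.1 hL
  -- With $i=\lceil k/3\rceil$ and $d=3i-k$, the parameters below satisfy $y=x+z$ and $3x+2z=2k+4$.
  -- The condition $d<i$ ensures $x\ge 2$; among positive $k$ it fails only for $1,2,4$.
  obtain ⟨i, d, hik, hd, hi, hid⟩ : ∃ i d, k + d = 3 * i ∧ d ≤ 2 ∧ (k + 2) / 3 = i ∧ d < i :=
    ⟨(k + 2) / 3, 3 * ((k + 2) / 3) - k, by omega, by omega, rfl, by omega⟩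
  rw [hi] at hm
  refine mem_lengthSystem_of_theta (x := 2 * i - 2 * d) (y := 2 * i + 2) (z := 2 + 2 * d)
    (by omega) (m - (2 * i + 2)) fun n => (h n).trans ?_
  rw [lengthSet_theta_large (k := k) (by omega) (by omega) (by omega) (by omega) (by omega)
    (by omega) (by omega)]
  have : (2 * (2 * i - 2 * d) + 3 * (2 * i + 2) + (2 + 2 * d) + 2 * (m - (2 * i + 2)) -
      3 * (2 * i - 2 * d) - 2 * (2 + 2 * d)) / 2 = m := by omega
  rw [this]

theorem family7_subset {L : Set ℕ} (hL : L ∈ family7) :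
    L ∈ lengthSystem (zeroSumSequences E4) := by
  rcases mem_family7_iff.1 hL with ⟨m, k, hm, h⟩ | ⟨m, k, hm, h⟩
  · refine mem_lengthSystem_of_theta (x := 2 * k + 3) (y := 2 * k + 2) (z := 1) (by omega)
      (m - (2 * k + 3)) fun n => (h n).trans ?_
    rw [lengthSet_theta_odd_gt (by omega) (by omega) (by omega) (by omega),
      show (2 * (2 * k + 3) + 3 * (2 * k + 2) + 1 + 2 * (m - (2 * k + 3)) - 6 * k - 7) / 2 = m by
        omega]
  · refine mem_lengthSystem_of_theta (x := 2 * k + 4) (y := 2 * k + 3) (z := 1) (by omega)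
      (m - (2 * k + 4)) fun n => (h n).trans ?_
    rw [lengthSet_theta_even_gt (by omega) (by omega) (by omega) (by omega),
      show (2 * (2 * k + 4) + 3 * (2 * k + 3) + 1 + 2 * (m - (2 * k + 4)) - 6 * k - 10) / 2 = m by
        omega]

theorem family8_subset {L : Set ℕ} (hL : L ∈ family8) :
    L ∈ lengthSystem (zeroSumSequences E4) := by
  rcases mem_family8_iff.1 hL with ⟨m, k, hm, h⟩ | ⟨m, k, hm, h⟩
  · refine mem_lengthSystem_of_theta (x := 2 * k + 2) (y := 2 * k + 3) (z := 1) (by omega)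
      (m - (2 * k + 3)) fun n => (h n).trans ?_
    rw [lengthSet_theta_even_lt (by omega) (by omega) (by omega) (by omega),
      show (2 * (2 * k + 2) + 3 * (2 * k + 3) + 1 + 2 * (m - (2 * k + 3)) - 6 * k - 8) / 2 = m by
        omega]
  · refine mem_lengthSystem_of_theta (x := 2 * k + 3) (y := 2 * k + 4) (z := 1) (by omega)
      (m - (2 * k + 4)) fun n => (h n).trans ?_
    rw [lengthSet_theta_odd_lt (by omega) (by omega) (by omega) (by omega),
      show (2 * (2 * k + 3) + 3 * (2 * k + 4) + 1 + 2 * (m - (2 * k + 4)) - 6 * k - 11) / 2 = m by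
        omega]

/-! ### Realization of intervals -/

/-- Multiplication by $U^{2i}$ with $|U|=5$ adds $10i$ elements and makes weights $0,6,\dots,6i$
available. The hypothesis $c\ge 2$ fills the space between these jumps, and `hcard` makes $5w\le
3|A|$ rule out any larger weight. -/
theorem mem_lengthSystem_of_interval {B : Multiset E4} (h0 : (0 : E4) ∉ B) {a c : ℕ} (i : ℕ)
    (hc : 2 ≤ c) (hB : ∀ e ≤ c, HasWeight B (a + 2 * e))
    (hcard : 3 * B.card < 5 * (a + 2 * c + 2))
    (hlow : ∀ w, HasWeight (B + 2 • (i • thetaFive.val)) w → a ≤ w) {L : Set ℕ} {m j : ℕ}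
    (hm : 2 * m + a + 2 * c = B.card + 4 * i + 2 * j)
    (hL : ∀ n, n ∈ L ↔ m ≤ n ∧ n ≤ m + c + 3 * i) : L ∈ lengthSystem (zeroSumSequences E4) := by
  set A := B + 2 • (i • thetaFive.val) with hA
  have c5 : thetaFive.card = 5 := by decide +kernel
  have hAc : A.card = B.card + 10 * i := by
    rw [hA, Multiset.card_add, Multiset.card_nsmul, Multiset.card_nsmul, Finset.card_val, c5]; ring
  have hU : ∀ r ≤ i, HasWeight (2 • (i • thetaFive.val)) (6 * r) := by
    intro r hr
    refine ⟨Multiset.replicate (2 * r) thetaFive, (i - r) • thetaFive.val, ?_, ?_, ?_⟩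
    · intro C hC
      rw [Multiset.eq_of_mem_replicate hC]
      exact isCircuit_thetaFive
    · rw [cover_replicate, mul_smul, ← smul_add, ← add_smul, Nat.add_sub_cancel' hr]
    · rw [weight_replicate, c5]; omega
  have hW : ∀ e ≤ c + 3 * i, HasWeight A (a + 2 * e) := by
    intro e he
    obtain ⟨r, e', hr, he', h⟩ : ∃ r e', r ≤ i ∧ e' ≤ c ∧ e = e' + 3 * r := by
      by_cases hec : e ≤ c
      · exact ⟨0, e, by omega, hec, by omega⟩
      · exact ⟨(e - c + 2) / 3, e - 3 * ((e - c + 2) / 3), by omega, by omega, by omega⟩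
    have := (hB e' he').add (hU r hr)
    rwa [show a + 2 * e' + 6 * r = a + 2 * e by omega] at this
  have hcB := (hB 0 (by omega)).mod_two
  have hmem : ∀ w, HasWeight A w ↔ ∃ e ≤ c + 3 * i, w = a + 2 * e := by
    intro w
    constructor
    · intro hw
      have h1 := hlow w hw
      have h2 := hw.five_mul_le
      have h3 := hw.mod_two
      exact ⟨(w - a) / 2, by omega, by omega⟩
    · rintro ⟨e, he, rfl⟩
      exact hW e he
  rw [mem_lengthSystem_iff]
  refine ⟨A, j, ?_, (hW 0 (by omega)).sum_eq, ?_⟩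
  · rw [hA, Multiset.mem_add]
    rintro (h | h)
    · exact h0 h
    · exact isCircuit_thetaFive.zero_notMem
        (Multiset.mem_of_mem_nsmul (Multiset.mem_of_mem_nsmul h))
  · ext n
    rw [hL]
    simp only [lengthSet, Set.mem_ofPred_eq, hmem]
    constructor
    · intro h
      exact ⟨_, ⟨m + c + 3 * i - n, by omega, rfl⟩, by omega⟩
    · rintro ⟨w, ⟨e, he, rfl⟩, h⟩
      omega

theorem hasWeight_codes (p : List Bool) (k : ℕ) (A : List ℕ) (w : ℕ)
    (h : (decide (3 ≤ k) && (decide (k ≤ 5) && ((A.all fun n => memb n (List.range' 1 15)) &&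
      (Nat.beq (xorSum A) 0 && (searchPattern p k A && Nat.beq w (patternWeight p + (k - 2)))))))
        = true) : HasWeight (A.map dec : List E4) w := by
  simp only [Bool.and_eq_true, decide_eq_true_eq, List.all_eq_true, memb_iff, Nat.beq_eq] at h
  obtain ⟨h1, h2, h3, h4, h5, rfl⟩ := h
  refine hasWeight_of_searchPattern p k h1 h2 A h3 ?_ h5
  rw [← dec_xorSum, h4, dec_zero]

/-- Two circuits with five elements which share three elements. -/
def twoFive : List ℕ := [1, 2, 4, 8, 15, 1, 2, 4, 9, 14]

theorem zero_notMem_codes {A : List ℕ} (h : (A.all fun n => memb n (List.range' 1 15)) = true) :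
    (0 : E4) ∉ ((A.map dec : List E4) : Multiset E4) := by
  rw [Multiset.mem_coe, List.mem_map]
  rintro ⟨n, hn, h0⟩
  exact dec_ne_zero (memb_iff.1 (List.all_eq_true.1 h n hn)) h0

theorem HasWeight.codes_append {A B : List ℕ} {v w : ℕ}
    (hA : HasWeight (A.map dec : List E4) v) (hB : HasWeight (B.map dec : List E4) w) :
    HasWeight ((A ++ B).map dec : List E4) (v + w) := by
  rw [List.map_append, ← Multiset.coe_add]
  exact hA.add hB

theorem hasWeight_codes_zero {A : List ℕ} (h : oddPart A = []) :
    HasWeight (A.map dec : List E4) 0 := by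
  obtain ⟨R, hR⟩ := exists_oddPart_add A
  rw [h] at hR
  rw [← Multiset.map_coe, ← hR, Multiset.map_add, Multiset.map_nsmul]
  simpa using HasWeight.squares (R.map dec)

theorem hasWeight_twoFive {e : ℕ} (he : e ≤ 2) :
    HasWeight (twoFive.map dec : List E4) (2 + 2 * e) := by
  interval_cases e
  · exact hasWeight_codes [] 4 _ _ (by decide +kernel)
  · exact hasWeight_codes [false] 4 _ _ (by decide +kernel)
  · exact (hasWeight_codes [] 5 [1, 2, 4, 8, 15] 3 (by decide +kernel)).codes_append
      (hasWeight_codes [] 5 [1, 2, 4, 9, 14] 3 (by decide +kernel))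

/-- The appended circuit is the symmetric difference of the two five-element circuits, so the whole
sequence is a square and weight 0 becomes available. -/
theorem hasWeight_twoFive_append {e : ℕ} (he : e ≤ 4) :
    HasWeight ((twoFive ++ [8, 15, 9, 14]).map dec : List E4) (0 + 2 * e) := by
  interval_cases e
  · exact hasWeight_codes_zero (by decide +kernel)
  · exact hasWeight_codes [true] 3 _ _ (by decide +kernel)
  · exact hasWeight_codes [false] 4 _ _ (by decide +kernel)
  · exact (hasWeight_twoFive (e := 1) (by norm_num)).codes_append
      (hasWeight_codes [] 4 [8, 15, 9, 14] 2 (by decide +kernel))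
  · exact (hasWeight_twoFive (e := 2) (by norm_num)).codes_append
      (hasWeight_codes [] 4 [8, 15, 9, 14] 2 (by decide +kernel))

theorem hasWeight_twoFive_twoFive {e : ℕ} (he : e ≤ 6) :
    HasWeight ((twoFive ++ twoFive).map dec : List E4) (0 + 2 * e) := by
  by_cases h0 : e = 0
  · subst h0; exact hasWeight_codes_zero (by decide +kernel)
  by_cases h1 : e = 1
  · subst h1; exact hasWeight_codes [true] 3 _ _ (by decide +kernel)
  have := (hasWeight_twoFive (e := (e - 2) / 2) (by omega)).codes_append
    (hasWeight_twoFive (e := (e - 1) / 2) (by omega))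
  rwa [show 2 + 2 * ((e - 2) / 2) + (2 + 2 * ((e - 1) / 2)) = 0 + 2 * e by omega] at this

theorem family3_subset {L : Set ℕ} (hL : L ∈ family3) :
    L ∈ lengthSystem (zeroSumSequences E4) := by
  obtain ⟨m, k, hk, hm, hk1, hk3, h⟩ := mem_family3_iff.1 hL
  by_cases h1 : k = 1
  · subst h1
    refine mem_lengthSystem_of_theta (x := 2) (y := 0) (z := 2) rfl (m - 2)
      fun n => (h n).trans ?_
    rw [mem_lengthSet_theta]
    constructor
    · intro h
      exact ⟨2 * m + 2 - 2 * n, 0, by omega, by omega, by omega, by omega, by omega, by omega,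
        by omega⟩
    · rintro ⟨p, q, h⟩; omega
  by_cases h3 : k = 3
  · subst h3
    refine mem_lengthSystem_of_theta (x := 2) (y := 2) (z := 2) rfl (m - 3)
      fun n => (h n).trans ?_
    rw [mem_lengthSet_theta]
    constructor
    · intro h
      exact ⟨2 * ((m + 3 - n) % 2), 2 * ((m + 3 - n) / 2), by omega, by omega, by omega, by omega,
        by omega, by omega, by omega⟩
    · rintro ⟨p, q, h⟩; omega
  -- One base sequence for each residue of $k$ modulo 3, with $(k,m)=(2,2),(4,3),(6,4)$. Each factor
  -- $U^2$ adds $(3,2)$, so the minimum stays at $\lceil 2k/3\rceil$.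
  obtain ⟨i, hi⟩ : ∃ i, k = 2 + 3 * i ∨ k = 4 + 3 * i ∨ k = 6 + 3 * i :=
    ⟨if k % 3 = 2 then (k - 2) / 3 else if k % 3 = 1 then (k - 4) / 3 else (k - 6) / 3, by
      split_ifs <;> omega⟩
  rcases hi with hi | hi | hi
  · refine mem_lengthSystem_of_interval (B := (twoFive.map dec : List E4)) (a := 2) (c := 2)
      (j := m - (2 * i + 2)) (zero_notMem_codes (by decide +kernel)) i le_rfl
      (fun e he => hasWeight_twoFive he) (by simp [twoFive]) ?_ (m := m) ?_ ?_
    -- Weight 0 would make `A` a square, but `dec 8` has odd multiplicity.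
    · intro w hw
      by_contra hlt
      have hp := hw.mod_two
      rw [Multiset.card_add, Multiset.card_nsmul, Multiset.coe_card] at hp
      have h10 : (twoFive.map dec).length = 10 := by simp [twoFive]
      have hw0 : w = 0 := by omega
      subst hw0
      obtain ⟨F, R, hF, hA, hw⟩ := hw
      have hF0 : F = 0 := Multiset.card_eq_zero.1 (by have := card_le_weight hF; omega)
      have hc := congrArg (Multiset.count (dec 8)) hA
      rw [hF0, cover_zero, zero_add, Multiset.count_nsmul, Multiset.count_add,
        Multiset.count_nsmul, Multiset.coe_count,
        show (twoFive.map dec).count (dec 8) = 1 by decide +kernel] at hc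
      omega
    · have : (((twoFive.map dec : List E4)) : Multiset E4).card = 10 := by simp [twoFive]
      omega
    · intro n; rw [h, hi]; omega
  · refine mem_lengthSystem_of_interval (B := ((twoFive ++ [8, 15, 9, 14]).map dec : List E4))
      (a := 0) (c := 4) (j := m - (2 * i + 3)) (zero_notMem_codes (by decide +kernel)) i
      (by norm_num) (fun e he => hasWeight_twoFive_append he) (by simp [twoFive])
      (fun w _ => Nat.zero_le w) (m := m) ?_ ?_
    · have : ((((twoFive ++ [8, 15, 9, 14]).map dec : List E4)) : Multiset E4).card = 14 := by
        simp [twoFive]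
      omega
    · intro n; rw [h, hi]; omega
  · refine mem_lengthSystem_of_interval (B := ((twoFive ++ twoFive).map dec : List E4))
      (a := 0) (c := 6) (j := m - (2 * i + 4)) (zero_notMem_codes (by decide +kernel)) i
      (by norm_num) (fun e he => hasWeight_twoFive_twoFive he) (by simp [twoFive])
      (fun w _ => Nat.zero_le w) (m := m) ?_ ?_
    · have : ((((twoFive ++ twoFive).map dec : List E4)) : Multiset E4).card = 20 := by
        simp [twoFive]
      omega
    · intro n; rw [h, hi]; omega

/-! ### Realization of intervals with a gap before the maximum -/

/-- A sequence over three parallel pairs of elements of an affine hyperplane. -/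
def pairsSeq (x y z : ℕ) : Multiset E4 :=
  x • {dec 1, dec 2} + y • {dec 4, dec 7} + z • {dec 8, dec 11}

theorem mem_pairsSeq {x y z : ℕ} {a : E4} (ha : a ∈ pairsSeq x y z) :
    ∃ n ∈ [1, 2, 4, 7, 8, 11], a = dec n := by
  simp only [pairsSeq, Multiset.mem_add] at ha
  rcases ha with (h | h) | h <;> have h := Multiset.mem_of_mem_nsmul h <;>
    simp only [Multiset.insert_eq_cons, Multiset.mem_cons, Multiset.mem_singleton] at h <;>
    rcases h with rfl | rfl <;> exact ⟨_, by decide, rfl⟩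

/-- Each of the six codes has an odd number of binary digits 1, so a zero-sum set of such elements
has even size. -/
theorem circuitCodes_pairs : ([3, 5].all fun n => (circuitCodes n).all fun l =>
    !(l.all fun k => memb k [1, 2, 4, 7, 8, 11])) = true := by
  decide +kernel

theorem card_eq_four_of_subset_pairsSeq {x y z : ℕ} {C : Finset E4} (hC : IsCircuit C)
    (h : ∀ a ∈ C, a ∈ pairsSeq x y z) : C.card = 4 := by
  by_contra hne
  obtain ⟨l, hl, hr, hv⟩ := hC.exists_codes (AddEquiv.refl E4)
  have hcard : C.card ∈ [3, 5] := by
    have := hC.three_le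
    have := hC.le_five
    simp only [List.mem_cons, List.not_mem_nil, or_false]; omega
  have key := List.all_eq_true.1 (List.all_eq_true.1 circuitCodes_pairs _ hcard) l hl
  have hall : (l.all fun k => memb k [1, 2, 4, 7, 8, 11]) = true := by
    rw [List.all_eq_true]
    intro k hk
    rw [memb_iff]
    obtain ⟨n, hn, e⟩ := mem_pairsSeq (h (dec k) (by
      rw [← Finset.mem_val, hv]; exact mem_coded hk))
    have hn' : ∀ n ∈ [1, 2, 4, 7, 8, 11], n ∈ List.range' 1 15 := by decide
    rwa [dec_injOn (hr k hk) (hn' n hn) e]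
  rw [hall] at key
  exact absurd key (by decide)

/-- All three pairs have the sum `dec 3`, so any two of them form a circuit; $s,t,u$ count these
three circuits. -/
theorem hasWeight_pairsSeq {s t u a b c : ℕ} :
    HasWeight (pairsSeq (s + t + 2 * a) (s + u + 2 * b) (t + u + 2 * c)) (2 * (s + t + u)) := by
  have h1 : IsCircuit ({dec 1, dec 2, dec 4, dec 7} : Finset E4) :=
    ⟨by decide +kernel, by decide +kernel, by decide +kernel, by decide +kernel⟩
  have h2 : IsCircuit ({dec 1, dec 2, dec 8, dec 11} : Finset E4) :=
    ⟨by decide +kernel, by decide +kernel, by decide +kernel, by decide +kernel⟩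
  have h3 : IsCircuit ({dec 4, dec 7, dec 8, dec 11} : Finset E4) :=
    ⟨by decide +kernel, by decide +kernel, by decide +kernel, by decide +kernel⟩
  have v1 : ({dec 1, dec 2, dec 4, dec 7} : Finset E4).val =
    ({dec 1, dec 2} : Multiset E4) + {dec 4, dec 7} := by decide +kernel
  have v2 : ({dec 1, dec 2, dec 8, dec 11} : Finset E4).val =
    ({dec 1, dec 2} : Multiset E4) + {dec 8, dec 11} := by decide +kernel
  have v3 : ({dec 4, dec 7, dec 8, dec 11} : Finset E4).val =
    ({dec 4, dec 7} : Multiset E4) + {dec 8, dec 11} := by decide +kernel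
  have c1 : ({dec 1, dec 2, dec 4, dec 7} : Finset E4).card = 4 := by decide +kernel
  have c2 : ({dec 1, dec 2, dec 8, dec 11} : Finset E4).card = 4 := by decide +kernel
  have c3 : ({dec 4, dec 7, dec 8, dec 11} : Finset E4).card = 4 := by decide +kernel
  refine ⟨Multiset.replicate s {dec 1, dec 2, dec 4, dec 7} +
    Multiset.replicate t {dec 1, dec 2, dec 8, dec 11} +
    Multiset.replicate u {dec 4, dec 7, dec 8, dec 11},
    a • {dec 1, dec 2} + b • {dec 4, dec 7} + c • {dec 8, dec 11}, ?_, ?_, ?_⟩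
  · intro C hC
    simp only [Multiset.mem_add] at hC
    rcases hC with (h | h) | h
    · rw [Multiset.eq_of_mem_replicate h]; exact h1
    · rw [Multiset.eq_of_mem_replicate h]; exact h2
    · rw [Multiset.eq_of_mem_replicate h]; exact h3
  · rw [cover_add, cover_add, cover_replicate, cover_replicate, cover_replicate, v1, v2, v3]
    simp only [pairsSeq, add_smul, smul_add, mul_smul]
    abel
  · rw [weight_add, weight_add, weight_replicate, weight_replicate, weight_replicate, c1, c2, c3]
    ring

theorem family5_subset {L : Set ℕ} (hL : L ∈ family5) :
    L ∈ lengthSystem (zeroSumSequences E4) := by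
  obtain ⟨m, k, hk, hm, h⟩ := mem_family5_iff.1 hL
  -- The multiplicities $x,y$ are even and as equal as possible with $x+y=2k+2$. The $4k+8$ elements
  -- bound the weight by $2(k+2)$.
  set x := 2 * ((k + 2) / 2) with hx
  set y := 2 * ((k + 1) / 2) with hy
  have hcard : (pairsSeq x y 2).card = 4 * k + 8 := by
    simp only [pairsSeq, Multiset.card_add, Multiset.card_nsmul, Multiset.insert_eq_cons,
      Multiset.card_cons, Multiset.card_singleton]
    omega
  have h4 : ∀ C, IsCircuit C → (∀ a ∈ C, a ∈ pairsSeq x y 2) → C.card = 4 :=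
    fun C hC hCs => card_eq_four_of_subset_pairsSeq hC hCs
  have hmem : ∀ w, HasWeight (pairsSeq x y 2) w ↔ ∃ e ≤ k + 2, e ≠ 1 ∧ w = 2 * e := by
    intro w
    constructor
    · intro hw
      have h1 := two_mul_weight_le h4 hw
      have h2 := hw.mod_two
      refine ⟨w / 2, by omega, ?_, by omega⟩
      intro hw1
      have hw2 : w = 2 := by omega
      subst hw2
      -- Weight 2 means a single circuit, whose elements would have odd multiplicity, while all
      -- multiplicities are even.
      obtain ⟨F, R, hF, hA, hwt⟩ := hw
      have hF4 : ∀ C ∈ F, C.card = 4 := fun C hC => h4 C (hF C hC) fun a ha => by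
        rw [← hA]; exact Multiset.mem_add.2 (Or.inl (mem_cover.2 ⟨C, hC, ha⟩))
      obtain ⟨C, hC⟩ : ∃ C, C ∈ F := by
        by_contra hno
        push Not at hno
        rw [Multiset.eq_zero_of_forall_notMem hno] at hwt
        simp at hwt
      obtain ⟨F', rfl⟩ := Multiset.exists_cons_of_mem hC
      rw [weight_cons, hF4 C hC] at hwt
      have hF' : F' = 0 := Multiset.card_eq_zero.1 (by
        have := card_le_weight (F := F') fun D hD => hF D (Multiset.mem_cons_of_mem hD)
        omega)
      obtain ⟨a, ha⟩ : C.Nonempty := by rw [← Finset.card_pos, hF4 C hC]; norm_num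
      have hc := congrArg (Multiset.count a) hA
      rw [hF', cover_cons, cover_zero, add_zero, Multiset.count_add, Multiset.count_nsmul,
        Multiset.count_eq_one_of_mem C.nodup ha, pairsSeq, Multiset.count_add, Multiset.count_add,
        Multiset.count_nsmul, Multiset.count_nsmul, Multiset.count_nsmul, hx, hy, mul_assoc,
        mul_assoc] at hc
      omega
    · rintro ⟨e, he, he1, rfl⟩
      by_cases he0 : e = 0
      · have := hasWeight_pairsSeq (s := 0) (t := 0) (u := 0) (a := (k + 2) / 2)
          (b := (k + 1) / 2) (c := 1)
        subst he0
        simpa [hx, hy] using this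
      -- The third pair is used up by two circuits: both with the first pair if $e$ is even, one
      -- with each of the other pairs if $e$ is odd.
      rcases Nat.mod_two_eq_zero_or_one e with hpar | hpar
      · have := hasWeight_pairsSeq (s := e - 2) (t := 2) (u := 0) (a := (x - e) / 2)
          (b := (y - (e - 2)) / 2) (c := 0)
        rwa [show e - 2 + 2 + 2 * ((x - e) / 2) = x by omega,
          show e - 2 + 0 + 2 * ((y - (e - 2)) / 2) = y by omega,
          show 2 * (e - 2 + 2 + 0) = 2 * e by omega] at this
      · have := hasWeight_pairsSeq (s := e - 2) (t := 1) (u := 1) (a := (x - (e - 1)) / 2)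
          (b := (y - (e - 1)) / 2) (c := 0)
        rwa [show e - 2 + 1 + 2 * ((x - (e - 1)) / 2) = x by omega,
          show e - 2 + 1 + 2 * ((y - (e - 1)) / 2) = y by omega,
          show 2 * (e - 2 + 1 + 1) = 2 * e by omega] at this
  rw [mem_lengthSystem_iff]
  refine ⟨pairsSeq x y 2, m - (k + 2), ?_, ((hmem 0).2 ⟨0, by omega, by omega, rfl⟩).sum_eq, ?_⟩
  · intro h0
    obtain ⟨n, hn, e⟩ := mem_pairsSeq h0
    have hn' : ∀ n ∈ [1, 2, 4, 7, 8, 11], n ∈ List.range' 1 15 := by decide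
    exact dec_ne_zero (hn' n hn) e.symm
  · ext n
    rw [h, hcard]
    simp only [lengthSet, Set.mem_ofPred_eq, hmem]
    constructor
    · intro hn
      exact ⟨_, ⟨m + k + 2 - n, by omega, by omega, rfl⟩, by omega⟩
    · rintro ⟨w, ⟨e, he, he1, rfl⟩, hn⟩
      omega

theorem lengthSystem_eq : lengthSystem (zeroSumSequences E4) = families := by
  ext L
  constructor
  · intro hL
    obtain ⟨B, y, h0, hs, rfl⟩ := mem_lengthSystem_iff.1 hL
    exact lengthSet_mem_families h0 hs y
  · rw [mem_families_iff]
    rintro (h | h | h | h | h | h | h | h)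
    · exact family1_subset h
    · exact family2_subset h
    · exact family3_subset h
    · exact family4_subset h
    · exact family5_subset h
    · exact family6_subset h
    · exact family7_subset h
    · exact family8_subset h

end SetsOfLengths

theorem theorem4p8 :
    SetsOfLengths.lengthSystem (SetsOfLengths.zeroSumSequences (Fin 4 → ZMod 2)) =
      SetsOfLengths.family1 ∪ SetsOfLengths.family2 ∪ SetsOfLengths.family3 ∪
      SetsOfLengths.family4 ∪ SetsOfLengths.family5 ∪ SetsOfLengths.family6 ∪
      SetsOfLengths.family7 ∪ SetsOfLengths.family8 ∧
    SetsOfLengths.family3 = SetsOfLengths.family3' := by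
  refine ⟨SetsOfLengths.lengthSystem_eq, ?_⟩
  ext L
  rw [SetsOfLengths.mem_family3_iff, SetsOfLengths.mem_family3'_iff]
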